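/- Let $k$ be a commutative ring and let $\mathcal{A}=(A=\bigoplus_{i\in\mathbb{Z}}A^i,d)$ be a differential graded (associative, unital) $k$-algebra such that $A^i=0$ for $i<0$, the ring $A^0$ is semisimple, and $d(A^0)=0$. Let $A^+=\bigoplus_{i>0}A^i$. Let $\mathrm{dgMod}$ be the category of right dg $\mathcal{A}$-modules and $\mathrm{dgHot}$ its homotopy category, with shift $(\{1\}M)^i=M^{i+1}$, $d_{\{1\}M}=-d_M$, and the triangulated structure given by mapping cones. Let $\mathrm{dgPer}\subset\mathrm{dgHot}$ be the smallest full triangulated subcategory that contains $\mathcal{A}$ and is closed under direct summands. For a dg module $M$ put $\overline{M}=M/MA^+=M\otimes_{\mathcal{A}}\mathcal{A}^0$, where $\mathcal{A}^0$ denotes $A^0$ regarded as a dg algebra concentrated in degree $0$. Let $\heartsuit$ be the full subcategory of $\mathrm{dgHot}$ whose objects are the $M\in\mathrm{dgPer}$ with $H^i(\overline{M})=0$ for all $i\neq 0$. Let $(L_x)_{x\in W}$ represent the isomorphism classes of simple right $A^0$-modules and put $\hat L_x=L_x\otimes_{A^0}\mathcal{A}$, with differential $l\otimes a\mapsto l\otimes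 d(a)$; these dg modules are objects of $\heartsuit$. Let $I$ be an object of $\heartsuit$ such that 1. $H^1(I)=0$, and 2. for every $x\in W$ there is a monomorphism $\hat L_x\to I$ in $\heartsuit$. Then, for every $M\in\heartsuit$, the left $\operatorname{End}_{\heartsuit}(I)$-module $\operatorname{Hom}_{\heartsuit}(M,I)$ is finitely generated, and the functor $$\operatorname{Hom}_{\heartsuit}(?,I)\colon\ \heartsuit\longrightarrow\big(\operatorname{End}_{\heartsuit}(I)\text{-}\mathrm{mof}\big)^{\mathrm{op}}$$ is an equivalence between $\heartsuit$ and the opposite of the category of finitely generated left $\operatorname{End}_{\heartsuit}(I)$-modules. -/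

import Mathlib

open CategoryTheory
open scoped TensorProduct MulOpposite

universe w u

noncomputable section

/-- A differential graded `k`-algebra: a `ℤ`-graded associative unital `k`-algebra with a
`k`-linear differential of degree `1` satisfying the graded Leibniz rule. -/
structure DGAlgebra (k : Type w) [CommRing k] where
  carrier : Type u
  [ring : Ring carrier]
  [algebra : Algebra k carrier]
  gr : ℤ → Submodule k carrier
  [graded : GradedAlgebra gr]
  diff : carrier →ₗ[k] carrier
  diff_mem : ∀ (i : ℤ) (a : carrier), a ∈ gr i → diff a ∈ gr (i + 1)
  diff_diff : ∀ a : carrier, diff (diff a) = 0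
  leibniz : ∀ (i : ℤ) (a b : carrier), a ∈ gr i →
    diff (a * b) = diff a * b + i.negOnePow • (a * diff b)

attribute [instance] DGAlgebra.ring DGAlgebra.algebra DGAlgebra.graded

namespace DGAlgebra

variable {k : Type w} [CommRing k] (R : DGAlgebra.{w, u} k)

/-- The multiplication `A^i × A^j → A^n` for `i + j = n`. -/
def mul {i j n : ℤ} (h : i + j = n) : R.gr i →+ R.gr j →+ R.gr n :=
  AddMonoidHom.mk' (fun a => AddMonoidHom.mk'
      (fun b => ⟨(a : R.carrier) * b, h ▸ SetLike.mul_mem_graded a.2 b.2⟩)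
      (fun b b' => by ext; simp [mul_add])) (fun a a' => by ext; simp [add_mul])

/-- The differential `A^i → A^j` for `i + 1 = j`. -/
def d {i j : ℤ} (h : i + 1 = j) : R.gr i →+ R.gr j where
  toFun a := ⟨R.diff a, h ▸ R.diff_mem i a a.2⟩
  map_zero' := by ext; simp
  map_add' a b := by ext; simp

@[simp] lemma coe_mul {i j n : ℤ} (h : i + j = n) (a : R.gr i) (b : R.gr j) :
    ((R.mul h a b : R.gr n) : R.carrier) = a * b := rfl

@[simp] lemma coe_d {i j : ℤ} (h : i + 1 = j) (a : R.gr i) :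
    ((R.d h a : R.gr j) : R.carrier) = R.diff a := rfl

/-- The standing conditions on the dg algebra: it is positively graded, its degree zero part is a
semisimple ring, and the differential vanishes on the degree zero part. -/
class Admissible : Prop where
  positive : ∀ i : ℤ, i < 0 → R.gr i = ⊥
  semisimple : IsSemisimpleRing (R.gr 0)
  diff_zero : ∀ a ∈ R.gr 0, R.diff a = 0

end DGAlgebra

/-- A right dg module over the dg algebra `R`, given by its homogeneous components `X i`, the
biadditive action maps `X^i × A^j → X^n` for `i + j = n`, and the differential `X^i → X^j` for
`i + 1 = j`. (The action of `k` is the one induced by `k → A^0`; the differential is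
automatically `k`-linear, since the differential of `A` vanishes on the image of `k`.) -/
structure DGMod {k : Type w} [CommRing k] (R : DGAlgebra.{w, u} k) where
  X : ℤ → Type u
  [grp : ∀ i, AddCommGroup (X i)]
  act : ∀ {i j n : ℤ} (_ : i + j = n), X i →+ R.gr j →+ X n
  d : ∀ {i j : ℤ} (_ : i + 1 = j), X i →+ X j
  act_one : ∀ {i : ℤ} (x : X i), act (add_zero i) x (1 : R.gr 0) = x
  act_act : ∀ {i j l p q n : ℤ} (hij : i + j = p) (hpl : p + l = n) (hjl : j + l = q)
    (hiq : i + q = n) (x : X i) (a : R.gr j) (b : R.gr l),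
    act hpl (act hij x a) b = act hiq x (R.mul hjl a b)
  d_d : ∀ {i j l : ℤ} (hij : i + 1 = j) (hjl : j + 1 = l) (x : X i), d hjl (d hij x) = 0
  d_act : ∀ {i j n i' j' n' : ℤ} (h : i + j = n) (hn : n + 1 = n') (hi : i + 1 = i')
    (hj : j + 1 = j') (hl : i' + j = n') (hr : i + j' = n') (x : X i) (a : R.gr j),
    d hn (act h x a) = act hl (d hi x) a + i.negOnePow • act hr x (R.d hj a)

attribute [instance] DGMod.grp

namespace DGMod

variable {k : Type w} [CommRing k] {R : DGAlgebra.{w, u} k}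

/-- Morphisms of dg modules: homogeneous of degree zero, `A`-linear, compatible with the
differentials. -/
@[ext]
structure Hom (M N : DGMod R) where
  f : ∀ i : ℤ, M.X i →+ N.X i
  map_act : ∀ {i j n : ℤ} (h : i + j = n) (x : M.X i) (a : R.gr j),
    f n (M.act h x a) = N.act h (f i x) a
  map_d : ∀ {i j : ℤ} (h : i + 1 = j) (x : M.X i), f j (M.d h x) = N.d h (f i x)

/-- The category `dgMod` of dg modules. -/
instance : Category (DGMod R) where
  Hom M N := Hom M N
  id M := ⟨fun _ => AddMonoidHom.id _, fun _ _ _ => rfl, fun _ _ => rfl⟩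
  comp f g := ⟨fun i => (g.f i).comp (f.f i), fun h x a => by simp [f.map_act, g.map_act],
    fun h x => by simp [f.map_d, g.map_d]⟩

@[ext] lemma hom_ext {M N : DGMod R} {f g : M ⟶ N} (h : ∀ i x, f.f i x = g.f i x) : f = g :=
  Hom.ext (funext fun i => AddMonoidHom.ext (h i))

@[simp] lemma id_f (M : DGMod R) (i : ℤ) (x : M.X i) : (𝟙 M : M ⟶ M).f i x = x := rfl

@[simp] lemma comp_f {M N P : DGMod R} (f : M ⟶ N) (g : N ⟶ P) (i : ℤ) (x : M.X i) :
    (f ≫ g).f i x = g.f i (f.f i x) := rfl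

section Additive

variable {M N : DGMod R}

instance : Zero (M ⟶ N) := ⟨⟨fun _ => 0, by simp, by simp⟩⟩

instance : Add (M ⟶ N) := ⟨fun f g => ⟨fun i => f.f i + g.f i,
  by simp [f.map_act, g.map_act], by simp [f.map_d, g.map_d]⟩⟩

instance : Neg (M ⟶ N) := ⟨fun f => ⟨fun i => -f.f i,
  by simp [f.map_act], by simp [f.map_d]⟩⟩

@[simp] lemma zero_f (i : ℤ) (x : M.X i) : (0 : M ⟶ N).f i x = 0 := rfl

@[simp] lemma add_f (f g : M ⟶ N) (i : ℤ) (x : M.X i) :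
    (f + g).f i x = f.f i x + g.f i x := rfl

@[simp] lemma neg_f (f : M ⟶ N) (i : ℤ) (x : M.X i) : (-f).f i x = -f.f i x := rfl

instance : AddCommGroup (M ⟶ N) where
  add_assoc f g h := by ext; simp [add_assoc]
  zero_add f := by ext; simp
  add_zero f := by ext; simp
  add_comm f g := by ext; simp [add_comm]
  neg_add_cancel f := by ext; simp
  nsmul := nsmulRec
  zsmul := zsmulRec

end Additive

instance : Preadditive (DGMod R) where
  add_comp _ _ _ f f' g := by ext; simp
  comp_add _ _ _ f g g' := by ext; simp

/-- A homotopy from `f` to `g`: an `A`-linear map `s` of degree `-1` with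
`f - g = d s + s d`. -/
structure Homotopy {M N : DGMod R} (f g : M ⟶ N) where
  s : ∀ {i j : ℤ} (_ : j + 1 = i), M.X i →+ N.X j
  s_act : ∀ {i j n i' n' : ℤ} (h : i + j = n) (hi : i' + 1 = i) (hn : n' + 1 = n)
    (h' : i' + j = n') (x : M.X i) (a : R.gr j), s hn (M.act h x a) = N.act h' (s hi x) a
  comm : ∀ {h i j : ℤ} (hi : h + 1 = i) (hj : i + 1 = j) (x : M.X i),
    f.f i x = g.f i x + (N.d hi (s hi x) + s hj (M.d hj x))

variable (R) in
/-- The homotopy relation on morphisms of dg modules. -/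
def homotopic : HomRel (DGMod R) := fun _ _ f g => Nonempty (Homotopy f g)

lemma homotopic_add {M N : DGMod R} (f f' g g' : M ⟶ N) (h : homotopic R f f')
    (h' : homotopic R g g') : homotopic R (f + g) (f' + g') := by
  obtain ⟨h⟩ := h
  obtain ⟨h'⟩ := h'
  exact ⟨{
    s := fun e => h.s e + h'.s e
    s_act := fun e hi hn e' x a => by simp [h.s_act e hi hn e', h'.s_act e hi hn e']
    comm := fun hi hj x => by
      simp only [add_f, h.comm hi hj, h'.comm hi hj, AddMonoidHom.add_apply, map_add]
      abel }⟩

instance : Congruence (homotopic R) where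
  comp_left {M N P} f {g g'} := fun ⟨h⟩ => ⟨{
    s := fun e => (h.s e).comp (f.f _)
    s_act := fun e hi hn e' x a => by simp [f.map_act, h.s_act e hi hn e']
    comm := fun hi hj x => by simp [h.comm hi hj, f.map_d] }⟩
  comp_right {M N P f f'} g := fun ⟨h⟩ => ⟨{
    s := fun e => (g.f _).comp (h.s e)
    s_act := fun e hi hn e' x a => by simp [g.map_act, h.s_act e hi hn e']
    comm := fun hi hj x => by simp [h.comm hi hj, g.map_d] }⟩
  equivalence {M N} :=
    { refl := fun f => ⟨{ s := fun _ => 0, s_act := by simp, comm := by simp }⟩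
      symm := fun {f g} ⟨h⟩ => ⟨{
        s := fun e => -h.s e
        s_act := fun e hi hn e' x a => by simp [h.s_act e hi hn e']
        comm := fun hi hj x => by
          simp only [h.comm hi hj, AddMonoidHom.neg_apply, map_neg]; abel }⟩
      trans := fun {f g l} ⟨h⟩ ⟨h'⟩ => ⟨{
        s := fun e => h.s e + h'.s e
        s_act := fun e hi hn e' x a => by simp [h.s_act e hi hn e', h'.s_act e hi hn e']
        comm := fun hi hj x => by
          simp only [h.comm hi hj, h'.comm hi hj, AddMonoidHom.add_apply, map_add]
          abel }⟩ }

variable (R) in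
/-- The homotopy category `dgHot` of dg modules. -/
abbrev Hot := CategoryTheory.Quotient (homotopic R)

instance : Preadditive (Hot R) :=
  CategoryTheory.Quotient.preadditive _ fun _ _ f g f' g' h h' => homotopic_add f g f' g' h h'

variable (R) in
/-- The canonical functor `dgMod ⥤ dgHot`. -/
abbrev toHot : DGMod R ⥤ Hot R := CategoryTheory.Quotient.functor (homotopic R)

variable (R) in
/-- The dg algebra as a right dg module over itself. -/
def free : DGMod R where
  X i := R.gr i
  act h := R.mul h
  d h := R.d h
  act_one x := by ext; simp
  act_act _ _ _ _ x a b := by ext; simp [mul_assoc]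
  d_d _ _ x := by ext; simp [R.diff_diff]
  d_act {i _ _ _ _ _} _ _ _ _ _ _ x a := by
    ext
    simp [R.leibniz i x a x.2, Units.smul_def]

/-- The shift `{n}M`, with components `({n}M)^i = M^(i+n)` and differential `(-1)^n d`. -/
def shift (n : ℤ) (M : DGMod R) : DGMod R where
  X i := M.X (i + n)
  act h := M.act (by omega)
  d h := n.negOnePow • M.d (by omega)
  act_one x := by
    have := M.act_one x
    exact this
  act_act _ _ hjl _ x a b := M.act_act _ _ hjl _ x a b
  d_d _ _ x := by simp [Units.smul_def, M.d_d]
  d_act {i j m i' j' m'} h hm hi hj hl hr x a := by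
    have e := M.d_act (by omega : i + n + j = m + n) (by omega : m + n + 1 = m' + n)
      (by omega : i + n + 1 = i' + n) hj (by omega) (by omega) x a
    have s : n.negOnePow * (i + n).negOnePow = i.negOnePow := by
      rw [Int.negOnePow_add, mul_left_comm, Int.units_mul_self, mul_one]
    simp only [AddMonoidHom.smul_apply, e, smul_add, smul_smul, s]
    simp [Units.smul_def]

/-- The mapping cone `N ⊕ {1}M` of `f : M ⟶ N`, with differential
`(y, x) ↦ (d y + f x, - d x)`. -/
def cone {M N : DGMod R} (f : M ⟶ N) : DGMod R where
  X i := N.X i × M.X (i + 1)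
  act {i j n} h := AddMonoidHom.mk' (fun x => AddMonoidHom.mk'
      (fun a => (N.act h x.1 a, M.act (by omega : i + 1 + j = n + 1) x.2 a))
      (fun a a' => Prod.ext (by simp) (by simp)))
      (fun x x' => AddMonoidHom.ext fun a => Prod.ext (by simp) (by simp))
  d {i j} h := AddMonoidHom.mk'
      (fun x => (N.d h x.1 + f.f j (h ▸ x.2), -M.d (by omega : i + 1 + 1 = j + 1) x.2))
      (fun x x' => by
        subst h
        exact Prod.ext (by simp only [Prod.fst_add, Prod.snd_add, map_add]; abel)
          (by simp only [Prod.snd_add, map_add]; abel))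
  act_one x := Prod.ext (N.act_one x.1) (by
    have := M.act_one x.2
    exact this)
  act_act _ _ hjl _ x a b := Prod.ext (N.act_act _ _ hjl _ x.1 a b)
    (M.act_act _ _ hjl _ x.2 a b)
  d_d hij hjl x := by
    subst hij hjl
    exact Prod.ext (by simp [N.d_d, f.map_d]) (by simp [M.d_d])
  d_act {i j m i' j' m'} h hm hi hj hl hr x a := by
    subst h hm hi hj
    have e := N.d_act rfl rfl rfl rfl hl hr x.1 a
    have e' := M.d_act (by omega : i + 1 + j = i + j + 1) rfl rfl rfl (by omega) (by omega) x.2 a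
    rw [Int.negOnePow_succ] at e'
    have key : ∀ (p : ℤ) (hp : p = i + j + 1) (h1 : i + 1 + j = p),
        f.f p (hp ▸ M.act (by omega : i + 1 + j = i + j + 1) x.2 a)
          = N.act h1 (f.f (i + 1) x.2) a := by
      intro p hp h1
      subst hp
      exact f.map_act _ _ _
    refine Prod.ext ?_ ?_
    · have := key _ rfl hl
      simp [e, this]
      simp only [Units.smul_def]
      abel
    · simp [e', Units.smul_def]
      abel

/-- The submodule `MA^+` in degree `n`: generated by the products `x a` with `a` homogeneous of
positive degree. -/
def plus (M : DGMod R) (n : ℤ) : AddSubgroup (M.X n) :=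
  AddSubgroup.closure {y | ∃ (i j : ℤ) (h : i + j = n) (_ : 0 < j) (x : M.X i) (a : R.gr j),
    y = M.act h x a}

lemma act_mem_plus [R.Admissible] (M : DGMod R) {i j n : ℤ} (h : i + j = n) {x : M.X i}
    (hx : x ∈ M.plus i) (a : R.gr j) : M.act h x a ∈ M.plus n := by
  rcases lt_or_ge j 0 with hj | hj
  · have : a = 0 := Subtype.ext ((Submodule.mem_bot k).1
      (DGAlgebra.Admissible.positive (R := R) j hj ▸ a.2))
    simp [this]
  · induction hx using AddSubgroup.closure_induction with
    | mem y hy =>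
      obtain ⟨p, q, e, hq, x, b, rfl⟩ := hy
      rw [M.act_act e h (rfl : q + j = q + j) (by omega)]
      exact AddSubgroup.subset_closure ⟨_, _, _, by omega, _, _, rfl⟩
    | zero => simp
    | add y z _ _ hy hz => simpa using add_mem hy hz
    | neg y _ hy => simpa using hy

lemma d_mem_plus (M : DGMod R) {n m : ℤ} (h : n + 1 = m) {x : M.X n} (hx : x ∈ M.plus n) :
    M.d h x ∈ M.plus m := by
  induction hx using AddSubgroup.closure_induction with
  | mem y hy =>
    obtain ⟨i, j, e, hj, x, b, rfl⟩ := hy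
    rw [M.d_act e h rfl rfl (by omega) (by omega), Units.smul_def]
    refine add_mem (AddSubgroup.subset_closure ⟨_, _, _, hj, _, _, rfl⟩)
      (zsmul_mem (AddSubgroup.subset_closure ?_) _)
    exact ⟨_, _, _, by omega, _, _, rfl⟩
  | zero => simp
  | add y z _ _ hy hz => simpa using add_mem hy hz
  | neg y _ hy => simpa using hy

/-- The quotient dg module `M̄ = M / MA^+ = M ⊗_A A^0`. -/
def bar [R.Admissible] (M : DGMod R) : DGMod R where
  X i := M.X i ⧸ M.plus i
  act {i j n} h := QuotientAddGroup.lift (M.plus i)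
    (AddMonoidHom.mk' (fun x => (QuotientAddGroup.mk' (M.plus n)).comp (M.act h x))
      (fun x x' => by ext; simp))
    (fun x hx => by
      ext a
      simpa using M.act_mem_plus h hx a)
  d {i j} h := QuotientAddGroup.map _ _ (M.d h) (fun x hx => M.d_mem_plus h hx)
  act_one x := by
    induction x using QuotientAddGroup.induction_on with
    | H x => exact congrArg (QuotientAddGroup.mk' (M.plus _)) (M.act_one x)
  act_act hij hpl hjl hiq x a b := by
    induction x using QuotientAddGroup.induction_on with
    | H x => exact congrArg (QuotientAddGroup.mk' (M.plus _)) (M.act_act hij hpl hjl hiq x a b)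
  d_d hij hjl x := by
    induction x using QuotientAddGroup.induction_on with
    | H x => exact congrArg (QuotientAddGroup.mk' (M.plus _)) (M.d_d hij hjl x)
  d_act h hm hi hj hl hr x a := by
    induction x using QuotientAddGroup.induction_on with
    | H x => exact congrArg (QuotientAddGroup.mk' (M.plus _)) (M.d_act h hm hi hj hl hr x a)

/-- The cohomology `H^n(M)`: cycles modulo boundaries. -/
abbrev cohomology (M : DGMod R) (n : ℤ) : Type u :=
  (M.d (rfl : n + 1 = n + 1)).ker ⧸
    ((M.d (sub_add_cancel n 1)).range.addSubgroupOf (M.d (rfl : n + 1 = n + 1)).ker)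

section Hat

variable (L : Type u) [AddCommGroup L] [Module (R.gr 0)ᵐᵒᵖ L]

variable (R) in
/-- The relations `(l a) ⊗ b = l ⊗ (a b)`, for `a ∈ A^0`. -/
def balance (i : ℤ) : Submodule ℤ (L ⊗[ℤ] R.gr i) :=
  Submodule.span ℤ {t | ∃ (l : L) (a : R.gr 0) (b : R.gr i),
    t = (MulOpposite.op a • l) ⊗ₜ[ℤ] b - l ⊗ₜ[ℤ] (R.mul (zero_add i) a b)}

variable (R) in
/-- The tensor product `L ⊗_{A^0} A^i` of a right and a left `A^0`-module. -/
abbrev Ten (i : ℤ) : Type u := (L ⊗[ℤ] R.gr i) ⧸ balance R L i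

variable {L} in
/-- The pure tensor `l ⊗ b`. -/
def ten (i : ℤ) : L →+ R.gr i →+ Ten R L i :=
  AddMonoidHom.mk' (fun l => AddMonoidHom.mk' (fun b => Submodule.Quotient.mk (l ⊗ₜ[ℤ] b))
    (fun b b' => by simp [TensorProduct.tmul_add])) (fun l l' => by
      ext b; simp [TensorProduct.add_tmul])

variable {L}

lemma ten_smul {i : ℤ} (l : L) (a : R.gr 0) (b : R.gr i) :
    ten i (MulOpposite.op a • l) b = ten i l (R.mul (zero_add i) a b) :=
  (Submodule.Quotient.eq _).2 (Submodule.subset_span ⟨l, a, b, rfl⟩)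

lemma ten_induction {i : ℤ} {P : Ten R L i → Prop} (t : Ten R L i)
    (h : ∀ l b, P (ten i l b)) (h0 : P 0) (hadd : ∀ x y, P x → P y → P (x + y)) : P t := by
  induction t using Submodule.Quotient.induction_on with
  | H t =>
    induction t using TensorProduct.induction_on with
    | zero => exact h0
    | tmul l b => exact h l b
    | add x y hx hy => exact hadd _ _ hx hy

lemma ten_hom_ext {i : ℤ} {G : Type u} [AddCommGroup G] {f g : Ten R L i →+ G}
    (h : ∀ l b, f (ten i l b) = g (ten i l b)) (t : Ten R L i) : f t = g t := by
  induction t using ten_induction with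
  | h l b => exact h l b
  | h0 => simp
  | hadd x y hx hy => simp only [map_add, hx, hy]

/-- The map out of `L ⊗_{A^0} A^i` induced by a balanced biadditive map. -/
def tenLift {i : ℤ} {G : Type u} [AddCommGroup G] (φ : L →+ R.gr i →+ G)
    (h : ∀ l (a : R.gr 0) b, φ (MulOpposite.op a • l) b = φ l (R.mul (zero_add i) a b)) :
    Ten R L i →+ G :=
  ((balance R L i).liftQ (TensorProduct.liftAddHom φ (by simp)).toIntLinearMap (by
    rw [balance, Submodule.span_le]
    rintro _ ⟨l, a, b, rfl⟩
    simp [h])).toAddMonoidHom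

@[simp] lemma tenLift_ten {i : ℤ} {G : Type u} [AddCommGroup G] (φ : L →+ R.gr i →+ G)
    (h : ∀ l (a : R.gr 0) b, φ (MulOpposite.op a • l) b = φ l (R.mul (zero_add i) a b))
    (l : L) (b : R.gr i) : tenLift φ h (ten i l b) = φ l b := rfl

variable (L) [R.Admissible]

lemma d_mul_zero {i j : ℤ} (h : i + 1 = j) (a : R.gr 0) (b : R.gr i) :
    R.d h (R.mul (zero_add i) a b) = R.mul (zero_add j) a (R.d h b) := by
  ext
  simp [R.leibniz 0 a b a.2, DGAlgebra.Admissible.diff_zero (R := R) a.1 a.2]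

variable (R) in
/-- The dg module `L̂ = L ⊗_{A^0} A` attached to a right `A^0`-module `L`, with
`(l ⊗ b) a = l ⊗ (b a)` and `d (l ⊗ b) = l ⊗ d b`. -/
def hat : DGMod R where
  X i := Ten R L i
  act {i j n} h := tenLift (AddMonoidHom.mk' (fun l => (AddMonoidHom.compHom (ten n l)).comp
      (R.mul h)) (fun l l' => by ext; simp)) (fun l a b => by
        ext c
        have e : R.mul h (R.mul (zero_add i) a b) c = R.mul (zero_add n) a (R.mul h b c) := by
          ext; simp [mul_assoc]
        simp [ten_smul, e])
  d {i j} h := tenLift (AddMonoidHom.mk' (fun l => (ten j l).comp (R.d h))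
      (fun l l' => by ext; simp)) (fun l a b => by simp [ten_smul, d_mul_zero])
  act_one x := by
    induction x using ten_induction with
    | h l b =>
      have e : R.mul (add_zero _) b (1 : R.gr 0) = b := by ext; simp
      simp [e]
    | h0 => simp
    | hadd x y hx hy => simp only [map_add, AddMonoidHom.add_apply, hx, hy]
  act_act {i j l p q n} hij hpl hjl hiq x a c := by
    induction x using ten_induction with
    | h l b =>
      have e : R.mul hpl (R.mul hij b a) c = R.mul hiq b (R.mul hjl a c) := by
        ext; simp [mul_assoc]
      simp [e]
    | h0 => simp
    | hadd x y hx hy => simp only [map_add, AddMonoidHom.add_apply, hx, hy]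
  d_d hij hjl x := by
    induction x using ten_induction with
    | h l b =>
      have e : R.d hjl (R.d hij b) = 0 := by ext; simp [R.diff_diff]
      simp [e]
    | h0 => simp
    | hadd x y hx hy => simp only [map_add, hx, hy, add_zero]
  d_act {i _ _ _ _ _} h hm hi hj hl hr x a := by
    induction x using ten_induction with
    | h l b =>
      have e : R.d hm (R.mul h b a) =
          R.mul hl (R.d hi b) a + i.negOnePow • R.mul hr b (R.d hj a) :=
        (free R).d_act h hm hi hj hl hr b a
      simp [e, Units.smul_def]
    | h0 => simp
    | hadd x y hx hy =>
      simp only [map_add, AddMonoidHom.add_apply, hx, hy, smul_add]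
      abel

end Hat

variable (R) in
/-- The perfect dg modules: the objects of the smallest full triangulated subcategory of `dgHot`
that contains the free module `A` and is closed under direct summands (it is closed under all
shifts, under mapping cones of morphisms between its objects, and under retracts; in
particular it is closed under isomorphisms in `dgHot`, and contains zero and finite
direct sums). -/
inductive IsPerfect : ObjectProperty (Hot R)
  | free : IsPerfect ((toHot R).obj (free R))
  | shift (n : ℤ) (M : DGMod R) : IsPerfect ((toHot R).obj M) →
      IsPerfect ((toHot R).obj (M.shift n))
  | cone {M N : DGMod R} (f : M ⟶ N) : IsPerfect ((toHot R).obj M) →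
      IsPerfect ((toHot R).obj N) → IsPerfect ((toHot R).obj (DGMod.cone f))
  | summand {X Y : Hot R} (r : Retract X Y) : IsPerfect Y → IsPerfect X

variable (R) in
/-- The objects of the heart: the perfect dg modules `M` such that `H^i(M̄) = 0` for `i ≠ 0`. -/
def isHeart [R.Admissible] : ObjectProperty (Hot R) := fun M =>
  IsPerfect R M ∧ ∀ i : ℤ, i ≠ 0 → Subsingleton (M.as.bar.cohomology i)

variable (R) in
/-- The heart, a full subcategory of `dgHot`. -/
abbrev Heart [R.Admissible] := (isHeart R).FullSubcategory

section Hat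

variable [R.Admissible] (L : Type u) [AddCommGroup L] [Module (R.gr 0)ᵐᵒᵖ L]

/-- For `L` a simple right `A^0`-module, the dg module `L̂` is a direct summand of `A`. -/
lemma exists_retract_hat [IsSimpleModule (R.gr 0)ᵐᵒᵖ L] :
    Nonempty (Retract (hat R L) (free R)) := by
  have : IsSemisimpleRing (R.gr 0) := DGAlgebra.Admissible.semisimple
  have : Nontrivial L := IsSimpleModule.nontrivial (R.gr 0)ᵐᵒᵖ L
  have : Module.Projective (R.gr 0)ᵐᵒᵖ L := Module.projective_of_isSemisimpleRing _ _
  obtain ⟨l₀, hl₀⟩ := exists_ne (0 : L)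
  obtain ⟨s, hs⟩ := Module.projective_lifting_property
    (LinearMap.toSpanSingleton (R.gr 0)ᵐᵒᵖ L l₀) LinearMap.id
    (IsSimpleModule.toSpanSingleton_surjective _ hl₀)
  have hs' : ∀ l, s l • l₀ = l := fun l => LinearMap.congr_fun hs l
  let φ (i : ℤ) : Ten R L i →+ R.gr i := tenLift
    (AddMonoidHom.mk' (fun l => R.mul (zero_add i) (s l).unop) (fun l l' => by
      ext; simp)) (fun l a b => by ext; simp [mul_assoc])
  have hφ : ∀ i l b, φ i (ten i l b) = R.mul (zero_add i) (s l).unop b := fun _ _ _ => rfl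
  refine ⟨⟨⟨φ, ?_, ?_⟩, ⟨fun i => ten i l₀, fun _ _ _ => rfl, fun _ _ => rfl⟩, ?_⟩⟩
  · intro i j n h x a
    refine ten_hom_ext (f := (φ n).comp (((hat R L).act h).flip a))
      (g := ((R.mul h).flip a).comp (φ i)) (fun l b => ?_) x
    refine (hφ n l (R.mul h b a)).trans (Eq.trans ?_ (congrArg (fun y => R.mul h y a)
      (hφ i l b)).symm)
    ext
    simp [mul_assoc]
  · intro i j h x
    refine ten_hom_ext (f := (φ j).comp ((hat R L).d h)) (g := (R.d h).comp (φ i))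
      (fun l b => ?_) x
    refine (hφ j l (R.d h b)).trans (Eq.trans ?_ (congrArg (R.d h) (hφ i l b)).symm)
    rw [d_mul_zero]
  · ext i x
    refine ten_hom_ext (f := (ten i l₀).comp (φ i)) (g := AddMonoidHom.id _) (fun l b => ?_) x
    refine (congrArg (ten i l₀) (hφ i l b)).trans ?_
    rw [← ten_smul, MulOpposite.op_unop, hs']
    rfl

lemma isHeart_hat [IsSimpleModule (R.gr 0)ᵐᵒᵖ L] : isHeart R ((toHot R).obj (hat R L)) := by
  obtain ⟨r⟩ := exists_retract_hat (R := R) L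
  refine ⟨.summand (r.map (toHot R)) .free, fun i hi => ?_⟩
  have h : ∀ x : (hat R L).bar.X i, x = 0 := by
    intro x
    induction x using QuotientAddGroup.induction_on with
    | H x =>
      refine (QuotientAddGroup.eq_zero_iff x).2 ?_
      induction x using ten_induction with
      | h l b =>
        rcases lt_or_gt_of_ne hi with hi | hi
        · have : b = 0 := Subtype.ext ((Submodule.mem_bot k).1
            (DGAlgebra.Admissible.positive (R := R) i hi ▸ b.2))
          rw [this, map_zero]
          exact zero_mem _
        · refine AddSubgroup.subset_closure ⟨0, i, zero_add i, hi, ten 0 l 1, b, ?_⟩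
          have e : R.mul (zero_add i) (1 : R.gr 0) b = b := by ext; simp
          exact (congrArg (ten i l) e).symm
      | h0 => exact zero_mem _
      | hadd x y hx hy => exact add_mem hx hy
  refine ⟨fun a b => ?_⟩
  induction a using QuotientAddGroup.induction_on with
  | H a =>
    induction b using QuotientAddGroup.induction_on with
    | H b => exact congrArg _ (Subtype.ext ((h _).trans (h _).symm))

variable (R) in
/-- The object `L̂` of the heart, for a simple right `A^0`-module `L`. -/
def heartHat [IsSimpleModule (R.gr 0)ᵐᵒᵖ L] : Heart R :=
  ⟨(toHot R).obj (hat R L), isHeart_hat L⟩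

end Hat

end DGMod

end

/-!
The modules `M` with `H^i(M̄) = 0` for `i ≠ 0` have minimal models: `A^0` being semisimple, `M` is
homotopy equivalent to a perfect dg module which is, up to its differential, of the form `V ⊗ A`
with `V` a finitely generated `A^0`-module in degree `0`. Between such pure dg modules there are no
nonzero homotopies, for degree reasons, so the heart is equivalent to the category of pure perfect
dg modules. The latter is closed under kernels and cokernels in all dg modules, hence abelian, and
its objects are artinian because `V` is.

A pure quotient of a pure perfect dg module is an iterated extension of modules `L̂`, whose closed
maps of degree `1` to `I` are null-homotopic as `H^1(I) = 0`. Since a short exact sequence of pure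
dg modules splits if one forgets the differential, this vanishing makes `I` injective. Every nonzero
object of the heart contains some `L̂`, which embeds into `I`, so `I` is a coseparator. Finally,
for an injective coseparator `I` of an abelian category with artinian objects, every object embeds
into a finite power of `I`, and `Hom(-, I)` is an equivalence to the opposite of the category of
finitely generated `End I`-modules: injectivity and separation turn the linear algebra of
presentations into that of kernels of maps between powers of `I`.
-/

noncomputable section

section InjectiveCoseparator

open Limits

universe v u₁

variable {C : Type u₁} [Category.{v} C] [Abelian C] {I : C}

attribute [local instance] Abelian.hasFiniteBiproducts

lemma end_smul_eq_comp {X : C} (q : End I) (f : X ⟶ I) : q • f = f ≫ q := rfl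

lemma sum_smul_eq_lift_comp_desc {X : C} {n : ℕ} (y : Fin n → (X ⟶ I)) (q : Fin n → End I) :
    ∑ t, q t • y t = biproduct.lift y ≫ biproduct.desc q := by
  rw [biproduct.lift_desc]
  rfl

lemma exists_fin_family_comp_eq_zero {X : C} [IsArtinianObject X] {α : Type*}
    (f : α → (X ⟶ I)) :
    ∃ (n : ℕ) (a : Fin n → α), ∀ {Z : C} (z : Z ⟶ X), (∀ t, z ≫ f (a t) = 0) →
      ∀ i, z ≫ f i = 0 := by
  classical
  obtain ⟨_, ⟨s, rfl⟩, hs⟩ := WellFounded.has_min (wellFounded_lt (α := Subobject X))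
    (Set.range fun s : Finset α => s.inf fun i => kernelSubobject (f i)) ⟨_, ∅, rfl⟩
  have hle (i : α) : s.inf (fun i => kernelSubobject (f i)) ≤ kernelSubobject (f i) :=
    inf_eq_right.1 <| by
      rw [← Finset.inf_insert (f := fun i => kernelSubobject (f i))]
      exact (Finset.inf_mono (Finset.subset_insert i s)).eq_of_not_lt (hs _ ⟨_, rfl⟩)
  refine ⟨s.card, fun t => s.equivFin.symm t, fun z hz i => ?_⟩
  rw [← kernelSubobject_factors_iff]
  refine Subobject.factors_of_le z (hle i) ((Subobject.finset_inf_factors z).2 fun j hj => ?_)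
  rw [kernelSubobject_factors_iff]
  simpa using hz (s.equivFin ⟨j, hj⟩)

lemma mem_span_range_of_comp_eq_zero [Injective I] {X : C} {n : ℕ} {y : Fin n → (X ⟶ I)}
    {g : X ⟶ I} (h : ∀ {Z : C} (z : Z ⟶ X), (∀ t, z ≫ y t = 0) → z ≫ g = 0) :
    g ∈ Submodule.span (End I) (Set.range y) := by
  let S := ShortComplex.mk (kernel.ι (biproduct.lift y)) (biproduct.lift y) (kernel.condition _)
  have hS : S.Exact := ShortComplex.exact_kernel _
  have hg : S.f ≫ g = 0 := h _ fun t => by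
    rw [← biproduct.lift_π y t, kernel.condition_assoc, zero_comp]
  refine (Submodule.mem_span_range_iff_exists_fun _).2
    ⟨fun t => biproduct.ι (fun _ => I) t ≫ hS.descToInjective g hg, ?_⟩
  rw [sum_smul_eq_lift_comp_desc]
  refine Eq.trans ?_ (hS.comp_descToInjective g hg)
  congr 1
  ext t
  simp

lemma eq_zero_of_isCoseparator {X Y : C} (hI : IsCoseparator I) {f : X ⟶ Y}
    (h : ∀ g : Y ⟶ I, f ≫ g = 0) : f = 0 :=
  (Preadditive.isCoseparator_iff I).1 hI f h

lemma exists_fin_family_jointly_mono (hI : IsCoseparator I) (X : C) [IsArtinianObject X] :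
    ∃ (n : ℕ) (y : Fin n → (X ⟶ I)), ∀ {Z : C} (z : Z ⟶ X), (∀ t, z ≫ y t = 0) → z = 0 := by
  obtain ⟨n, y, hy⟩ := exists_fin_family_comp_eq_zero (fun g : X ⟶ I => g)
  exact ⟨n, y, fun z hz => eq_zero_of_isCoseparator hI (hy z hz)⟩

lemma span_range_eq_top [Injective I] {X : C} {n : ℕ} {y : Fin n → (X ⟶ I)}
    (hy : ∀ {Z : C} (z : Z ⟶ X), (∀ t, z ≫ y t = 0) → z = 0) :
    Submodule.span (End I) (Set.range y) = ⊤ :=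
  Submodule.eq_top_iff'.2 fun g => mem_span_range_of_comp_eq_zero fun z hz => by
    rw [hy z hz, zero_comp]

lemma isFG_preadditiveYonedaObj [Injective I] (hI : IsCoseparator I) (X : Cᵒᵖ)
    [IsArtinianObject X.unop] : ModuleCat.isFG (End I) ((preadditiveYonedaObj I).obj X) := by
  obtain ⟨n, y, hy⟩ := exists_fin_family_jointly_mono hI X.unop
  exact (ModuleCat.isFG_iff _).2
    ⟨(span_range_eq_top hy ▸ Submodule.fg_span (Set.finite_range y) : (⊤ : Submodule _ _).FG)⟩

lemma exists_comp_eq_of_forall_relation (hI : IsCoseparator I) {X Z : C} {n : ℕ}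
    {y : Fin n → (X ⟶ I)} (hy : ∀ {Z : C} (z : Z ⟶ X), (∀ t, z ≫ y t = 0) → z = 0)
    (x : Fin n → (Z ⟶ I))
    (hx : ∀ q : Fin n → End I, ∑ t, q t • y t = 0 → ∑ t, q t • x t = 0) :
    ∃ f : Z ⟶ X, ∀ t, f ≫ y t = x t := by
  have : Mono (biproduct.lift y) := Preadditive.mono_of_cancel_zero _ fun z hz =>
    hy z fun t => by rw [← biproduct.lift_π y t, reassoc_of% hz, zero_comp]
  have hcoker : biproduct.lift x ≫ cokernel.π (biproduct.lift y) = 0 := by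
    refine eq_zero_of_isCoseparator hI fun g => ?_
    obtain ⟨q, hq⟩ : ∃ q : Fin n → End I, cokernel.π (biproduct.lift y) ≫ g = biproduct.desc q :=
      ⟨fun t => biproduct.ι (fun _ => I) t ≫ cokernel.π _ ≫ g, by ext; simp⟩
    rw [Category.assoc, hq, ← sum_smul_eq_lift_comp_desc]
    apply hx
    rw [sum_smul_eq_lift_comp_desc, ← hq, cokernel.condition_assoc, zero_comp]
  refine ⟨Abelian.monoLift (biproduct.lift y) (biproduct.lift x) hcoker, fun t => ?_⟩
  rw [← biproduct.lift_π y t, ← Category.assoc, Abelian.monoLift_comp, biproduct.lift_π]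

lemma exists_hom_comp_eq [Injective I] (hI : IsCoseparator I) {X Z : C} [IsArtinianObject X]
    (φ : (X ⟶ I) →ₗ[End I] (Z ⟶ I)) : ∃ f : Z ⟶ X, ∀ g, f ≫ g = φ g := by
  obtain ⟨n, y, hy⟩ := exists_fin_family_jointly_mono hI X
  obtain ⟨f, hf⟩ := exists_comp_eq_of_forall_relation hI hy (fun t => φ (y t)) fun q hq => by
    rw [← map_zero φ, ← hq, map_sum]
    exact Finset.sum_congr rfl fun t _ => (map_smul φ _ _).symm
  refine ⟨f, fun g => ?_⟩
  have : ((preadditiveYonedaObj I).map f.op).hom = φ :=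
    LinearMap.ext_on_range (span_range_eq_top hy) hf
  exact LinearMap.congr_fun this g

lemma exists_presentation [Injective I] [∀ X : C, IsArtinianObject X] (n : ℕ)
    (N : Submodule (End I) (Fin n → End I)) :
    ∃ (X : C) (y : Fin n → (X ⟶ I)), Submodule.span (End I) (Set.range y) = ⊤ ∧
      ∀ q : Fin n → End I, ∑ t, q t • y t = 0 ↔ q ∈ N := by
  obtain ⟨m, a, ha⟩ := exists_fin_family_comp_eq_zero
    fun q : N => (biproduct.desc q.1 : (⨁ fun _ : Fin n => I) ⟶ I)
  let r (i : Fin m) : (⨁ fun _ : Fin n => I) ⟶ I := biproduct.desc (a i).1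
  let ι := kernel.ι (biproduct.lift r)
  let y (t : Fin n) : kernel (biproduct.lift r) ⟶ I := ι ≫ biproduct.π _ t
  have hsum (q : Fin n → End I) : ∑ t, q t • y t = ι ≫ biproduct.desc q := by
    rw [sum_smul_eq_lift_comp_desc]
    congr 1
    ext
    simp [y]
  have hι (i : Fin m) : ι ≫ r i = 0 := by
    rw [← biproduct.lift_π r i, kernel.condition_assoc, zero_comp]
  refine ⟨kernel (biproduct.lift r), y, span_range_eq_top fun z hz => ?_, fun q => ?_⟩
  · rw [← cancel_mono ι, zero_comp]
    ext t
    simpa [y] using hz t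
  rw [hsum]
  refine ⟨fun hq => ?_, fun hq => ha ι hι ⟨q, hq⟩⟩
  obtain ⟨e, he⟩ := (Submodule.mem_span_range_iff_exists_fun _).1
    (mem_span_range_of_comp_eq_zero (y := r) (g := biproduct.desc q) fun z hz => by
      have hz' : z ≫ biproduct.lift r = 0 := by
        ext i
        simpa using hz i
      rw [← kernel.lift_ι _ z hz', Category.assoc, hq, comp_zero])
  have hq' : q = ∑ i, e i • (a i).1 := by
    funext t
    rw [← biproduct.ι_desc (f := fun _ : Fin n => I) q t, ← he, Preadditive.comp_sum,
      Finset.sum_apply]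
    exact Finset.sum_congr rfl fun i _ => by
      rw [end_smul_eq_comp, biproduct.ι_desc_assoc]
      rfl
  exact hq' ▸ sum_mem fun i _ => N.smul_mem _ (a i).2

lemma isCoseparator_of_injective [Injective I]
    (h : ∀ X : C, ¬IsZero X → ∃ (Y : C) (i : Y ⟶ X) (j : Y ⟶ I), Mono i ∧ j ≠ 0) :
    IsCoseparator I := by
  refine (Preadditive.isCoseparator_iff I).2 fun X Y f hf => ?_
  by_contra hf0
  have himage : ¬IsZero (image f) := fun h0 => hf0 <| by
    rw [← image.fac f, h0.eq_zero_of_src (image.ι f), comp_zero]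
  obtain ⟨Z, i, j, _, hj⟩ := h _ himage
  refine hj ?_
  rw [← Injective.comp_factorThru j (i ≫ image.ι f), Category.assoc,
    zero_of_epi_comp (factorThruImage f) ((image.fac_assoc f _).trans (hf _)), comp_zero]

theorem preadditiveYonedaObj_lift_isEquivalence [∀ X : C, IsArtinianObject X] [Injective I]
    (hI : IsCoseparator I) :
    ∃ hfg : ∀ M : Cᵒᵖ, ModuleCat.isFG (End I) ((preadditiveYonedaObj I).obj M),
      ((ModuleCat.isFG (End I)).lift (preadditiveYonedaObj I) hfg).rightOp.IsEquivalence := by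
  refine ⟨fun M => isFG_preadditiveYonedaObj hI M, ?_⟩
  set F := (ModuleCat.isFG (End I)).lift (preadditiveYonedaObj I) _
  have : (preadditiveYonedaObj I).Faithful :=
    (isCoseparator_iff_faithful_preadditiveYonedaObj I).1 hI
  have : F.Faithful := inferInstanceAs (ObjectProperty.lift _ _ _).Faithful
  have : F.Full := ⟨fun {X Z} φ => by
    obtain ⟨f, hf⟩ := exists_hom_comp_eq hI (X := X.unop) (Z := Z.unop) φ.hom.hom
    exact ⟨f.op, InducedCategory.hom_ext (ModuleCat.hom_ext (LinearMap.ext hf))⟩⟩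
  have : F.EssSurj := ⟨fun E => by
    have : Module.Finite (End I) E.obj := (ModuleCat.isFG_iff _).1 E.property
    obtain ⟨n, π, hπ⟩ := Module.Finite.exists_fin' (End I) E.obj
    obtain ⟨X, y, hy, hy'⟩ := exists_presentation n (LinearMap.ker π)
    let ρ := Fintype.linearCombination (End I) y
    have hρ : LinearMap.ker ρ = LinearMap.ker π := Submodule.ext hy'
    have hρ' : Function.Surjective ρ := by
      rw [← LinearMap.range_eq_top, Fintype.range_linearCombination, hy]
    let e : (X ⟶ I) ≃ₗ[End I] E.obj := (ρ.quotKerEquivOfSurjective hρ').symm.trans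
      ((Submodule.quotEquivOfEq _ _ hρ).trans (π.quotKerEquivOfSurjective hπ))
    exact ⟨Opposite.op X, ⟨(ModuleCat.isFG (End I)).isoMk e.toModuleIso⟩⟩⟩
  have : F.IsEquivalence := { }
  infer_instance

end InjectiveCoseparator

lemma isArtinianObject_of_faithful {C D : Type*} [Category* C] [Category* D] [Balanced C]
    (F : C ⥤ D) [F.Faithful] [F.PreservesMonomorphisms] (X : C) [IsArtinianObject (F.obj X)] :
    IsArtinianObject X := by
  have hF : StrictMono fun S : Subobject X => Subobject.mk (F.map S.arrow) := fun S T h => by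
    have hST : Subobject.ofLE S T h.le ≫ T.arrow = S.arrow := Subobject.ofLE_arrow _
    refine (Subobject.mk_lt_mk_iff_of_comm (F.map (Subobject.ofLE S T h.le))
      (by rw [← F.map_comp, hST])).2 fun _ => ?_
    refine (Subobject.mk_lt_mk_iff_of_comm _ hST).1 ?_ (isIso_of_reflects_iso _ F)
    rwa [Subobject.mk_arrow, Subobject.mk_arrow]
  exact ⟨hF.wellFoundedLT⟩

lemma exists_linearMap_comp_comp_eq {S V W : Type*} [Ring S] [AddCommGroup V] [Module S V]
    [IsSemisimpleModule S V] [AddCommGroup W] [Module S W] [IsSemisimpleModule S W]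
    (f : V →ₗ[S] W) : ∃ g : W →ₗ[S] V, f ∘ₗ g ∘ₗ f = f := by
  obtain ⟨s, hs⟩ := IsSemisimpleModule.lifting_property f.rangeRestrict
    f.surjective_rangeRestrict LinearMap.id
  obtain ⟨g, hg⟩ := IsSemisimpleModule.extension_property (LinearMap.range f).subtype
    Subtype.val_injective s
  refine ⟨g, LinearMap.ext fun v => ?_⟩
  have hgs : g (f v) = s (f.rangeRestrict v) := LinearMap.congr_fun hg (f.rangeRestrict v)
  have hfs := congrArg Subtype.val (LinearMap.congr_fun hs (f.rangeRestrict v))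
  exact (congrArg f hgs).trans hfs

lemma exists_isIdempotentElem_mul {S T : Type*} [Ring S] [Ring T] (φ : S →+* T) {e : S}
    (he : IsNilpotent (e - e ^ 2)) (hφ : IsIdempotentElem (φ e)) :
    ∃ r, IsIdempotentElem (e * r) ∧ φ (e * r) = φ e := by
  obtain ⟨n, hn⟩ := he
  obtain ⟨r, hr⟩ : e ∣ 1 - (1 - e ^ (n + 1)) ^ (n + 1) := by
    refine dvd_trans (dvd_pow_self e n.succ_ne_zero) ⟨∑ i ∈ Finset.range (n + 1),
      (1 - e ^ (n + 1)) ^ i, ?_⟩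
    rw [← mul_neg_geom_sum, sub_sub_cancel]
  refine ⟨r, hr ▸ isIdempotentElem_one_sub_one_sub_pow_pow e (n + 1) ?_, ?_⟩
  · rw [pow_succ, hn, zero_mul]
  · rw [← hr, map_sub, map_pow, map_sub, map_pow, map_one, hφ.pow_succ_eq, hφ.one_sub.pow_succ_eq,
      sub_sub_cancel]

namespace DGMod

variable {k : Type w} [CommRing k] {R : DGAlgebra.{w, u} k} {J K M N P Q : DGMod R}

/-- A sub dg module, as a family of subgroups stable under the action and the differential. -/
structure DGSubmodule (M : DGMod R) where
  carrier (i : ℤ) : AddSubgroup (M.X i)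
  act_mem {i j n : ℤ} (h : i + j = n) {x : M.X i} (hx : x ∈ carrier i) (a : R.gr j) :
    M.act h x a ∈ carrier n
  d_mem {i j : ℤ} (h : i + 1 = j) {x : M.X i} (hx : x ∈ carrier i) : M.d h x ∈ carrier j

namespace DGSubmodule

variable (S : DGSubmodule M)

/-- A sub dg module as a dg module. -/
def toDGMod : DGMod R where
  X i := S.carrier i
  act h := AddMonoidHom.mk' (fun x => AddMonoidHom.mk'
    (fun a => ⟨M.act h x a, S.act_mem h x.2 a⟩) (fun a b => by ext; simp))
    (fun x y => by ext; simp)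
  d h := AddMonoidHom.mk' (fun x => ⟨M.d h x, S.d_mem h x.2⟩) (fun x y => by ext; simp)
  act_one x := Subtype.ext (M.act_one x.1)
  act_act hij hpl hjl hiq x a b := Subtype.ext (M.act_act hij hpl hjl hiq x.1 a b)
  d_d hij hjl x := Subtype.ext (M.d_d hij hjl x.1)
  d_act h hn hi hj hl hr x a := Subtype.ext (by
    simpa [Units.smul_def] using M.d_act h hn hi hj hl hr x.1 a)

/-- The inclusion of a sub dg module. -/
def ι : S.toDGMod ⟶ M where
  f i := (S.carrier i).subtype
  map_act _ _ _ := rfl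
  map_d _ _ := rfl

lemma ι_injective (i : ℤ) : Function.Injective (S.ι.f i) := Subtype.val_injective

lemma ι_f_mem {i : ℤ} (x : S.toDGMod.X i) : S.ι.f i x ∈ S.carrier i := x.2

lemma exists_ι_f_eq {i : ℤ} {x : M.X i} (hx : x ∈ S.carrier i) : ∃ y, S.ι.f i y = x :=
  ⟨⟨x, hx⟩, rfl⟩

/-- The quotient by a sub dg module. -/
def quot : DGMod R where
  X i := M.X i ⧸ S.carrier i
  act {i j n} h := QuotientAddGroup.lift (S.carrier i)
    (AddMonoidHom.mk' (fun x => (QuotientAddGroup.mk' (S.carrier n)).comp (M.act h x))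
      (fun x x' => by ext; simp))
    (fun x hx => by
      ext a
      simpa using S.act_mem h hx a)
  d h := QuotientAddGroup.map _ _ (M.d h) (fun x hx => S.d_mem h hx)
  act_one x := by
    induction x using QuotientAddGroup.induction_on with
    | H x => exact congrArg (QuotientAddGroup.mk' _) (M.act_one x)
  act_act hij hpl hjl hiq x a b := by
    induction x using QuotientAddGroup.induction_on with
    | H x => exact congrArg (QuotientAddGroup.mk' _) (M.act_act hij hpl hjl hiq x a b)
  d_d hij hjl x := by
    induction x using QuotientAddGroup.induction_on with
    | H x => exact congrArg (QuotientAddGroup.mk' _) (M.d_d hij hjl x)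
  d_act h hm hi hj hl hr x a := by
    induction x using QuotientAddGroup.induction_on with
    | H x => exact congrArg (QuotientAddGroup.mk' _) (M.d_act h hm hi hj hl hr x a)

/-- The projection onto the quotient by a sub dg module. -/
def π : M ⟶ S.quot where
  f i := QuotientAddGroup.mk' (S.carrier i)
  map_act _ _ _ := rfl
  map_d _ _ := rfl

lemma π_surjective (i : ℤ) : Function.Surjective (S.π.f i) := QuotientAddGroup.mk'_surjective _

lemma π_f_eq_zero_iff {i : ℤ} (x : M.X i) : S.π.f i x = 0 ↔ x ∈ S.carrier i :=
  QuotientAddGroup.eq_zero_iff x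

/-- The kernel of a morphism of dg modules. -/
def ker (f : M ⟶ N) : DGSubmodule M where
  carrier i := (f.f i).ker
  act_mem h x hx a := by
    rw [AddMonoidHom.mem_ker] at hx ⊢
    rw [f.map_act, hx, map_zero, AddMonoidHom.zero_apply]
  d_mem h x hx := by
    rw [AddMonoidHom.mem_ker] at hx ⊢
    rw [f.map_d, hx, map_zero]

/-- The image of a morphism of dg modules. -/
def range (f : M ⟶ N) : DGSubmodule N where
  carrier i := (f.f i).range
  act_mem h x := by
    rintro ⟨y, rfl⟩ a
    exact ⟨M.act h y a, f.map_act h y a⟩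
  d_mem h x := by
    rintro ⟨y, rfl⟩
    exact ⟨M.d h y, f.map_d h y⟩

/-- A morphism of dg modules, with its image as target. -/
def toRange (f : M ⟶ N) : M ⟶ (range f).toDGMod where
  f i := (f.f i).rangeRestrict
  map_act h x a := Subtype.ext (f.map_act h x a)
  map_d h x := Subtype.ext (f.map_d h x)

lemma toRange_surjective (f : M ⟶ N) (i : ℤ) : Function.Surjective ((toRange f).f i) :=
  (f.f i).rangeRestrict_surjective

end DGSubmodule

section Abelian

open Limits

variable (f : M ⟶ N)

lemma comp_eq_zero_iff {g : N ⟶ P} : f ≫ g = 0 ↔ ∀ i x, g.f i (f.f i x) = 0 := by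
  refine ⟨fun h i x => ?_, fun h => hom_ext h⟩
  exact congrArg (fun w : M ⟶ P => w.f i x) h

lemma mono_of_injective (hf : ∀ i, Function.Injective (f.f i)) : Mono f :=
  ⟨fun _ _ hgh => hom_ext fun i x => hf i (congrArg (fun w : _ ⟶ N => w.f i x) hgh)⟩

lemma epi_of_surjective (hf : ∀ i, Function.Surjective (f.f i)) : Epi f :=
  ⟨fun _ _ hgh => hom_ext fun i y => by
    obtain ⟨x, rfl⟩ := hf i y
    exact congrArg (fun w : M ⟶ _ => w.f i x) hgh⟩

variable {f} in
/-- A morphism which is degreewise the kernel of `f` is a kernel of `f`. -/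
def isLimitKernelFork {ι : P ⟶ M} (hι : ∀ i, Function.Injective (ι.f i))
    (h : ∀ i, Function.Exact (ι.f i) (f.f i)) :
    IsLimit (KernelFork.ofι ι ((comp_eq_zero_iff ι).2 fun i => (h i).apply_apply_eq_zero)) :=
  have := mono_of_injective ι hι
  KernelFork.IsLimit.ofι' ι _ fun {Q} g hg => by
    choose y hy using fun i x => (h i _).1 ((comp_eq_zero_iff g).1 hg i x)
    exact ⟨{  f i := AddMonoidHom.mk' (y i) fun a b => hι i (by simp [hy])
              map_act h x a := hι _ (by simp [hy, g.map_act, ι.map_act])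
              map_d h x := hι _ (by simp [hy, g.map_d, ι.map_d]) },
      hom_ext hy⟩

variable {f} in
/-- A morphism which is degreewise the cokernel of `f` is a cokernel of `f`. -/
def isColimitCokernelCofork {π : N ⟶ P} (hπ : ∀ i, Function.Surjective (π.f i))
    (h : ∀ i, Function.Exact (f.f i) (π.f i)) :
    IsColimit (CokernelCofork.ofπ π ((comp_eq_zero_iff f).2 fun i => (h i).apply_apply_eq_zero)) :=
  have := epi_of_surjective π hπ
  CokernelCofork.IsColimit.ofπ' π _ fun {Q} g hg => by
    have key : ∀ i {x y : N.X i}, π.f i x = π.f i y → g.f i x = g.f i y := fun i x y hxy => by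
      obtain ⟨z, hz⟩ := (h i _).1 (by rw [map_sub, hxy, sub_self] : π.f i (x - y) = 0)
      rw [← sub_eq_zero, ← map_sub, ← hz, (comp_eq_zero_iff f).1 hg]
    choose s hs using hπ
    have hg' : ∀ i x, g.f i (s i (π.f i x)) = g.f i x := fun i x => key i (hs i _)
    exact ⟨{  f i := AddMonoidHom.mk' (fun x => g.f i (s i x)) fun a b => by
                rw [← map_add]
                exact key i (by simp [hs])
              map_act h x a := (key _ (by simp [hs, π.map_act])).trans (g.map_act h (s _ x) a)
              map_d h x := (key _ (by simp [hs, π.map_d])).trans (g.map_d h (s _ x)) },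
      hom_ext hg'⟩

lemma injective_of_mono [Mono f] (i : ℤ) : Function.Injective (f.f i) := by
  refine (injective_iff_map_eq_zero _).2 fun x hx => ?_
  have h : (DGSubmodule.ker f).ι = 0 := by
    rw [← cancel_mono f, zero_comp, comp_eq_zero_iff]
    exact fun i x => (DGSubmodule.ker f).ι_f_mem x
  obtain ⟨y, rfl⟩ := (DGSubmodule.ker f).exists_ι_f_eq hx
  rw [h, zero_f]

lemma surjective_of_epi [Epi f] (i : ℤ) : Function.Surjective (f.f i) := by
  intro y
  have h : (DGSubmodule.range f).π = 0 := by
    rw [← cancel_epi f, comp_zero, comp_eq_zero_iff]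
    exact fun i x => ((DGSubmodule.range f).π_f_eq_zero_iff _).2 ⟨x, rfl⟩
  refine ((DGSubmodule.range f).π_f_eq_zero_iff y).1 ?_
  rw [h, zero_f]

lemma exact_ker_ι (i : ℤ) : Function.Exact ((DGSubmodule.ker f).ι.f i) (f.f i) := fun _ =>
  ⟨fun h => (DGSubmodule.ker f).exists_ι_f_eq h,
    fun ⟨y, hy⟩ => hy ▸ (DGSubmodule.ker f).ι_f_mem y⟩

lemma exact_range_π (i : ℤ) : Function.Exact (f.f i) ((DGSubmodule.range f).π.f i) := fun x =>
  (DGSubmodule.range f).π_f_eq_zero_iff x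

/-- The product of a family of dg modules. -/
def prod {J : Type u} (F : J → DGMod R) : DGMod R where
  X i := ∀ j, (F j).X i
  act h := AddMonoidHom.mk' (fun x => AddMonoidHom.mk' (fun a j => (F j).act h (x j) a)
    (fun a b => by ext; simp)) (fun x y => by ext; simp)
  d h := AddMonoidHom.mk' (fun x j => (F j).d h (x j)) (fun x y => by ext; simp)
  act_one x := funext fun j => (F j).act_one (x j)
  act_act hij hpl hjl hiq x a b := funext fun j => (F j).act_act hij hpl hjl hiq (x j) a b
  d_d hij hjl x := funext fun j => (F j).d_d hij hjl (x j)
  d_act h hn hi hj hl hr x a := funext fun j => by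
    simpa [Units.smul_def] using (F j).d_act h hn hi hj hl hr (x j) a

instance : HasFiniteProducts (DGMod R) :=
  have : HasProducts.{u} (DGMod R) := hasProducts_of_limit_fans
    (fun F => Fan.mk (prod F) fun j =>
      { f _ := Pi.evalAddMonoidHom _ j, map_act _ _ _ := rfl, map_d _ _ := rfl })
    fun F => Fan.IsLimit.mk _
      (fun s => { f i := AddMonoidHom.mk' (fun x j => (s.proj j).f i x) fun x y =>
                    funext fun j => map_add ((s.proj j).f i) x y
                  map_act h x a := funext fun j => (s.proj j).map_act h x a
                  map_d h x := funext fun j => (s.proj j).map_d h x })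
      (fun _ _ => rfl)
      fun _ _ hm => hom_ext fun i x => funext fun j =>
        congrArg (fun w : _ ⟶ F j => w.f i x) (hm j)
  hasFiniteProducts_of_hasProducts.{u} (DGMod R)

instance : HasKernels (DGMod R) where
  has_limit f := ⟨⟨_, isLimitKernelFork (DGSubmodule.ker f).ι_injective (exact_ker_ι f)⟩⟩

instance : HasCokernels (DGMod R) where
  has_colimit f := ⟨⟨_, isColimitCokernelCofork (DGSubmodule.range f).π_surjective
    (exact_range_π f)⟩⟩

instance : IsNormalMonoCategory (DGMod R) where
  normalMonoOfMono f _ := ⟨⟨_, (DGSubmodule.range f).π, _,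
    isLimitKernelFork (injective_of_mono f) (exact_range_π f)⟩⟩

instance : IsNormalEpiCategory (DGMod R) where
  normalEpiOfEpi f _ := ⟨⟨_, (DGSubmodule.ker f).ι, _,
    isColimitCokernelCofork (surjective_of_epi f) (exact_ker_ι f)⟩⟩

instance : Abelian (DGMod R) where

lemma injective_of_isLimit {c : KernelFork f} (hc : IsLimit c) (i : ℤ) :
    Function.Injective (c.ι.f i) :=
  have := Fork.IsLimit.mono hc
  injective_of_mono _ i

lemma exact_of_isLimit {c : KernelFork f} (hc : IsLimit c) (i : ℤ) :
    Function.Exact (c.ι.f i) (f.f i) := fun x => by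
  refine ⟨fun hx => ?_, fun ⟨y, hy⟩ => hy ▸ (comp_eq_zero_iff _).1 c.condition i y⟩
  have w := (comp_eq_zero_iff _).2 fun i => (exact_ker_ι f i).apply_apply_eq_zero
  obtain ⟨y, rfl⟩ := (DGSubmodule.ker f).exists_ι_f_eq hx
  obtain ⟨l, hl⟩ := KernelFork.IsLimit.lift' hc _ w
  exact ⟨l.f i y, congrArg (fun v : _ ⟶ M => v.f i y) hl⟩

lemma surjective_of_isColimit {c : CokernelCofork f} (hc : IsColimit c) (i : ℤ) :
    Function.Surjective (c.π.f i) :=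
  have := Cofork.IsColimit.epi hc
  surjective_of_epi _ i

lemma exact_of_isColimit {c : CokernelCofork f} (hc : IsColimit c) (i : ℤ) :
    Function.Exact (f.f i) (c.π.f i) := fun x => by
  refine ⟨fun hx => ?_, fun ⟨y, hy⟩ => hy ▸ (comp_eq_zero_iff _).1 c.condition i y⟩
  have w := (comp_eq_zero_iff _).2 fun i => (exact_range_π f i).apply_apply_eq_zero
  obtain ⟨l, hl⟩ := CokernelCofork.IsColimit.desc' hc _ w
  refine ((DGSubmodule.range f).π_f_eq_zero_iff x).1 ?_
  rw [← hl, comp_f, hx, map_zero]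

end Abelian

lemma d_zsmul_unit {i j : ℤ} (h : i + 1 = j) (z : ℤˣ) (x : M.X i) :
    M.d h (z • x) = z • M.d h x := by
  rw [Units.smul_def, Units.smul_def, map_zsmul]

/-- The identification of two components of a dg module whose indices agree. -/
def cast (M : DGMod R) {i j : ℤ} (h : i = j) : M.X i →+ M.X j := h ▸ AddMonoidHom.id _

/-- The homogeneous `A`-linear maps of degree `p` between dg modules, not necessarily compatible
with the differentials. -/
@[ext]
structure GradedHom (M N : DGMod R) (p : ℤ) where
  f : ∀ {i j : ℤ} (_ : i + p = j), M.X i →+ N.X j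
  map_act : ∀ {i j n i' n' : ℤ} (h : i + j = n) (hn : n + p = n') (hi : i + p = i')
    (h' : i' + j = n') (x : M.X i) (a : R.gr j), f hn (M.act h x a) = N.act h' (f hi x) a

namespace GradedHom

variable {p q r : ℤ}

@[ext] lemma hom_ext {u v : GradedHom M N p}
    (h : ∀ {i j : ℤ} (h : i + p = j) (x : M.X i), u.f h x = v.f h x) : u = v :=
  GradedHom.ext (funext fun _ => funext fun _ => funext fun e => AddMonoidHom.ext (h e))

instance : Zero (GradedHom M N p) := ⟨⟨fun _ => 0, by simp⟩⟩

instance : Add (GradedHom M N p) := ⟨fun u v => ⟨fun h => u.f h + v.f h,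
  fun h hn hi h' x a => by simp [u.map_act h hn hi h', v.map_act h hn hi h']⟩⟩

instance : Neg (GradedHom M N p) := ⟨fun u => ⟨fun h => -u.f h,
  fun h hn hi h' x a => by simp [u.map_act h hn hi h']⟩⟩

@[simp] lemma zero_f {i j : ℤ} (h : i + p = j) (x : M.X i) :
    (0 : GradedHom M N p).f h x = 0 := rfl

@[simp] lemma add_f (u v : GradedHom M N p) {i j : ℤ} (h : i + p = j) (x : M.X i) :
    (u + v).f h x = u.f h x + v.f h x := rfl

@[simp] lemma neg_f (u : GradedHom M N p) {i j : ℤ} (h : i + p = j) (x : M.X i) :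
    (-u).f h x = -u.f h x := rfl

instance : AddCommGroup (GradedHom M N p) where
  add_assoc u v w := by ext; simp [add_assoc]
  zero_add u := by ext; simp
  add_zero u := by ext; simp
  add_comm u v := by ext; simp [add_comm]
  neg_add_cancel u := by ext; simp
  nsmul := nsmulRec
  zsmul := zsmulRec

@[simp] lemma sub_f (u v : GradedHom M N p) {i j : ℤ} (h : i + p = j) (x : M.X i) :
    (u - v).f h x = u.f h x - v.f h x := by
  simp [sub_eq_add_neg]

@[simp] lemma units_smul_f (z : ℤˣ) (u : GradedHom M N p) {i j : ℤ} (h : i + p = j) (x : M.X i) :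
    (z • u).f h x = z • u.f h x := by
  obtain rfl | rfl := Int.units_eq_one_or z <;> simp

/-- The composition of homogeneous maps, in diagrammatic order. -/
def comp (u : GradedHom M N p) (v : GradedHom N P q) (h : p + q = r) : GradedHom M P r where
  f {i j} hij := (v.f (by omega : i + p + q = j)).comp (u.f rfl)
  map_act {i j n i' n'} e hn hi h' x a := by
    simp only [AddMonoidHom.comp_apply]
    rw [u.map_act e rfl rfl (by omega), v.map_act]

lemma comp_f (u : GradedHom M N p) (v : GradedHom N P q) (h : p + q = r) {i j l : ℤ}
    (hij : i + r = j) (hil : i + p = l) (hlj : l + q = j) (x : M.X i) :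
    (u.comp v h).f hij x = v.f hlj (u.f hil x) := by
  subst hil
  rfl

@[simp] lemma comp_add (u : GradedHom M N p) (v v' : GradedHom N P q) (h : p + q = r) :
    u.comp (v + v') h = u.comp v h + u.comp v' h := by
  ext
  simp [comp]

@[simp] lemma add_comp (u u' : GradedHom M N p) (v : GradedHom N P q) (h : p + q = r) :
    (u + u').comp v h = u.comp v h + u'.comp v h := by
  ext
  simp [comp]

/-- Composition as a biadditive map. -/
def compHom (h : p + q = r) : GradedHom M N p →+ GradedHom N P q →+ GradedHom M P r :=
  AddMonoidHom.mk' (fun u => AddMonoidHom.mk' (fun v => u.comp v h) (by simp))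
    (fun u u' => by ext; simp)

@[simp] lemma comp_zero (u : GradedHom M N p) (h : p + q = r) :
    u.comp (0 : GradedHom N P q) h = 0 :=
  map_zero (compHom h u)

@[simp] lemma zero_comp (v : GradedHom N P q) (h : p + q = r) :
    (0 : GradedHom M N p).comp v h = 0 :=
  map_zero ((compHom h).flip v)

@[simp] lemma comp_neg (u : GradedHom M N p) (v : GradedHom N P q) (h : p + q = r) :
    u.comp (-v) h = -u.comp v h :=
  map_neg (compHom h u) v

@[simp] lemma neg_comp (u : GradedHom M N p) (v : GradedHom N P q) (h : p + q = r) :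
    (-u).comp v h = -u.comp v h :=
  map_neg ((compHom h).flip v) u

@[simp] lemma comp_sub (u : GradedHom M N p) (v v' : GradedHom N P q) (h : p + q = r) :
    u.comp (v - v') h = u.comp v h - u.comp v' h :=
  map_sub (compHom h u) v v'

@[simp] lemma sub_comp (u u' : GradedHom M N p) (v : GradedHom N P q) (h : p + q = r) :
    (u - u').comp v h = u.comp v h - u'.comp v h :=
  map_sub ((compHom h).flip v) u u'

lemma comp_assoc {p₁ p₂ p₃ p₁₂ p₂₃ p₁₂₃ : ℤ} (u : GradedHom M N p₁) (v : GradedHom N P p₂)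
    (w : GradedHom P Q p₃) (h₁₂ : p₁ + p₂ = p₁₂) (h : p₁₂ + p₃ = p₁₂₃) (h₂₃ : p₂ + p₃ = p₂₃)
    (h' : p₁ + p₂₃ = p₁₂₃) :
    (u.comp v h₁₂).comp w h = u.comp (v.comp w h₂₃) h' := by
  ext i j hij x
  rw [comp_f _ _ h hij rfl (by omega), comp_f _ _ h₁₂ rfl rfl (by omega),
    comp_f _ _ h' hij rfl (by omega), comp_f _ _ h₂₃ (by omega) (by omega : _ = i + p₁₂) (by omega)]

/-- A morphism of dg modules as a homogeneous map of degree zero. -/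
def ofHom : (M ⟶ N) →+ GradedHom M N 0 :=
  AddMonoidHom.mk' (fun f =>
    { f := fun {i j} h => (f.f j).comp (M.cast (by omega))
      map_act := fun {i j n i' n'} h hn hi h' x a => by
        obtain rfl : n = n' := by omega
        obtain rfl : i = i' := by omega
        exact f.map_act h x a })
    (fun f g => by ext; simp)

@[simp] lemma ofHom_f_self (f : M ⟶ N) {i : ℤ} (h : i + 0 = i) (x : M.X i) :
    (ofHom f).f h x = f.f i x := rfl

/-- The identity as a homogeneous map of degree zero. -/
abbrev id (M : DGMod R) : GradedHom M M 0 := ofHom (𝟙 M)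

lemma ofHom_comp_ofHom (f : M ⟶ N) (g : N ⟶ P) :
    (ofHom f).comp (ofHom g) (add_zero 0) = ofHom (f ≫ g) := by
  ext i j h x
  obtain rfl : i = j := by omega
  simp [comp_f _ _ _ h h h]

@[simp] lemma comp_id (u : GradedHom M N p) (h : p + 0 = p) : u.comp (id N) h = u := by
  ext i j hij x
  rw [comp_f _ _ h hij hij (add_zero j)]
  rfl

@[simp] lemma id_comp (u : GradedHom M N p) (h : 0 + p = p) : (id M).comp u h = u := by
  ext i j hij x
  rw [comp_f _ _ h hij (add_zero i) hij]
  rfl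

/-- The differential `u ↦ d u - (-1)^p u d` of homogeneous maps. -/
def δ (h : p + 1 = q) : GradedHom M N p →+ GradedHom M N q :=
  AddMonoidHom.mk' (fun u =>
    { f := fun {i j} hij => (N.d (by omega : i + p + 1 = j)).comp (u.f rfl) -
        p.negOnePow • (u.f (by omega : i + 1 + p = j)).comp (M.d rfl)
      map_act := fun {i j n i' n'} e hn hi h' x a => by
        simp only [AddMonoidHom.sub_apply, AddMonoidHom.comp_apply, AddMonoidHom.smul_apply]
        rw [u.map_act e rfl rfl (by omega), N.d_act _ _ (by omega) rfl h' (by omega),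
          M.d_act e rfl rfl rfl (by omega) (by omega), map_add, Units.smul_def i.negOnePow,
          map_zsmul, u.map_act _ _ (by omega) h', u.map_act _ _ rfl (by omega), smul_add,
          ← Units.smul_def, smul_smul, Int.negOnePow_add, mul_comm p.negOnePow]
        simp only [Units.smul_def, map_sub, map_zsmul, AddMonoidHom.sub_apply,
          AddMonoidHom.coe_smul, Pi.smul_apply]
        abel })
    (fun u v => by
      ext
      simp only [add_f, AddMonoidHom.sub_apply, AddMonoidHom.comp_apply, map_add,
        AddMonoidHom.smul_apply, smul_add]
      abel)

lemma δ_f (h : p + 1 = q) (u : GradedHom M N p) {i j l m : ℤ} (hij : i + q = j)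
    (hil : i + p = l) (hlj : l + 1 = j) (him : i + 1 = m) (hmj : m + p = j) (x : M.X i) :
    (δ h u).f hij x = N.d hlj (u.f hil x) - p.negOnePow • u.f hmj (M.d him x) := by
  subst hil him
  rfl

lemma δ_δ (h : p + 1 = q) (h' : q + 1 = r) (u : GradedHom M N p) : δ h' (δ h u) = 0 := by
  subst h
  ext i j hij x
  rw [δ_f h' _ hij rfl (by omega) rfl (by omega), δ_f rfl _ rfl rfl (by omega) rfl (by omega),
    δ_f rfl _ _ (by omega : i + 1 + p = i + (p + 1)) (by omega) rfl (by omega), M.d_d, map_zero,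
    smul_zero, sub_zero, map_sub, N.d_d, d_zsmul_unit, Int.negOnePow_succ, Units.neg_smul]
  simp

lemma δ_comp {p' q' r' : ℤ} (u : GradedHom M N p) (v : GradedHom N P q) (h : p + q = r)
    (hr : r + 1 = r') (hp : p + 1 = p') (hq : q + 1 = q') (h₁ : p + q' = r') (h₂ : p' + q = r') :
    δ hr (u.comp v h) = u.comp (δ hq v) h₁ + q.negOnePow • (δ hp u).comp v h₂ := by
  ext i j hij x
  have hv := δ_f hq v (by omega : i + p + q' = j) (by omega : i + p + q = i + r) (by omega) rfl
    (by omega) (u.f rfl x)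
  have hu := δ_f hp u (by omega : i + p' = i + p + 1) rfl rfl rfl (by omega) x
  rw [δ_f hr _ hij rfl (by omega) rfl (by omega), comp_f u v h rfl rfl (by omega),
    comp_f u v h _ (by omega : i + 1 + p = i + p + 1) (by omega), add_f, units_smul_f,
    comp_f u _ h₁ hij rfl (by omega), comp_f _ v h₂ hij (by omega : _ = i + p + 1) (by omega),
    hv, hu, map_sub, Units.smul_def p.negOnePow, map_zsmul, ← Units.smul_def, smul_sub, smul_smul,
    ← Int.negOnePow_add, add_comm q p, h]
  abel

lemma δ_ofHom (f : M ⟶ N) : δ (zero_add 1) (ofHom f) = 0 := by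
  ext i j h x
  subst h
  simp [δ_f (zero_add 1) _ rfl (add_zero i) rfl rfl (add_zero (i + 1)), f.map_d]

/-- The morphism of dg modules given by a homogeneous map of degree zero commuting with the
differentials. -/
def toHom (u : GradedHom M N 0) (h : δ (zero_add 1) u = 0) : M ⟶ N where
  f i := u.f (add_zero i)
  map_act e x a := u.map_act e _ _ e x a
  map_d {i j} e x := by
    have : (δ (zero_add 1) u).f e x = 0 := by rw [h, zero_f]
    rw [δ_f (zero_add 1) u e (add_zero i) e e (add_zero j), sub_eq_zero] at this
    simpa using this.symm

@[simp] lemma ofHom_toHom (u : GradedHom M N 0) (h : δ (zero_add 1) u = 0) :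
    ofHom (toHom u h) = u := by
  ext i j e x
  obtain rfl : i = j := by omega
  rfl

lemma ofHom_injective : Function.Injective (ofHom : (M ⟶ N) → GradedHom M N 0) :=
  fun f g h => DGMod.hom_ext fun i x => by
    rw [← ofHom_f_self f (add_zero i), h, ofHom_f_self]

lemma toHot_map_eq_iff (f g : M ⟶ N) : (toHot R).map f = (toHot R).map g ↔
    ∃ s : GradedHom M N (-1), δ (neg_add_cancel 1) s = ofHom f - ofHom g := by
  rw [CategoryTheory.Quotient.functor_map_eq_iff]
  constructor
  · rintro ⟨s⟩
    refine ⟨⟨fun h => s.s (by omega), fun h hn hi h' x a => s.s_act h _ _ h' x a⟩, ?_⟩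
    ext i j h x
    obtain rfl : i = j := by omega
    rw [δ_f _ _ h rfl (by omega) rfl (by omega), sub_f, ofHom_f_self, ofHom_f_self,
      s.comm (by omega : i + -1 + 1 = i) rfl]
    simp
  · rintro ⟨s, hs⟩
    refine ⟨⟨fun h => s.f (by omega), fun h hn hi h' x a => s.map_act h _ _ h' x a, ?_⟩⟩
    intro l i j hi hj x
    have := congrArg (fun t : GradedHom M N 0 => t.f (add_zero i) x) hs
    simp only [δ_f _ s (add_zero i) (by omega : i + -1 = l) hi hj (by omega), sub_f,
      ofHom_f_self] at this
    rw [eq_sub_iff_add_eq'] at this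
    rw [← this]
    simp

end GradedHom

namespace GradedHom

variable {p q r : ℤ}

/-- The cocycles of the complex of homogeneous maps. -/
def IsClosed (u : GradedHom M N p) : Prop := δ rfl u = 0

/-- The coboundaries of the complex of homogeneous maps. -/
def IsExact (u : GradedHom M N p) : Prop :=
  ∃ v : GradedHom M N (p - 1), δ (sub_add_cancel p 1) v = u

lemma IsClosed.δ_eq_zero {u : GradedHom M N p} (hu : u.IsClosed) (h : p + 1 = q) : δ h u = 0 := by
  subst h
  exact hu

lemma isClosed_of_δ_eq_zero {u : GradedHom M N p} (h : p + 1 = q) (hu : δ h u = 0) :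
    u.IsClosed := by
  subst h
  exact hu

lemma isExact_δ (h : p + 1 = q) (u : GradedHom M N p) : (δ h u).IsExact := by
  obtain rfl : p = q - 1 := by omega
  exact ⟨u, rfl⟩

lemma IsExact.exists_δ_eq {u : GradedHom M N q} (hu : u.IsExact) (h : p + 1 = q) :
    ∃ v : GradedHom M N p, δ h v = u := by
  obtain rfl : p = q - 1 := by omega
  exact hu

lemma IsClosed.sub {u v : GradedHom M N p} (hu : u.IsClosed) (hv : v.IsClosed) :
    (u - v).IsClosed := by
  rw [IsClosed, map_sub, hu, hv, sub_zero]

lemma IsExact.isClosed {u : GradedHom M N p} (hu : u.IsExact) : u.IsClosed := by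
  obtain ⟨v, rfl⟩ := hu
  exact δ_δ _ _ v

lemma IsExact.add {u v : GradedHom M N p} (hu : u.IsExact) (hv : v.IsExact) :
    (u + v).IsExact := by
  obtain ⟨⟨u, rfl⟩, ⟨v, rfl⟩⟩ := hu, hv
  exact ⟨u + v, map_add _ u v⟩

lemma IsExact.neg {u : GradedHom M N p} (hu : u.IsExact) : (-u).IsExact := by
  obtain ⟨u, rfl⟩ := hu
  exact ⟨-u, map_neg _ u⟩

lemma δ_comp_of_isClosed_left {u : GradedHom M N p} (hu : u.IsClosed) (v : GradedHom N P q)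
    {q' r' : ℤ} (h : p + q = r) (hr : r + 1 = r') (hq : q + 1 = q') (h' : p + q' = r') :
    δ hr (u.comp v h) = u.comp (δ hq v) h' := by
  rw [δ_comp u v h hr rfl hq h' (by omega), hu, zero_comp, smul_zero, add_zero]

lemma δ_comp_of_isClosed_right (u : GradedHom M N p) {v : GradedHom N P q} (hv : v.IsClosed)
    {p' r' : ℤ} (h : p + q = r) (hr : r + 1 = r') (hp : p + 1 = p') (h' : p' + q = r') :
    δ hr (u.comp v h) = q.negOnePow • (δ hp u).comp v h' := by
  rw [δ_comp u v h hr hp rfl (by omega) h', hv, comp_zero, zero_add]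

lemma IsClosed.comp {u : GradedHom M N p} {v : GradedHom N P q} (hu : u.IsClosed)
    (hv : v.IsClosed) (h : p + q = r) : (u.comp v h).IsClosed := by
  rw [IsClosed, δ_comp_of_isClosed_left hu v h rfl rfl (by omega), hv, comp_zero]

lemma IsExact.comp {u : GradedHom M N p} {v : GradedHom N P q} (hu : u.IsExact)
    (hv : v.IsClosed) (h : p + q = r) : (u.comp v h).IsExact := by
  obtain ⟨u, rfl⟩ := hu
  refine ⟨q.negOnePow • u.comp v (by omega : _ = r - 1), ?_⟩
  rw [Units.smul_def, map_zsmul, δ_comp_of_isClosed_right u hv _ _ (sub_add_cancel p 1) h,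
    ← Units.smul_def, smul_smul, Int.units_mul_self, one_smul]

lemma IsClosed.comp_isExact {u : GradedHom M N p} {v : GradedHom N P q} (hu : u.IsClosed)
    (hv : v.IsExact) (h : p + q = r) : (u.comp v h).IsExact := by
  obtain ⟨v, rfl⟩ := hv
  exact ⟨u.comp v (by omega), δ_comp_of_isClosed_left hu v _ _ _ h⟩

lemma isClosed_ofHom (f : M ⟶ N) : (ofHom f).IsClosed := δ_ofHom f

lemma δ_ofHom_comp (f : M ⟶ N) (u : GradedHom N P p) (h : p + 1 = q) :
    δ h ((ofHom f).comp u (zero_add p)) = (ofHom f).comp (δ h u) (zero_add q) :=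
  δ_comp_of_isClosed_left (isClosed_ofHom f) u _ h h _

lemma δ_comp_ofHom (u : GradedHom M N p) (f : N ⟶ P) (h : p + 1 = q) :
    δ h (u.comp (ofHom f) (add_zero p)) = (δ h u).comp (ofHom f) (add_zero q) := by
  rw [δ_comp_of_isClosed_right u (isClosed_ofHom f) _ h h (add_zero q), Int.negOnePow_zero,
    one_smul]

lemma toHot_map_eq_iff_isExact (f g : M ⟶ N) :
    (toHot R).map f = (toHot R).map g ↔ (ofHom f - ofHom g).IsExact :=
  (toHot_map_eq_iff f g).trans
    ⟨fun ⟨s, hs⟩ => hs ▸ isExact_δ _ s, fun h => h.exists_δ_eq (neg_add_cancel 1)⟩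

variable (R) in
/-- The unit of the dg algebra as an element of the free dg module. -/
def freeOne : (free R).X 0 := (1 : R.gr 0)

lemma freeOne_act {i : ℤ} (a : (free R).X i) : (free R).act (zero_add i) (freeOne R) a = a :=
  Subtype.ext (one_mul (Subtype.val (p := (· ∈ R.gr i)) a))

/-- The homogeneous map out of the free dg module sending `1` to a given element. -/
def ofElem (p : ℤ) : N.X p →+ GradedHom (free R) N p :=
  AddMonoidHom.mk' (fun x =>
    { f := fun {i j} h => N.act (by omega : p + i = j) x
      map_act := fun h _ _ _ b a => (N.act_act _ _ h _ x b a).symm })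
    (fun x y => by
      ext
      exact DFunLike.congr_fun (map_add _ _ _) _)

lemma ofElem_f_freeOne (u : GradedHom (free R) N p) :
    ofElem p (u.f (zero_add p) (freeOne R)) = u := by
  ext i j h a
  refine (u.map_act (zero_add i) h (zero_add p) (by omega) (freeOne R) a).symm.trans ?_
  rw [freeOne_act]

lemma ofElem_eq_zero_iff {x : N.X p} : ofElem p x = 0 ↔ x = 0 := by
  refine ⟨fun h => ?_, fun h => by rw [h, map_zero]⟩
  rw [← N.act_one x]
  exact congrArg (fun u => u.f (zero_add p) (freeOne R)) h

lemma ofElem_comp (x : M.X p) (u : GradedHom M N q) (h : p + q = r) :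
    (ofElem p x).comp u h = ofElem r (u.f h x) := by
  ext i j hij a
  rw [comp_f _ _ h hij rfl (by omega)]
  exact u.map_act (by omega) _ h (by omega) x a

lemma δ_ofElem (x : N.X p) (h : p + 1 = q) : δ h (ofElem p x) = ofElem q (N.d h x) := by
  ext i j hij a
  rw [δ_f h _ hij rfl (by omega) rfl (by omega)]
  refine (congrArg₂ _ (N.d_act (by omega) (by omega) h rfl (by omega) (by omega) x a)
    rfl).trans ?_
  exact add_sub_cancel_right _ _

/-- The identification of a shift with the original dg module, of degree `n`. -/
def shiftHom (n : ℤ) (M : DGMod R) : GradedHom (M.shift n) M n where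
  f h := M.cast h
  map_act h hn hi h' x a := by
    subst hn hi
    rfl

/-- The inverse of `shiftHom`. -/
def shiftInv (n : ℤ) (M : DGMod R) : GradedHom M (M.shift n) (-n) where
  f {i j} h := M.cast (by omega : i = j + n)
  map_act {i j l i' l'} h hn hi h' x a := by
    obtain rfl : i = i' + n := by omega
    obtain rfl : l = l' + n := by omega
    rfl

lemma shiftHom_comp_shiftInv (n : ℤ) (M : DGMod R) :
    (shiftHom n M).comp (shiftInv n M) (add_neg_cancel n) = id (M.shift n) := by
  ext i j h x
  obtain rfl : i = j := by omega
  rw [comp_f _ _ _ h rfl (by omega)]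
  rfl

lemma shiftInv_comp_shiftHom (n : ℤ) (M : DGMod R) :
    (shiftInv n M).comp (shiftHom n M) (neg_add_cancel n) = id M := by
  ext i j h x
  obtain rfl : i = j := by omega
  obtain ⟨m, rfl⟩ : ∃ m, i = m + n := ⟨i - n, by omega⟩
  rw [comp_f _ _ _ h (by omega : m + n + -n = m) rfl]
  rfl

lemma isClosed_shiftHom (n : ℤ) (M : DGMod R) : (shiftHom n M).IsClosed := by
  ext i j h x
  obtain rfl : i + n + 1 = j := by omega
  rw [δ_f rfl _ h rfl rfl rfl (by omega)]
  have e : (shiftHom n M).f (by omega : i + 1 + n = i + n + 1) ((M.shift n).d rfl x) =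
      n.negOnePow • M.d rfl x := by
    have key : ∀ (m : ℤ) (hm : i + 1 + n = m), (shiftHom n M).f hm ((M.shift n).d rfl x) =
      n.negOnePow • M.d (by omega : i + n + 1 = m) x := by
      rintro m rfl
      rfl
    exact key _ _
  rw [e, smul_smul, Int.units_mul_self, one_smul]
  exact sub_self _

lemma isClosed_shiftInv (n : ℤ) (M : DGMod R) : (shiftInv n M).IsClosed := by
  have h := δ_comp_of_isClosed_left (isClosed_shiftHom n M) (shiftInv n M) (add_neg_cancel n)
    (zero_add 1) rfl (by omega)
  rw [shiftHom_comp_shiftInv, δ_ofHom] at h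
  rw [IsClosed, ← id_comp (δ rfl (shiftInv n M)) (zero_add _), ← shiftInv_comp_shiftHom n M,
    comp_assoc _ _ _ _ _ (by omega : n + (-n + 1) = 1) (by omega), ← h, comp_zero]

section Cone

variable (f : M ⟶ N)

lemma cone_d_eq {i j : ℤ} (h : i + 1 = j) (y : N.X i) (x : M.X (i + 1)) :
    (cone f).d h (y, x) = (N.d h y + f.f j (M.cast h x), -M.d (by omega) x) := by
  subst h
  rfl

/-- The inclusion of the target into the cone. -/
def coneInl : N ⟶ cone f where
  f i := AddMonoidHom.inl _ _
  map_act h x a := (Prod.ext rfl (by simp) :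
    (N.act h x a, 0) = (N.act h x a, M.act (by omega) 0 a))
  map_d h x := ((cone_d_eq f h x 0).trans (by simp; rfl)).symm

/-- The inclusion of the source into the cone, of degree `-1`. -/
def coneInr : GradedHom M (cone f) (-1) where
  f {i j} h := (AddMonoidHom.inr _ _).comp (M.cast (by omega : i = j + 1))
  map_act {i j l i' l'} h hn hi h' x a := by
    obtain rfl : i = i' + 1 := by omega
    obtain rfl : l = l' + 1 := by omega
    exact (Prod.ext (by simp) rfl :
      ((0 : N.X l'), M.act h x a) = (N.act h' 0 a, M.act (by omega) x a))

/-- The projection of the cone onto the target, of degree `0`. -/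
def coneFst : GradedHom (cone f) N 0 where
  f {i j} h := (N.cast (by omega)).comp (AddMonoidHom.fst _ _)
  map_act {i j l i' l'} h hn hi h' x a := by
    obtain rfl : i = i' := by omega
    obtain rfl : l = l' := by omega
    rfl

/-- The projection of the cone onto the source, of degree `1`. -/
def coneSnd : GradedHom (cone f) M 1 where
  f h := (M.cast h).comp (AddMonoidHom.snd _ _)
  map_act {i j l i' l'} h hn hi h' x a := by
    subst hn hi
    rfl

lemma coneInl_comp_coneFst : (ofHom (coneInl f)).comp (coneFst f) (add_zero 0) = id N := by
  ext i j h x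
  obtain rfl : i = j := by omega
  rw [comp_f _ _ _ h h h]
  rfl

lemma coneInl_comp_coneSnd : (ofHom (coneInl f)).comp (coneSnd f) (zero_add 1) = 0 := by
  ext i j h x
  subst h
  rw [comp_f _ _ _ rfl (add_zero i) rfl]
  rfl

lemma coneInr_comp_coneFst : (coneInr f).comp (coneFst f) (add_zero (-1)) = 0 := by
  ext i j h x
  rw [comp_f _ _ _ h h (add_zero j)]
  rfl

lemma coneInr_comp_coneSnd : (coneInr f).comp (coneSnd f) (neg_add_cancel 1) = id M := by
  ext i j h x
  obtain rfl : i = j := by omega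
  obtain ⟨m, rfl⟩ : ∃ m, i = m + 1 := ⟨i - 1, by omega⟩
  rw [comp_f _ _ _ h (by omega : m + 1 + -1 = m) rfl]
  rfl

lemma coneFst_comp_coneInl_add : (coneFst f).comp (ofHom (coneInl f)) (add_zero 0) +
    (coneSnd f).comp (coneInr f) (add_neg_cancel 1) = id (cone f) := by
  ext i j h x
  obtain rfl : i = j := by omega
  rw [add_f, comp_f _ _ _ h h h, comp_f _ _ _ h rfl (by omega)]
  exact Prod.ext (add_zero _) (zero_add _)

lemma isClosed_coneSnd : (coneSnd f).IsClosed := by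
  ext i j h x
  obtain rfl : i + 1 + 1 = j := by omega
  rw [δ_f rfl _ h rfl rfl rfl rfl]
  simp only [Int.negOnePow_one, Units.neg_smul, one_smul]
  exact sub_eq_zero.2 (neg_neg _).symm

lemma δ_coneFst : δ (zero_add 1) (coneFst f) = -(coneSnd f).comp (ofHom f) (add_zero 1) := by
  ext i j h x
  subst h
  rw [δ_f _ _ rfl (add_zero i) rfl rfl (add_zero _), neg_f, comp_f _ _ _ rfl rfl (add_zero _),
    Int.negOnePow_zero, one_smul]
  exact sub_add_cancel_left _ _

lemma δ_coneInr : δ (neg_add_cancel 1) (coneInr f) =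
    (ofHom f).comp (ofHom (coneInl f)) (add_zero 0) := by
  ext i j h x
  obtain rfl : i = j := by omega
  obtain ⟨m, rfl⟩ : ∃ m, i = m + 1 := ⟨i - 1, by omega⟩
  rw [δ_f _ _ h (by omega : m + 1 + -1 = m) rfl rfl (by omega), ofHom_comp_ofHom, Int.negOnePow_neg,
    Int.negOnePow_one, Units.neg_smul, one_smul, sub_neg_eq_add]
  refine (congrArg (· + _) ((cone_d_eq f rfl 0 x).trans (congrArg (·, _)
    ((congrArg (· + _) (map_zero _)).trans (zero_add _))))).trans ?_
  exact Prod.ext (add_zero _) (neg_add_cancel _)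

variable {f} in
/-- The homogeneous map out of the cone with given restrictions to the two summands. -/
def coneDesc (h : 1 + q = p) (y : GradedHom N P p) (x : GradedHom M P q) :
    GradedHom (cone f) P p :=
  (coneFst f).comp y (zero_add p) + (coneSnd f).comp x h

variable {f}

lemma coneInl_comp_coneDesc (h : 1 + q = p) (y : GradedHom N P p) (x : GradedHom M P q) :
    (ofHom (coneInl f)).comp (coneDesc h y x) (zero_add p) = y := by
  rw [coneDesc, comp_add, ← comp_assoc _ _ _ (add_zero 0) (zero_add p), coneInl_comp_coneFst,
    ← comp_assoc _ _ _ (zero_add 1) h, coneInl_comp_coneSnd, id_comp, zero_comp, add_zero]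

lemma coneInr_comp_coneDesc (h : 1 + q = p) (h' : -1 + p = q) (y : GradedHom N P p)
    (x : GradedHom M P q) : (coneInr f).comp (coneDesc h y x) h' = x := by
  rw [coneDesc, comp_add, ← comp_assoc _ _ _ (add_zero (-1)) h', coneInr_comp_coneFst,
    ← comp_assoc _ _ _ (neg_add_cancel 1) (zero_add q), coneInr_comp_coneSnd, id_comp, zero_comp,
    zero_add]

lemma coneDesc_comp (h : 1 + q = p) (y : GradedHom N P p) (x : GradedHom M P q)
    {s p' q' : ℤ} (w : GradedHom P Q s) (hp : p + s = p') (hq : q + s = q') (h' : 1 + q' = p') :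
    (coneDesc (f := f) h y x).comp w hp = coneDesc h' (y.comp w hp) (x.comp w hq) := by
  rw [coneDesc, add_comp, comp_assoc _ _ _ _ _ hp (zero_add p'), comp_assoc _ _ _ _ _ hq h']
  rfl

lemma coneDesc_coneInl_coneInr :
    coneDesc (add_neg_cancel 1) (ofHom (coneInl f)) (coneInr f) = id (cone f) :=
  coneFst_comp_coneInl_add f

lemma coneDesc_eta (h : 1 + q = p) (h' : -1 + p = q) (u : GradedHom (cone f) P p) :
    coneDesc h ((ofHom (coneInl f)).comp u (zero_add p)) ((coneInr f).comp u h') = u := by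
  rw [← coneDesc_comp (add_neg_cancel 1), coneDesc_coneInl_coneInr, id_comp]

lemma coneDesc_sub (h : 1 + q = p) (y y' : GradedHom N P p) (x x' : GradedHom M P q) :
    coneDesc (f := f) h y x - coneDesc h y' x' = coneDesc h (y - y') (x - x') := by
  simp only [coneDesc, comp_sub]
  abel

lemma δ_coneDesc (h : 1 + q = p) (y : GradedHom N P p) (x : GradedHom M P q) {p' : ℤ}
    (hp : p + 1 = p') (hq : q + 1 = p) (h' : 1 + p = p') :
    δ hp (coneDesc (f := f) h y x) =
      coneDesc h' (δ hp y) (δ hq x - p.negOnePow • (ofHom f).comp y (zero_add p)) := by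
  rw [coneDesc, map_add, δ_comp_of_isClosed_left (isClosed_coneSnd f) x h hp hq h',
    δ_comp _ _ _ hp (zero_add 1) hp (zero_add p') h', δ_coneFst, neg_comp,
    comp_assoc _ _ _ (add_zero 1) h' (zero_add p) h', coneDesc, comp_sub]
  obtain h | h := Int.units_eq_one_or p.negOnePow <;> rw [h] <;> simp <;> abel

lemma isClosed_coneDesc {y : GradedHom N P 0} {x : GradedHom M P (-1)} (hy : y.IsClosed)
    (hx : δ (neg_add_cancel 1) x = (ofHom f).comp y (zero_add 0)) :
    (coneDesc (f := f) (add_neg_cancel 1) y x).IsClosed := by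
  rw [IsClosed, δ_coneDesc _ _ _ _ (neg_add_cancel 1) rfl, hx, hy.δ_eq_zero, Int.negOnePow_zero,
    one_smul, sub_self, coneDesc, comp_zero, comp_zero, add_zero]

end Cone

end GradedHom

open GradedHom

lemma nonempty_retract_iff : Nonempty (Retract ((toHot R).obj M) ((toHot R).obj N)) ↔
    ∃ (i : M ⟶ N) (p : N ⟶ M), (ofHom (i ≫ p) - ofHom (𝟙 M)).IsExact := by
  simp only [← toHot_map_eq_iff_isExact, Functor.map_comp, CategoryTheory.Functor.map_id]
  constructor
  · rintro ⟨r⟩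
    obtain ⟨i, hi⟩ := (toHot R).map_surjective r.i
    obtain ⟨p, hp⟩ := (toHot R).map_surjective r.r
    exact ⟨i, p, by rw [hi, hp, r.retract]⟩
  · rintro ⟨i, p, h⟩
    exact ⟨⟨_, _, h⟩⟩

lemma nonempty_retract_of_isExact {u : GradedHom M N 0} {v : GradedHom N M 0} (hu : u.IsClosed)
    (hv : v.IsClosed) (h : (u.comp v (add_zero 0) - GradedHom.id M).IsExact) :
    Nonempty (Retract ((toHot R).obj M) ((toHot R).obj N)) := by
  refine nonempty_retract_iff.2 ⟨u.toHom (hu.δ_eq_zero _), v.toHom (hv.δ_eq_zero _), ?_⟩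
  rwa [← ofHom_comp_ofHom, ofHom_toHom, ofHom_toHom]

lemma nonempty_retract_shift {n : ℤ} {u : GradedHom M N n} {v : GradedHom N M (-n)}
    (hu : u.IsClosed) (hv : v.IsClosed)
    (h : (u.comp v (add_neg_cancel n) - GradedHom.id M).IsExact) :
    Nonempty (Retract ((toHot R).obj M) ((toHot R).obj (N.shift n))) := by
  refine nonempty_retract_of_isExact (hu.comp (isClosed_shiftInv n N) (add_neg_cancel n))
    ((isClosed_shiftHom n N).comp hv (add_neg_cancel n)) ?_
  rwa [comp_assoc _ _ _ _ _ (by omega : -n + 0 = -n) (by omega),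
    ← comp_assoc _ _ _ (by omega : -n + n = 0) (by omega) (by omega) (by omega),
    shiftInv_comp_shiftHom, id_comp]

lemma IsPerfect.of_comp_eq_id (hN : IsPerfect R ((toHot R).obj N)) {n m : ℤ}
    {u : GradedHom M N n} {v : GradedHom N M m} (hu : u.IsClosed) (hv : v.IsClosed)
    (h : n + m = 0) (huv : u.comp v h = GradedHom.id M) : IsPerfect R ((toHot R).obj M) := by
  obtain rfl : m = -n := by omega
  exact .summand (nonempty_retract_shift hu hv (by rw [huv, sub_self]; exact ⟨0, map_zero _⟩)).some
    (.shift n N hN)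

/-- Every cocycle is a coboundary. -/
def IsAcyclic (M : DGMod R) : Prop :=
  ∀ ⦃i j l : ℤ⦄ (h : i + 1 = j) (h' : j + 1 = l) (x : M.X j), M.d h' x = 0 → ∃ y, M.d h y = x

/-- Closed homogeneous maps of any degree to acyclic dg modules are exact. -/
def IsHomotopyProjective (M : DGMod R) : Prop :=
  ∀ ⦃Z : DGMod R⦄, Z.IsAcyclic → ∀ ⦃p : ℤ⦄ (u : GradedHom M Z p), u.IsClosed → u.IsExact

lemma isExact_of_free {p : ℤ} {u : GradedHom (free R) N p} (hu : u.IsClosed)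
    (hN : ∀ x : N.X p, N.d rfl x = 0 → ∃ y, N.d (sub_add_cancel p 1) y = x) : u.IsExact := by
  obtain ⟨y, hy⟩ := hN (u.f (zero_add p) (freeOne R)) <|
    ofElem_eq_zero_iff.1 (by rw [← δ_ofElem, ofElem_f_freeOne]; exact hu)
  exact ⟨ofElem _ y, by rw [δ_ofElem, hy, ofElem_f_freeOne]⟩

lemma isHomotopyProjective_free : IsHomotopyProjective (free R) := fun _ hZ p _ hu =>
  isExact_of_free hu fun x => hZ (sub_add_cancel p 1) rfl x

lemma IsHomotopyProjective.of_comp_eq (hN : N.IsHomotopyProjective) {n : ℤ} {u : GradedHom M N n}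
    {v : GradedHom N M (-n)} (hu : u.IsClosed) (hv : v.IsClosed)
    (h : (u.comp v (add_neg_cancel n) - GradedHom.id M).IsExact) : M.IsHomotopyProjective := by
  intro Z hZ p w hw
  have h₁ := hu.comp_isExact (hN hZ _ (hv.comp hw rfl)) (by omega : n + (-n + p) = p)
  rw [← comp_assoc _ _ _ (add_neg_cancel n) (zero_add p)] at h₁
  have h₂ := (h.comp hw (zero_add p)).neg.add h₁
  rwa [sub_comp, id_comp, neg_sub, sub_add_cancel] at h₂

lemma IsHomotopyProjective.shift (hM : M.IsHomotopyProjective) (n : ℤ) :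
    (M.shift n).IsHomotopyProjective := by
  refine hM.of_comp_eq (isClosed_shiftHom n M) (isClosed_shiftInv n M) ?_
  rw [shiftHom_comp_shiftInv, sub_self]
  exact ⟨0, map_zero _⟩

lemma IsHomotopyProjective.cone (hM : M.IsHomotopyProjective) (hN : N.IsHomotopyProjective)
    (f : M ⟶ N) : (cone f).IsHomotopyProjective := by
  intro Z hZ p u hu
  obtain ⟨q, rfl⟩ : ∃ q, q + 1 = p := ⟨p - 1, by omega⟩
  set y : GradedHom N Z (q + 1) := (ofHom (coneInl f)).comp u (zero_add _)
  set x : GradedHom M Z q := (coneInr f).comp u (by omega) with hx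
  have hδx : δ rfl x = (q + 1).negOnePow • (ofHom f).comp y (zero_add _) := by
    rw [hx, δ_comp_of_isClosed_right _ hu _ _ (neg_add_cancel 1) (zero_add _), δ_coneInr,
      comp_assoc _ _ _ _ _ (zero_add _)]
  obtain ⟨v, hv⟩ := (hN hZ y ((isClosed_ofHom _).comp hu _)).exists_δ_eq rfl
  obtain ⟨w, hw⟩ := (hM hZ (x + q.negOnePow • (ofHom f).comp v (zero_add q)) (by
    rw [GradedHom.IsClosed, map_add, hδx, Units.smul_def q.negOnePow, map_zsmul,
      δ_comp_of_isClosed_left (isClosed_ofHom f) v _ rfl rfl (zero_add _), hv, ← Units.smul_def,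
      Int.negOnePow_succ, Units.neg_smul, neg_add_cancel])).exists_δ_eq (sub_add_cancel q 1)
  have hu' : u = coneDesc (add_comm _ _) y x := (coneDesc_eta _ (by omega) u).symm
  rw [hu', ← add_sub_cancel_right x (q.negOnePow • (ofHom f).comp v (zero_add q)), ← hw, ← hv,
    ← δ_coneDesc (by omega) v w rfl _ _]
  exact isExact_δ _ _

lemma IsPerfect.isHomotopyProjective (hM : IsPerfect R ((toHot R).obj M)) :
    M.IsHomotopyProjective := by
  suffices h : ∀ X : Hot R, IsPerfect R X → X.as.IsHomotopyProjective from h _ hM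
  intro X hX
  induction hX with
  | free => exact isHomotopyProjective_free
  | shift n M _ hM => exact hM.shift n
  | cone f _ _ hM hN => exact hM.cone hN f
  | @summand X Y r _ hY =>
    obtain ⟨i, p, h⟩ := nonempty_retract_iff.1 ⟨r⟩
    refine hY.of_comp_eq (n := 0) (isClosed_ofHom i) (isClosed_ofHom p) ?_
    rwa [ofHom_comp_ofHom]

lemma nonempty_retract_cone_comp (f : M ⟶ N) {a : N ⟶ P} {b : P ⟶ N}
    (h : (ofHom (a ≫ b) - ofHom (𝟙 N)).IsExact) :
    Nonempty (Retract ((toHot R).obj (cone f)) ((toHot R).obj (cone (f ≫ a)))) := by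
  obtain ⟨s, hs⟩ := h.exists_δ_eq (neg_add_cancel 1)
  let sInl : GradedHom N (cone f) (-1) := s.comp (ofHom (coneInl f)) (add_zero _)
  have hsInl : δ (neg_add_cancel 1) sInl = ofHom (a ≫ b ≫ coneInl f) - ofHom (coneInl f) := by
    rw [δ_comp_of_isClosed_right s (isClosed_ofHom _) _ _ (neg_add_cancel 1) (add_zero 0), hs,
      Int.negOnePow_zero, one_smul, sub_comp, ofHom_comp_ofHom, ofHom_comp_ofHom, Category.id_comp,
      Category.assoc]
  have hfsInl := δ_comp_of_isClosed_left (isClosed_ofHom f) sInl (zero_add _) (neg_add_cancel 1)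
    (neg_add_cancel 1) (zero_add 0)
  refine nonempty_retract_of_isExact
    (u := coneDesc (add_neg_cancel 1) (ofHom (a ≫ coneInl (f ≫ a))) (coneInr (f ≫ a)))
    (v := coneDesc (add_neg_cancel 1) (ofHom (b ≫ coneInl f))
      (coneInr f + (ofHom f).comp sInl (zero_add _)))
    (isClosed_coneDesc (isClosed_ofHom _) ?_) (isClosed_coneDesc (isClosed_ofHom _) ?_) ?_
  · rw [δ_coneInr, ofHom_comp_ofHom, ofHom_comp_ofHom, Category.assoc]
  · rw [map_add, δ_coneInr, hfsInl, hsInl, comp_sub, add_sub_cancel, ofHom_comp_ofHom,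
      ofHom_comp_ofHom, Category.assoc]
  · suffices e : _ - GradedHom.id (cone f) = δ (neg_add_cancel 1)
        (coneDesc (by omega : 1 + (-2) = (-1 : ℤ)) sInl 0) from e ▸ isExact_δ _ _
    rw [δ_coneDesc _ _ _ _ (by omega) (add_neg_cancel 1), hsInl, map_zero, zero_sub,
      coneDesc_comp _ _ _ _ _ (add_zero _) (add_neg_cancel 1), ← ofHom_comp_ofHom,
      comp_assoc _ _ _ _ _ (zero_add 0), coneInl_comp_coneDesc, coneInr_comp_coneDesc,
      ← coneDesc_coneInl_coneInr, coneDesc_sub, ofHom_comp_ofHom, add_sub_cancel_left]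
    · simp
    · rfl

lemma nonempty_retract_comp_cone (f : M ⟶ N) {a : M ⟶ P} {b : P ⟶ M}
    (h : (ofHom (a ≫ b) - ofHom (𝟙 M)).IsExact) :
    Nonempty (Retract ((toHot R).obj (cone f)) ((toHot R).obj (cone (b ≫ f)))) := by
  obtain ⟨s, hs⟩ := h.exists_δ_eq (neg_add_cancel 1)
  let sf : GradedHom M N (-1) := s.comp (ofHom f) (add_zero _)
  have hsf : δ (neg_add_cancel 1) sf = ofHom (a ≫ b ≫ f) - ofHom f := by
    rw [δ_comp_of_isClosed_right s (isClosed_ofHom _) _ _ (neg_add_cancel 1) (add_zero 0), hs,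
      Int.negOnePow_zero, one_smul, sub_comp, ofHom_comp_ofHom, ofHom_comp_ofHom, Category.id_comp,
      Category.assoc]
  refine nonempty_retract_of_isExact
    (u := coneDesc (add_neg_cancel 1) (ofHom (coneInl (b ≫ f)))
      ((ofHom a).comp (coneInr (b ≫ f)) (zero_add _) -
        sf.comp (ofHom (coneInl (b ≫ f))) (add_zero _)))
    (v := coneDesc (add_neg_cancel 1) (ofHom (coneInl f)) ((ofHom b).comp (coneInr f) (zero_add _)))
    (isClosed_coneDesc (isClosed_ofHom _) ?_) (isClosed_coneDesc (isClosed_ofHom _) ?_) ?_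
  · rw [map_sub, δ_comp_of_isClosed_left (isClosed_ofHom a) _ _ _ (neg_add_cancel 1) (zero_add 0),
      δ_coneInr, δ_comp_of_isClosed_right sf (isClosed_ofHom _) _ _ (neg_add_cancel 1) (add_zero 0),
      hsf]
    simp [ofHom_comp_ofHom]
  · rw [δ_comp_of_isClosed_left (isClosed_ofHom b) _ _ _ (neg_add_cancel 1) (zero_add 0),
      δ_coneInr]
    simp [ofHom_comp_ofHom]
  · suffices e : _ - GradedHom.id (cone f) = -δ (neg_add_cancel 1)
        (coneDesc (by omega : 1 + (-2) = (-1 : ℤ)) 0 (s.comp (coneInr f) (by omega))) from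
      e ▸ (isExact_δ _ _).neg
    rw [coneDesc_comp _ _ _ _ _ (add_zero _) (add_neg_cancel 1), coneInl_comp_coneDesc, sub_comp,
      comp_assoc _ _ _ (zero_add _) (add_zero _) (add_zero _) (zero_add _), coneInr_comp_coneDesc,
      comp_assoc _ _ _ (add_zero _) (add_zero _) (add_zero _) (add_zero _), coneInl_comp_coneDesc,
      ← coneDesc_coneInl_coneInr, coneDesc_sub, δ_coneDesc _ _ _ _ (by omega) (add_neg_cancel 1),
      δ_comp s _ _ _ (neg_add_cancel 1) (neg_add_cancel 1) (add_zero _) (zero_add _), hs,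
      δ_coneInr]
    simp only [coneDesc, ← ofHom_comp_ofHom, sf, map_zero, comp_zero, comp_sub, sub_comp,
      id_comp, zero_add, Int.negOnePow_neg, Int.negOnePow_one, Units.neg_smul, one_smul]
    rw [comp_assoc s _ _ _ (add_zero _) (zero_add 0) (add_zero _), comp_assoc (ofHom a) _ _ _
      (zero_add _) (zero_add _) (zero_add _)]
    simp only [comp_neg, comp_sub, comp_add, comp_zero]
    abel

section FiniteRank

variable {p q r : ℤ} {S T : Set ℤ}

/-- The homogeneous maps of the form `x ↦ ∑ yᵢ · aᵢ(x)` with `aᵢ` taking values in the dg algebra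
and the degrees of the finitely many elements `yᵢ` in `S`. -/
def finiteRank (S : Set ℤ) (M N : DGMod R) (p : ℤ) : AddSubmonoid (GradedHom M N p) :=
  AddSubmonoid.closure {u | ∃ n ∈ S, ∃ (q : ℤ) (h : q + n = p) (a : GradedHom M (free R) q)
    (y : N.X n), u = a.comp (ofElem n y) h}

lemma comp_ofElem_mem_finiteRank (a : GradedHom M (free R) q) {n : ℤ} (y : N.X n)
    (h : q + n = p) (hn : n ∈ S) : a.comp (ofElem n y) h ∈ finiteRank S M N p :=
  AddSubmonoid.subset_closure ⟨n, hn, q, h, a, y, rfl⟩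

lemma ofElem_mem_finiteRank {n : ℤ} (y : N.X n) (hn : n ∈ S) :
    ofElem n y ∈ finiteRank S (free R) N n := by
  rw [← id_comp (ofElem n y) (zero_add n)]
  exact comp_ofElem_mem_finiteRank _ y _ hn

lemma finiteRank_induction {motive : ∀ u : GradedHom M N p, u ∈ finiteRank S M N p → Prop}
    (zero : motive 0 (zero_mem _))
    (add : ∀ u v hu hv, motive u hu → motive v hv → motive (u + v) (add_mem hu hv))
    (comp : ∀ n (hn : n ∈ S) q (h : q + n = p) (a : GradedHom M (free R) q) (y : N.X n),
      motive (a.comp (ofElem n y) h) (comp_ofElem_mem_finiteRank a y h hn))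
    {u : GradedHom M N p} (hu : u ∈ finiteRank S M N p) : motive u hu := by
  induction hu using AddSubmonoid.closure_induction with
  | mem u hu =>
    obtain ⟨n, hn, q, h, a, y, rfl⟩ := hu
    exact comp n hn q h a y
  | zero => exact zero
  | add u v _ _ hu hv => exact add u v _ _ hu hv

lemma finiteRank_mono (h : S ⊆ T) : finiteRank S M N p ≤ finiteRank T M N p :=
  AddSubmonoid.closure_mono fun _ ⟨n, hn, hu⟩ => ⟨n, h hn, hu⟩

lemma comp_mem_finiteRank (u : GradedHom M N p) {v : GradedHom N P q}
    (hv : v ∈ finiteRank S N P q) (h : p + q = r) : u.comp v h ∈ finiteRank S M P r := by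
  induction hv using finiteRank_induction with
  | zero => rw [comp_zero]; exact zero_mem _
  | add v w _ _ hv hw => rw [comp_add]; exact add_mem hv hw
  | comp n hn q' h' a y =>
    rw [← comp_assoc u a _ rfl (by omega)]
    exact comp_ofElem_mem_finiteRank _ _ _ hn

lemma mem_finiteRank_comp {u : GradedHom M N p} (hu : u ∈ finiteRank S M N p)
    (v : GradedHom N P q) (h : p + q = r) (hT : ∀ n ∈ S, n + q ∈ T) :
    u.comp v h ∈ finiteRank T M P r := by
  induction hu using finiteRank_induction with
  | zero => rw [zero_comp]; exact zero_mem _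
  | add u w _ _ hu hw => rw [add_comp]; exact add_mem hu hw
  | comp n hn q' h' a y =>
    rw [comp_assoc _ _ _ h' h rfl (by omega), ofElem_comp]
    exact comp_ofElem_mem_finiteRank _ _ _ (hT n hn)

/-- The graded module underlying `M` is a direct summand of a finite direct sum of shifts of the
free one whose generators have degrees in `S`; as for a dual basis, this is expressed by the
identity being of finite rank. -/
def IsFinProj (S : Set ℤ) (M : DGMod R) : Prop :=
  GradedHom.id M ∈ finiteRank S M M 0

lemma IsFinProj.mem_finiteRank (hM : M.IsFinProj S) (u : GradedHom M N p)
    (hT : ∀ n ∈ S, n + p ∈ T) : u ∈ finiteRank T M N p := by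
  rw [← id_comp u (zero_add p)]
  exact mem_finiteRank_comp hM u _ hT

lemma IsFinProj.of_comp_eq_id (hN : N.IsFinProj S) (u : GradedHom M N p) (v : GradedHom N M q)
    (h : p + q = 0) (huv : u.comp v h = GradedHom.id M) (hT : ∀ n ∈ S, n + q ∈ T) :
    M.IsFinProj T := by
  rw [IsFinProj, ← huv]
  exact comp_mem_finiteRank u (hN.mem_finiteRank v hT) h

lemma isFinProj_free : (free R).IsFinProj {0} := by
  have h := comp_ofElem_mem_finiteRank (S := {0}) (GradedHom.id (free R)) (freeOne R) (add_zero 0)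
    rfl
  have e : ofElem 0 (freeOne R) = GradedHom.id (free R) := ofElem_f_freeOne (GradedHom.id (free R))
  rwa [e, id_comp] at h

lemma IsFinProj.mem_finiteRank_univ (hM : M.IsFinProj S) (u : GradedHom M N p) :
    u ∈ finiteRank Set.univ M N p :=
  hM.mem_finiteRank u fun _ _ => Set.mem_univ _

lemma IsFinProj.shift (hM : M.IsFinProj Set.univ) (n : ℤ) : (M.shift n).IsFinProj Set.univ :=
  hM.of_comp_eq_id _ _ _ (shiftHom_comp_shiftInv n M) fun _ _ => Set.mem_univ _

lemma IsFinProj.cone (hM : M.IsFinProj Set.univ) (hN : N.IsFinProj Set.univ) (f : M ⟶ N) :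
    (cone f).IsFinProj Set.univ := by
  rw [IsFinProj, ← coneFst_comp_coneInl_add f]
  exact add_mem (comp_mem_finiteRank _ (hN.mem_finiteRank_univ _) _)
    (comp_mem_finiteRank _ (hM.mem_finiteRank_univ _) _)

lemma IsFinProj.exists_comp_eq (hM : M.IsFinProj S) {f : N ⟶ P}
    (hf : ∀ i, Function.Surjective (f.f i)) (u : GradedHom M P p) :
    ∃ v : GradedHom M N p, v.comp (ofHom f) (add_zero p) = u := by
  induction hM.mem_finiteRank_univ u using finiteRank_induction with
  | zero => exact ⟨0, zero_comp _ _⟩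
  | add u u' _ _ hu hu' =>
    obtain ⟨⟨v, rfl⟩, v', rfl⟩ := hu, hu'
    exact ⟨v + v', add_comp _ _ _ _⟩
  | comp n _ q h a y =>
    obtain ⟨x, rfl⟩ := hf n y
    refine ⟨a.comp (ofElem n x) h, ?_⟩
    rw [comp_assoc _ _ _ h _ (add_zero n) h, ofElem_comp, ofHom_f_self]

end FiniteRank

lemma IsPerfect.exists_retract {X : Hot R} (hX : IsPerfect R X) :
    ∃ N : DGMod R, N.IsFinProj Set.univ ∧ Nonempty (Retract X ((toHot R).obj N)) := by
  induction hX with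
  | free => exact ⟨DGMod.free R, isFinProj_free.mem_finiteRank_univ _, ⟨.refl _⟩⟩
  | shift n M _ hM =>
    obtain ⟨N, hN, r⟩ := hM
    obtain ⟨i, p, h⟩ := nonempty_retract_iff.1 r
    refine ⟨N.shift n, hN.shift n, nonempty_retract_shift (u := (shiftHom n M).comp (ofHom i)
      (add_zero n)) (v := (ofHom p).comp (shiftInv n M) (zero_add _))
      ((isClosed_shiftHom n M).comp (isClosed_ofHom i) _)
      ((isClosed_ofHom p).comp (isClosed_shiftInv n M) _) ?_⟩
    have h' := (isClosed_shiftHom n M).comp_isExact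
      (h.comp (isClosed_shiftInv n M) (zero_add (-n))) (add_neg_cancel n)
    rwa [sub_comp, comp_sub, id_comp, shiftHom_comp_shiftInv, ← ofHom_comp_ofHom,
      comp_assoc _ _ _ _ _ (zero_add _) (zero_add _), ← comp_assoc _ _ _ (add_zero n)
        (add_neg_cancel n) (zero_add _)] at h'
  | @cone M N f _ _ hM hN =>
    obtain ⟨M', hM', rM⟩ := hM
    obtain ⟨N', hN', rN⟩ := hN
    obtain ⟨iM, pM, hpM⟩ := nonempty_retract_iff.1 rM
    obtain ⟨iN, pN, hpN⟩ := nonempty_retract_iff.1 rN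
    exact ⟨DGMod.cone (pM ≫ f ≫ iN), hM'.cone hN' _,
      ⟨(nonempty_retract_cone_comp f hpN).some.trans
        (nonempty_retract_comp_cone (f ≫ iN) hpM).some⟩⟩
  | summand r _ hY =>
    obtain ⟨N, hN, ⟨r'⟩⟩ := hY
    exact ⟨N, hN, ⟨r.trans r'⟩⟩

section DegreeZero

variable {p q : ℤ}

instance (M : DGMod R) (i : ℤ) : Module (R.gr 0)ᵐᵒᵖ (M.X i) where
  smul a x := M.act (add_zero i) x a.unop
  one_smul x := M.act_one x
  mul_smul a b x := (M.act_act _ _ (add_zero 0) _ x b.unop a.unop).symm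
  smul_zero a := congrArg (· a.unop) (map_zero (M.act (add_zero i)))
  smul_add a x y := congrArg (· a.unop) (map_add (M.act (add_zero i)) x y)
  add_smul a b x := map_add (M.act (add_zero i) x) a.unop b.unop
  zero_smul x := map_zero (M.act (add_zero i) x)

/-- A homogeneous map, restricted to one degree, as a map of modules over the degree zero part of
the dg algebra. -/
def GradedHom.linearMap (u : GradedHom M N p) {i j : ℤ} (h : i + p = j) :
    M.X i →ₗ[(R.gr 0)ᵐᵒᵖ] N.X j where
  __ := u.f h
  map_smul' r x := u.map_act (add_zero i) h h (add_zero j) x r.unop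

instance [R.Admissible] : IsSemisimpleRing (R.gr 0)ᵐᵒᵖ :=
  have : IsSemisimpleRing (R.gr 0) := DGAlgebra.Admissible.semisimple
  inferInstance

lemma eq_zero_of_neg [R.Admissible] {i : ℤ} (hi : i < 0) (a : R.gr i) : a = 0 :=
  Subtype.ext ((DGAlgebra.Admissible.positive i hi).le a.2)

/-- The differential in one degree as a map of modules over the degree zero part of the dg
algebra. -/
def dLinearMap [R.Admissible] (M : DGMod R) {i j : ℤ} (h : i + 1 = j) :
    M.X i →ₗ[(R.gr 0)ᵐᵒᵖ] M.X j where
  __ := M.d h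
  map_smul' r x := by
    have hr : R.d (zero_add 1) r.unop = 0 :=
      Subtype.ext (DGAlgebra.Admissible.diff_zero _ r.unop.2)
    refine (M.d_act (add_zero i) h h (zero_add 1) (add_zero j) (by omega) x r.unop).trans ?_
    rw [hr, map_zero, smul_zero, add_zero]
    rfl

lemma apply_eq_zero_of_mem_finiteRank [R.Admissible] {S : Set ℤ} {u : GradedHom M N p}
    (hu : u ∈ finiteRank S M N p) {i j : ℤ} (h : i + p = j) (hS : ∀ n ∈ S, j < n) (x : M.X i) :
    u.f h x = 0 := by
  induction hu using finiteRank_induction with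
  | zero => rfl
  | add u v _ _ hu hv => rw [GradedHom.add_f, hu, hv, add_zero]
  | comp n hn q hq a y =>
    have ha : (a.f rfl x : R.gr (i + q)) = 0 := eq_zero_of_neg (by have := hS n hn; omega) _
    rw [GradedHom.comp_f a _ hq h rfl (by omega)]
    exact (congrArg _ ha).trans (map_zero _)

lemma eq_zero_of_mem_finiteRank {S : Set ℤ} (hS : ∀ n ∈ S, Subsingleton (N.X n))
    {u : GradedHom M N p} (hu : u ∈ finiteRank S M N p) : u = 0 := by
  induction hu using finiteRank_induction with
  | zero => rfl
  | add u v _ _ hu hv => rw [hu, hv, add_zero]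
  | comp n hn q hq a y =>
    have := hS n hn
    rw [Subsingleton.elim y 0, map_zero, comp_zero]

/-- The dg module `M` is, up to its differential, of the form `V ⊗ A` with `V` a finitely
generated projective module over the degree zero part of `A`. -/
def IsPure (M : DGMod R) : Prop := M.IsFinProj {0}

lemma IsPure.subsingleton_of_neg [R.Admissible] (hM : M.IsPure) {i : ℤ} (hi : i < 0) :
    Subsingleton (M.X i) :=
  subsingleton_of_forall_eq 0 fun x =>
    apply_eq_zero_of_mem_finiteRank hM (add_zero i) (by simpa using hi) x

lemma IsPure.hom_ext (hM : M.IsPure) {u v : GradedHom M N p}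
    (h : ∀ x : M.X 0, u.f (zero_add p) x = v.f (zero_add p) x) : u = v := by
  have key (e : GradedHom M M 0) (he : e ∈ finiteRank {0} M M 0) :
      e.comp u (zero_add p) = e.comp v (zero_add p) := by
    induction he using finiteRank_induction with
    | zero => rw [zero_comp, zero_comp]
    | add e e' _ _ he he' => rw [add_comp, add_comp, he, he']
    | comp n hn q hq a y =>
      obtain rfl : n = 0 := hn
      rw [comp_assoc a _ u hq _ (zero_add p) (by omega),
        comp_assoc a _ v hq _ (zero_add p) (by omega), ofElem_comp, ofElem_comp, h]
  simpa only [id_comp] using key _ hM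

lemma IsPure.exists_extension (hM : M.IsPure) (φ : M.X 0 →ₗ[(R.gr 0)ᵐᵒᵖ] N.X p) :
    ∃ u : GradedHom M N p, ∀ x, u.f (zero_add p) x = φ x := by
  have key (e : GradedHom M M 0) (he : e ∈ finiteRank {0} M M 0) :
      ∃ u : GradedHom M N p, ∀ x, u.f (zero_add p) x = φ (e.f (zero_add 0) x) := by
    induction he using finiteRank_induction with
    | zero => exact ⟨0, fun _ => (map_zero φ).symm⟩
    | add e e' _ _ he he' =>
      obtain ⟨⟨u, hu⟩, u', hu'⟩ := he, he'
      exact ⟨u + u', fun x => by rw [GradedHom.add_f, GradedHom.add_f, hu, hu', map_add]⟩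
    | comp n hn q hq a y =>
      obtain rfl : n = 0 := hn
      obtain rfl : q = 0 := by omega
      refine ⟨a.comp (ofElem p (φ y)) (zero_add p), fun x => ?_⟩
      rw [GradedHom.comp_f _ _ (zero_add p) _ (zero_add 0) (zero_add p),
        GradedHom.comp_f _ _ hq _ (zero_add 0) (zero_add 0)]
      exact (map_smul φ (MulOpposite.op (α := R.gr 0) (a.f (zero_add 0) x)) y).symm
  exact key _ hM

lemma IsPure.finite (hM : M.IsPure) : Module.Finite (R.gr 0)ᵐᵒᵖ (M.X 0) := by
  have key (e : GradedHom M M 0) (he : e ∈ finiteRank {0} M M 0) :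
      ∃ V : Submodule (R.gr 0)ᵐᵒᵖ (M.X 0), V.FG ∧ ∀ x, e.f (zero_add 0) x ∈ V := by
    induction he using finiteRank_induction with
    | zero => exact ⟨⊥, Submodule.fg_bot, fun _ => Submodule.zero_mem _⟩
    | add e e' _ _ he he' =>
      obtain ⟨⟨V, hV, h⟩, V', hV', h'⟩ := he, he'
      exact ⟨V ⊔ V', hV.sup hV', fun x => Submodule.add_mem_sup (h x) (h' x)⟩
    | comp n hn q hq a y =>
      obtain rfl : n = 0 := hn
      obtain rfl : q = 0 := by omega
      refine ⟨Submodule.span _ {y}, Submodule.fg_span_singleton y, fun x => ?_⟩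
      rw [GradedHom.comp_f _ _ hq _ (zero_add 0) (zero_add 0)]
      exact Submodule.smul_mem _ (MulOpposite.op (α := R.gr 0) (a.f (zero_add 0) x))
        (Submodule.mem_span_singleton_self y)
  obtain ⟨V, hV, h⟩ := key _ hM
  rw [(Submodule.eq_top_iff').2 h] at hV
  exact ⟨hV⟩

lemma IsPure.exists_comp_comp_eq [R.Admissible] (hM : M.IsPure) (hN : N.IsPure)
    (u : GradedHom M N 0) : ∃ v : GradedHom N M 0,
      (u.comp v (add_zero 0)).comp u (add_zero 0) = u := by
  obtain ⟨φ, hφ⟩ := exists_linearMap_comp_comp_eq (u.linearMap (add_zero 0))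
  obtain ⟨v, hv⟩ := hN.exists_extension φ
  refine ⟨v, hM.hom_ext fun x => ?_⟩
  rw [GradedHom.comp_f _ _ _ _ (add_zero 0) (add_zero 0),
    GradedHom.comp_f _ _ _ _ (add_zero 0) (add_zero 0), hv]
  exact LinearMap.congr_fun hφ x

end DegreeZero

section Plus

variable {p q : ℤ}

lemma GradedHom.map_mem_plus (u : GradedHom M N p) {i j : ℤ} (h : i + p = j) {x : M.X i}
    (hx : x ∈ M.plus i) : u.f h x ∈ N.plus j := by
  induction hx using AddSubgroup.closure_induction with
  | mem y hy =>
    obtain ⟨i', t, hi, ht, x, a, rfl⟩ := hy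
    exact AddSubgroup.subset_closure ⟨i' + p, t, by omega, ht, _, a,
      u.map_act hi h rfl (by omega) x a⟩
  | zero => rw [map_zero]; exact zero_mem _
  | add y z _ _ hy hz => rw [map_add]; exact add_mem hy hz
  | neg y _ hy => rw [map_neg]; exact neg_mem hy

lemma map_mem_plus (f : M ⟶ N) {i : ℤ} {x : M.X i} (hx : x ∈ M.plus i) : f.f i x ∈ N.plus i :=
  (ofHom f).map_mem_plus (add_zero i) hx

lemma ofElem_mem_finiteRank_of_mem_plus {n : ℤ} {S : Set ℤ} {y : N.X n} (hy : y ∈ N.plus n)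
    (hS : ∀ m < n, ∀ z : N.X m, ofElem m z ∈ finiteRank S (free R) N m) :
    ofElem n y ∈ finiteRank S (free R) N n := by
  induction hy using AddSubgroup.closure_induction with
  | mem y hy =>
    obtain ⟨m, j, h, hj, z, a, rfl⟩ := hy
    have hjm : j + m = n := by omega
    have hza : (ofElem j (show (free R).X j from a)).comp (ofElem m z) hjm =
        ofElem n (N.act h z a) := ofElem_comp _ _ hjm
    rw [← hza]
    exact comp_mem_finiteRank _ (hS m (by omega) z) hjm
  | zero => rw [map_zero]; exact zero_mem _
  | add y z _ _ hy hz => rw [map_add]; exact add_mem hy hz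
  | neg y _ hy =>
    rw [map_neg, ← id_comp (ofElem n y) (zero_add n), ← neg_comp]
    exact comp_mem_finiteRank _ hy (zero_add n)

lemma IsFinProj.exists_finite (hM : M.IsFinProj Set.univ) :
    ∃ S : Set ℤ, S.Finite ∧ M.IsFinProj S := by
  have key (e : GradedHom M M 0) (he : e ∈ finiteRank Set.univ M M 0) :
      ∃ S : Set ℤ, S.Finite ∧ e ∈ finiteRank S M M 0 := by
    induction he using finiteRank_induction with
    | zero => exact ⟨∅, Set.finite_empty, zero_mem _⟩
    | add e e' _ _ he he' =>
      obtain ⟨⟨S, hS, h⟩, S', hS', h'⟩ := he, he'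
      exact ⟨S ∪ S', hS.union hS', add_mem (finiteRank_mono Set.subset_union_left h)
        (finiteRank_mono Set.subset_union_right h')⟩
    | comp n _ q h a y =>
      exact ⟨{n}, Set.finite_singleton n, comp_ofElem_mem_finiteRank a y h rfl⟩
  exact key _ hM

lemma IsFinProj.exists_subsingleton [R.Admissible] (hM : M.IsFinProj Set.univ) :
    ∃ c, ∀ i < c, Subsingleton (M.X i) := by
  obtain ⟨S, hS, h⟩ := hM.exists_finite
  obtain ⟨c, hc⟩ := hS.bddBelow
  exact ⟨c, fun i hi => subsingleton_of_forall_eq 0 fun x =>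
    apply_eq_zero_of_mem_finiteRank h (add_zero i) (fun n hn => hi.trans_le (hc hn)) x⟩

lemma comp_mem_finiteRank_of_mem_plus {f : N ⟶ P} (hf : ∀ i x, f.f i x ∈ P.plus i) {m : ℤ}
    {u : GradedHom M N p} (hu : u ∈ finiteRank (Set.Iic m) M N p) :
    u.comp (ofHom f) (add_zero p) ∈ finiteRank (Set.Iic (m - 1)) M P p := by
  induction hu using finiteRank_induction with
  | zero => rw [zero_comp]; exact zero_mem _
  | add u v _ _ hu hv => rw [add_comp]; exact add_mem hu hv
  | comp n hn q h a y =>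
    rw [comp_assoc _ _ _ h _ (add_zero n) h, ofElem_comp, ofHom_f_self]
    have hn : n ≤ m := hn
    exact comp_mem_finiteRank a (ofElem_mem_finiteRank_of_mem_plus (hf n y) fun l hl z =>
      ofElem_mem_finiteRank z (show l ≤ m - 1 by omega)) h

lemma IsFinProj.isNilpotent [R.Admissible] (hN : N.IsFinProj Set.univ) {e : End N}
    (he : ∀ i x, e.f i x ∈ N.plus i) : IsNilpotent e := by
  obtain ⟨S, hS, hNS⟩ := hN.exists_finite
  obtain ⟨b, hb⟩ := hS.bddAbove
  obtain ⟨c, hc⟩ := hN.exists_subsingleton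
  have hpow (n : ℕ) : ofHom (e ^ n) ∈ finiteRank (Set.Iic (b - n)) N N 0 := by
    induction n with
    | zero => exact finiteRank_mono (fun n hn => (hb hn).trans (by simp)) hNS
    | succ n ih =>
      have h := comp_mem_finiteRank_of_mem_plus he ih
      rw [ofHom_comp_ofHom, sub_sub] at h
      rw [pow_succ']
      exact_mod_cast h
  refine ⟨(b - c + 1).toNat, ofHom_injective ?_⟩
  rw [map_zero]
  refine eq_zero_of_mem_finiteRank (fun n hn => hc n ?_) (hpow _)
  rw [Set.mem_Iic] at hn
  omega

lemma IsFinProj.isPure_of_plus_eq_top [R.Admissible] (hM : M.IsFinProj Set.univ)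
    (h : ∀ n ≠ 0, M.plus n = ⊤) : M.IsPure := by
  obtain ⟨c, hc⟩ := hM.exists_subsingleton
  have key (m : ℕ) : ∀ n < c + m, ∀ y : M.X n, ofElem n y ∈ finiteRank {0} (free R) M n := by
    induction m with
    | zero =>
      intro n hn y
      have := hc n (by simpa using hn)
      rw [Subsingleton.elim y 0, map_zero]
      exact zero_mem _
    | succ m ih =>
      intro n hn y
      by_cases hn0 : n = 0
      · exact ofElem_mem_finiteRank y hn0
      · exact ofElem_mem_finiteRank_of_mem_plus (h n hn0 ▸ AddSubgroup.mem_top y)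
          fun l hl z => ih l (by push_cast at hn; omega) z
  have gen (n : ℤ) (y : M.X n) : ofElem n y ∈ finiteRank {0} (free R) M n :=
    key (n + 1 - c).toNat n (by omega) y
  have all (e : GradedHom M M 0) (he : e ∈ finiteRank Set.univ M M 0) :
      e ∈ finiteRank {0} M M 0 := by
    induction he using finiteRank_induction with
    | zero => exact zero_mem _
    | add e e' _ _ he he' => exact add_mem he he'
    | comp n _ q h a y => exact comp_mem_finiteRank a (gen n y) h
  exact all _ hM

end Plus

section MinimalModel

lemma GradedHom.δ_f_neg_one (s : GradedHom M N (-1)) {h i j : ℤ} (hi : h + 1 = i) (hj : i + 1 = j)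
    (x : M.X i) : (δ (neg_add_cancel 1) s).f (add_zero i) x =
      N.d hi (s.f (by omega) x) + s.f (by omega) (M.d hj x) := by
  rw [δ_f _ s (add_zero i) (by omega : i + -1 = h) hi hj (by omega), Int.negOnePow_neg,
    Int.negOnePow_one, Units.neg_smul, one_smul, sub_neg_eq_add]

lemma sub_f (f g : M ⟶ N) (i : ℤ) (x : M.X i) : (f - g).f i x = f.f i x - g.f i x :=
  (sub_eq_add_neg _ _).symm

lemma exists_sub_eq_d_add_d {f g : M ⟶ N} (h : (ofHom f - ofHom g).IsExact) :
    ∃ s : GradedHom M N (-1), ∀ {h i j : ℤ} (hi : h + 1 = i) (hj : i + 1 = j) (x : M.X i),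
      f.f i x - g.f i x = N.d hi (s.f (by omega) x) + s.f (by omega) (M.d hj x) := by
  obtain ⟨s, hs⟩ := h.exists_δ_eq (neg_add_cancel 1)
  refine ⟨s, fun {h i j} hi hj x => ?_⟩
  rw [← δ_f_neg_one, hs, GradedHom.sub_f, ofHom_f_self, ofHom_f_self]

variable [R.Admissible]

/-- The projection of `M` onto `M / M A⁺`. -/
def toBar (M : DGMod R) : M ⟶ M.bar where
  f i := QuotientAddGroup.mk' (M.plus i)
  map_act _ _ _ := rfl
  map_d _ _ := rfl

lemma toBar_surjective (M : DGMod R) (i : ℤ) : Function.Surjective (M.toBar.f i) :=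
  QuotientAddGroup.mk'_surjective _

lemma toBar_eq_zero_iff {i : ℤ} {x : M.X i} : M.toBar.f i x = 0 ↔ x ∈ M.plus i :=
  QuotientAddGroup.eq_zero_iff x

lemma bar_act_of_pos {i j n : ℤ} (h : i + j = n) (hj : 0 < j) (x : M.bar.X i) (a : R.gr j) :
    M.bar.act h x a = 0 := by
  obtain ⟨x, rfl⟩ := M.toBar_surjective i x
  rw [← M.toBar.map_act]
  exact toBar_eq_zero_iff.2 (AddSubgroup.subset_closure ⟨i, j, h, hj, x, a, rfl⟩)

lemma exists_bar_splitting (M : DGMod R) : ∃ G : GradedHom M.bar M.bar (-1),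
    ∀ {i j : ℤ} (h : i + 1 = j) (x : M.bar.X i),
      M.bar.d h (G.f (by omega) (M.bar.d h x)) = M.bar.d h x := by
  choose G hG using fun (i j : ℤ) (h : i + 1 = j) =>
    exists_linearMap_comp_comp_eq (M.bar.dLinearMap h)
  refine ⟨⟨fun {i j} h => (G j i (by omega)).toAddMonoidHom, ?_⟩,
    fun {i j} h x => LinearMap.congr_fun (hG i j h) x⟩
  intro i j n i' n' h hn hi h' x a
  rcases lt_trichotomy j 0 with hj | rfl | hj
  · rw [eq_zero_of_neg hj a, map_zero, map_zero, map_zero]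
  · obtain rfl : i = n := by omega
    obtain rfl : i' = n' := by omega
    exact map_smul (G i' i (by omega)) (MulOpposite.op a) x
  · rw [bar_act_of_pos h hj, bar_act_of_pos h' hj, map_zero]

lemma IsFinProj.exists_d_mem_plus (hN : N.IsFinProj Set.univ) : ∃ e : N ⟶ N,
    (ofHom e - ofHom (𝟙 N)).IsExact ∧
      ∀ {i j : ℤ} (h : i + 1 = j) (x : N.X i), N.d h (e.f i x) ∈ N.plus j := by
  obtain ⟨G, hG⟩ := N.exists_bar_splitting
  obtain ⟨s, hs⟩ := hN.exists_comp_eq N.toBar_surjective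
    ((ofHom N.toBar).comp G (zero_add (-1)))
  have hsG {i j : ℤ} (h : i + -1 = j) (x : N.X i) :
      N.toBar.f j (s.f h x) = G.f h (N.toBar.f i x) := by
    have := congrArg (fun u => u.f h x) hs
    simp only [GradedHom.comp_f _ _ (add_zero (-1)) h h (add_zero j),
      GradedHom.comp_f _ _ (zero_add (-1)) h (add_zero i) h, ofHom_f_self] at this
    exact this
  have hclosed : (ofHom (𝟙 N) - δ (neg_add_cancel 1) s).IsClosed :=
    (isClosed_ofHom _).sub (isExact_δ _ s).isClosed
  refine ⟨toHom _ (hclosed.δ_eq_zero _), ?_, fun {i j} h x => ?_⟩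
  · rw [ofHom_toHom, sub_sub_cancel_left]
    exact (isExact_δ _ s).neg
  · have he : (toHom _ (hclosed.δ_eq_zero _)).f i x =
        x - (N.d (sub_add_cancel i 1) (s.f (by omega) x) + s.f (by omega) (N.d h x)) := by
      rw [← δ_f_neg_one]
      exact GradedHom.sub_f (ofHom (𝟙 N)) _ (add_zero i) x
    rw [he, ← toBar_eq_zero_iff, map_sub, map_add, N.d_d, zero_add, map_sub, N.toBar.map_d,
      N.toBar.map_d, hsG, N.toBar.map_d, hG, sub_self]

lemma exists_sub_d_mem_plus {i : ℤ} (hM : Subsingleton (M.bar.cohomology i)) {h j : ℤ}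
    (hi : h + 1 = i) (hj : i + 1 = j) {x : M.X i} (hx : M.d hj x ∈ M.plus j) :
    ∃ w : M.X h, x - M.d hi w ∈ M.plus i := by
  obtain rfl : h = i - 1 := by omega
  obtain rfl := hj
  have hz : M.toBar.f i x ∈ (M.bar.d rfl).ker := by
    rw [AddMonoidHom.mem_ker, ← M.toBar.map_d]
    exact toBar_eq_zero_iff.2 hx
  have hb := (QuotientAddGroup.eq_zero_iff _).1
    (Subsingleton.elim (QuotientAddGroup.mk ⟨_, hz⟩ : M.bar.cohomology i) 0)
  obtain ⟨y, hy⟩ := hb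
  obtain ⟨w, rfl⟩ := M.toBar_surjective _ y
  refine ⟨w, toBar_eq_zero_iff.1 ?_⟩
  rw [map_sub, M.toBar.map_d, sub_eq_zero]
  exact hy.symm

instance : (toHot R).Additive :=
  CategoryTheory.Quotient.functor_additive _ fun _ _ f g f' g' h h' => homotopic_add f g f' g' h h'

/-- The ring homomorphism from the endomorphisms of `N` to their homotopy classes. -/
def hotEnd (N : DGMod R) : End N →+* End ((toHot R).obj N) where
  toFun f := (toHot R).map f
  map_one' := (toHot R).map_id N
  map_mul' f g := (toHot R).map_comp g f
  map_zero' := (toHot R).map_zero _ _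
  map_add' _ _ := (toHot R).map_add

lemma IsFinProj.isNilpotent_of_toHot_map_eq_zero (hN : N.IsFinProj Set.univ) {e : End N}
    (he : N.hotEnd e = 0)
    (hd : ∀ {i j : ℤ} (h : i + 1 = j) (x : N.X i), N.d h (e.f i x) ∈ N.plus j) :
    IsNilpotent e := by
  obtain ⟨s, hs⟩ := exists_sub_eq_d_add_d ((toHot_map_eq_iff_isExact e 0).1
    (he.trans ((toHot R).map_zero _ _).symm))
  have hcube : IsNilpotent (e ^ 3) := hN.isNilpotent fun i x => by
    have hsx := hs (sub_add_cancel i 1) rfl (e.f i x)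
    rw [zero_f, sub_zero] at hsx
    rw [pow_succ, pow_two]
    change e.f i (e.f i (e.f i x)) ∈ N.plus i
    rw [hsx, map_add, e.map_d]
    exact add_mem (hd _ _) (map_mem_plus e (s.map_mem_plus _ (hd _ _)))
  exact (IsNilpotent.pow_iff_pos three_ne_zero).1 hcube

lemma IsFinProj.exists_isNilpotent_sub_sq (hN : N.IsFinProj Set.univ)
    (hM : ∀ i ≠ 0, Subsingleton (M.bar.cohomology i)) {a : M ⟶ N} {b : N ⟶ M}
    (hab : (toHot R).map a ≫ (toHot R).map b = 𝟙 _) :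
    ∃ e : End N, N.hotEnd e = (toHot R).map b ≫ (toHot R).map a ∧ IsIdempotentElem (N.hotEnd e) ∧
      IsNilpotent (e - e ^ 2) ∧ ∀ i ≠ 0, ∀ x, e.f i x ∈ N.plus i := by
  obtain ⟨c, hc, hcd⟩ := hN.exists_d_mem_plus
  rw [← toHot_map_eq_iff_isExact, CategoryTheory.Functor.map_id] at hc
  let e : End N := c ≫ (b ≫ a) ≫ c
  have he : N.hotEnd e = (toHot R).map b ≫ (toHot R).map a := by
    change (toHot R).map (c ≫ (b ≫ a) ≫ c) = _
    simp only [Functor.map_comp, hc, Category.id_comp, Category.comp_id]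
  have hidem : IsIdempotentElem (N.hotEnd e) := by
    rw [he]
    change ((toHot R).map b ≫ (toHot R).map a) ≫ (toHot R).map b ≫ (toHot R).map a = _
    rw [Category.assoc, reassoc_of% hab]
  refine ⟨e, he, hidem, hN.isNilpotent_of_toHot_map_eq_zero ?_ fun h x => ?_, fun i hi x => ?_⟩
  · rw [map_sub, map_pow, hidem.pow_eq two_ne_zero, sub_self]
  · have hsub : (e - e ^ 2).f _ x = e.f _ x - e.f _ (e.f _ x) := by
      rw [pow_two]
      exact sub_f e (e * e) _ x
    rw [hsub, map_sub]
    exact sub_mem (hcd h _) (hcd h _)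
  · obtain ⟨w, hw⟩ := exists_sub_d_mem_plus (hM i hi) (sub_add_cancel i 1) rfl
      (x := b.f i (c.f i x)) (by rw [← b.map_d]; exact map_mem_plus b (hcd _ _))
    have hew := map_mem_plus (a ≫ c) hw
    rw [map_sub, (a ≫ c).map_d] at hew
    have hsum := add_mem hew (hcd (sub_add_cancel i 1) (a.f _ w))
    rw [comp_f, comp_f, sub_add_cancel] at hsum
    exact hsum

/-- The idempotent endomorphism of `N` defined by a retract can be lifted to an idempotent
endomorphism of the dg module, which splits off the pure model. -/
lemma IsPerfect.exists_isPure_iso {X : Hot R} (hX : IsPerfect R X)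
    (hbar : ∀ i ≠ 0, Subsingleton (X.as.bar.cohomology i)) :
    ∃ M : DGMod R, M.IsPure ∧ Nonempty (X ≅ (toHot R).obj M) := by
  obtain ⟨N, hN, ⟨r⟩⟩ := hX.exists_retract
  obtain ⟨a, ha⟩ := (toHot R).map_surjective (X := X.as) r.i
  obtain ⟨b, hb⟩ := (toHot R).map_surjective (Y := X.as) r.r
  have hab : (toHot R).map a ≫ (toHot R).map b = 𝟙 X := by rw [ha, hb, r.retract]
  obtain ⟨e, he, hidem, hnil, heplus⟩ := hN.exists_isNilpotent_sub_sq hbar hab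
  obtain ⟨t, ht, hte⟩ := exists_isIdempotentElem_mul N.hotEnd hnil hidem
  obtain ⟨M, i, p, hip, hpi⟩ := IsIdempotentComplete.idempotents_split N (e * t) ht
  have hM : M.IsFinProj Set.univ := hN.of_comp_eq_id (ofHom i) (ofHom p) (add_zero 0)
    (by rw [ofHom_comp_ofHom, hip]) fun _ _ => Set.mem_univ _
  have hpiE : (toHot R).map p ≫ (toHot R).map i = (toHot R).map b ≫ (toHot R).map a := by
    rw [← Functor.map_comp, hpi, ← he]
    exact hte
  refine ⟨M, hM.isPure_of_plus_eq_top fun n hn => ?_, ⟨(toHot R).map a ≫ (toHot R).map p,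
    (toHot R).map i ≫ (toHot R).map b, ?_, ?_⟩⟩
  · refine (AddSubgroup.eq_top_iff' _).2 fun x => ?_
    have hpx : p.f n (i.f n x) = x := congrArg (fun g : M ⟶ M => g.f n x) hip
    have hix : i.f n x = e.f n (t.f n (i.f n x)) := by
      refine Eq.trans ?_ (congrArg (fun g : N ⟶ N => g.f n (i.f n x)) hpi)
      rw [comp_f, hpx]
    rw [← hpx, hix]
    exact map_mem_plus p (heplus n hn _)
  · rw [Category.assoc, reassoc_of% hpiE, hab]
    exact (Category.comp_id _).trans hab
  · rw [Category.assoc, ← Category.assoc ((toHot R).map b), ← hpiE, Category.assoc,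
      ← Category.assoc ((toHot R).map i), ← Functor.map_comp, hip, CategoryTheory.Functor.map_id,
      Category.id_comp]

end MinimalModel

section

variable {ι : K ⟶ M} {π : M ⟶ Q} {p : ℤ}

lemma eq_of_comp_ofHom_eq (hι : ∀ i, Function.Injective (ι.f i)) {u v : GradedHom P K p}
    (huv : u.comp (ofHom ι) (add_zero p) = v.comp (ofHom ι) (add_zero p)) : u = v := by
  ext i j hij x
  have := congrArg (fun w => GradedHom.f w hij x) huv
  simp only [GradedHom.comp_f _ _ _ hij hij (add_zero j), ofHom_f_self] at this
  exact hι j this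

lemma eq_of_ofHom_comp_eq (hπ : ∀ i, Function.Surjective (π.f i)) {u v : GradedHom Q P p}
    (huv : (ofHom π).comp u (zero_add p) = (ofHom π).comp v (zero_add p)) : u = v := by
  ext i j hij x
  obtain ⟨x, rfl⟩ := hπ i x
  have := congrArg (fun w => GradedHom.f w hij x) huv
  simpa only [GradedHom.comp_f _ _ _ hij (add_zero i) hij, ofHom_f_self] using this

lemma exists_comp_ofHom_eq (hι : ∀ i, Function.Injective (ι.f i))
    (hex : ∀ i, Function.Exact (ι.f i) (π.f i)) (w : GradedHom P M p)
    (hw : w.comp (ofHom π) (add_zero p) = 0) :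
    ∃ v : GradedHom P K p, v.comp (ofHom ι) (add_zero p) = w := by
  have key (i j : ℤ) (hij : i + p = j) (x : P.X i) : ∃ y, ι.f j y = w.f hij x := by
    refine (hex j _).1 ?_
    have := congrArg (fun w => GradedHom.f w hij x) hw
    simpa only [GradedHom.comp_f _ _ _ hij hij (add_zero j), ofHom_f_self, GradedHom.zero_f]
      using this
  choose v hv using key
  refine ⟨{ f {i j} hij := AddMonoidHom.mk' (v i j hij) fun x y => hι j (by simp [hv])
            map_act {i j n i' n'} hij hn hi h' x a := hι n' ?_ }, ?_⟩
  · exact (hv _ _ _ _).trans ((w.map_act hij hn hi h' x a).trans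
      ((congrArg (fun y => M.act h' y a) (hv _ _ _ _).symm).trans (ι.map_act h' _ a).symm))
  · ext i j hij x
    rw [GradedHom.comp_f _ _ _ hij hij (add_zero j), ofHom_f_self]
    exact hv i j hij x

lemma exists_ofHom_comp_eq (hex : ∀ i, Function.Exact (ι.f i) (π.f i))
    (hπ : ∀ i, Function.Surjective (π.f i)) (w : GradedHom M P p)
    (hw : (ofHom ι).comp w (zero_add p) = 0) :
    ∃ v : GradedHom Q P p, (ofHom π).comp v (zero_add p) = w := by
  have key (i j : ℤ) (hij : i + p = j) : (π.f i).ker ≤ (w.f hij).ker := fun x hx => by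
    obtain ⟨y, rfl⟩ := (hex i x).1 hx
    have := congrArg (fun w => GradedHom.f w hij y) hw
    rwa [GradedHom.comp_f _ _ _ hij (add_zero i) hij, ofHom_f_self] at this
  let v (i j : ℤ) (hij : i + p = j) : Q.X i →+ P.X j :=
    (π.f i).liftOfSurjective (hπ i) ⟨w.f hij, key i j hij⟩
  have hv (i j : ℤ) (hij : i + p = j) (x : M.X i) : v i j hij (π.f i x) = w.f hij x :=
    AddMonoidHom.liftOfRightInverse_comp_apply _ _ _ _ _
  refine ⟨{ f {i j} hij := v i j hij
            map_act {i j n i' n'} hij hn hi h' x a := ?_ }, ?_⟩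
  · obtain ⟨x, rfl⟩ := hπ i x
    rw [← π.map_act hij, hv, hv, w.map_act hij hn hi h']
  · ext i j hij x
    rw [GradedHom.comp_f _ _ _ hij (add_zero i) hij, ofHom_f_self]
    exact hv i j hij x

end

/-- Short exact sequences of dg modules, expressed degreewise. -/
structure IsShortExact (ι : K ⟶ M) (π : M ⟶ Q) : Prop where
  injective (i : ℤ) : Function.Injective (ι.f i)
  exact (i : ℤ) : Function.Exact (ι.f i) (π.f i)
  surjective (i : ℤ) : Function.Surjective (π.f i)

/-- A splitting of a short exact sequence of dg modules which ignores the differentials. The map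
`connecting` measures its failure to be compatible with them. -/
structure GradedSplitting (ι : K ⟶ M) (π : M ⟶ Q) where
  retraction : GradedHom M K 0
  sec : GradedHom Q M 0
  connecting : GradedHom Q K 1
  comp_retraction : (ofHom ι).comp retraction (add_zero 0) = GradedHom.id K
  sec_comp : sec.comp (ofHom π) (add_zero 0) = GradedHom.id Q
  add_eq_id : retraction.comp (ofHom ι) (add_zero 0) + (ofHom π).comp sec (add_zero 0) =
    GradedHom.id M
  δ_retraction : δ (zero_add 1) retraction = (ofHom π).comp connecting (zero_add 1)

section

variable {ι : K ⟶ M} {π : M ⟶ Q} (h : IsShortExact ι π)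

section

include h

lemma IsShortExact.comp_eq_zero : (ofHom ι).comp (ofHom π) (add_zero 0) = 0 := by
  rw [ofHom_comp_ofHom, (comp_eq_zero_iff ι).2 fun i => (h.exact i).apply_apply_eq_zero, map_zero]

lemma IsShortExact.nonempty_gradedSplitting (r : GradedHom M K 0)
    (hr : (ofHom ι).comp r (add_zero 0) = GradedHom.id K) : Nonempty (GradedSplitting ι π) := by
  obtain ⟨s, hs⟩ := exists_ofHom_comp_eq h.exact h.surjective
      (GradedHom.id M - r.comp (ofHom ι) (add_zero 0)) <| by
    rw [comp_sub, ← comp_assoc _ _ _ (add_zero 0) (add_zero 0), hr, comp_id, id_comp, sub_self]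
  have hsπ : s.comp (ofHom π) (add_zero 0) = GradedHom.id Q :=
    eq_of_ofHom_comp_eq h.surjective <| by
    rw [← comp_assoc _ _ _ (add_zero 0) (add_zero 0), hs, sub_comp,
      comp_assoc _ _ _ _ _ (add_zero 0) (add_zero 0), h.comp_eq_zero, comp_zero, sub_zero, id_comp,
      comp_id]
  obtain ⟨γ, hγ⟩ := exists_ofHom_comp_eq h.exact h.surjective (δ (zero_add 1) r) <| by
    rw [← δ_ofHom_comp, hr, δ_ofHom]
  exact ⟨⟨r, s, γ, hr, hsπ, by rw [hs, add_sub_cancel], hγ.symm⟩⟩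

lemma IsShortExact.nonempty_gradedSplitting_of_isFinProj {S : Set ℤ} (hQ : Q.IsFinProj S) :
    Nonempty (GradedSplitting ι π) := by
  obtain ⟨s, hs⟩ := hQ.exists_comp_eq h.surjective (GradedHom.id Q)
  obtain ⟨r, hr⟩ := exists_comp_ofHom_eq h.injective h.exact
      (GradedHom.id M - (ofHom π).comp s (add_zero 0)) <| by
    rw [sub_comp, comp_assoc _ _ _ _ _ (add_zero 0) (add_zero 0), hs, id_comp, comp_id, sub_self]
  refine h.nonempty_gradedSplitting r (eq_of_comp_ofHom_eq h.injective ?_)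
  rw [comp_assoc _ _ _ _ _ (add_zero 0) (add_zero 0), hr, comp_sub, comp_id,
    ← comp_assoc _ _ _ (add_zero 0) (add_zero 0), h.comp_eq_zero, zero_comp, sub_zero, id_comp]

end

namespace GradedSplitting

variable (σ : GradedSplitting ι π)

include σ

lemma isFinProj_left {S : Set ℤ} (hM : M.IsFinProj S) : K.IsFinProj S :=
  hM.of_comp_eq_id _ _ _ σ.comp_retraction fun n hn => by rwa [add_zero]

lemma isFinProj_right {S : Set ℤ} (hM : M.IsFinProj S) : Q.IsFinProj S :=
  hM.of_comp_eq_id _ _ _ σ.sec_comp fun n hn => by rwa [add_zero]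

lemma isFinProj_middle {S : Set ℤ} (hK : K.IsFinProj S) (hQ : Q.IsFinProj S) : M.IsFinProj S := by
  rw [IsFinProj, ← σ.add_eq_id]
  exact add_mem (comp_mem_finiteRank _ (hK.mem_finiteRank _ fun n hn => by rwa [add_zero]) _)
    (comp_mem_finiteRank _ (hQ.mem_finiteRank _ fun n hn => by rwa [add_zero]) _)

include h

lemma isClosed_connecting : σ.connecting.IsClosed := by
  refine isClosed_of_δ_eq_zero rfl (eq_of_ofHom_comp_eq h.surjective ?_)
  rw [← δ_ofHom_comp, ← σ.δ_retraction, δ_δ, comp_zero]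

lemma δ_sec : δ (zero_add 1) σ.sec = -σ.connecting.comp (ofHom ι) (add_zero 1) := by
  refine eq_of_ofHom_comp_eq h.surjective ?_
  have hδ := congrArg (δ (zero_add 1)) σ.add_eq_id
  rw [map_add, δ_ofHom, δ_comp_ofHom, δ_ofHom_comp, σ.δ_retraction] at hδ
  rw [comp_neg, ← comp_assoc _ _ _ (zero_add 1) (add_zero 1) (add_zero 1)]
  exact eq_neg_of_add_eq_zero_right hδ

lemma exists_comp_eq (g : K ⟶ J) (hg : (σ.connecting.comp (ofHom g) (add_zero 1)).IsExact) :
    ∃ g' : M ⟶ J, ι ≫ g' = g := by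
  obtain ⟨t, ht⟩ := hg.exists_δ_eq (zero_add 1)
  let v := σ.retraction.comp (ofHom g) (add_zero 0) - (ofHom π).comp t (zero_add 0)
  have hv : δ (zero_add 1) v = 0 := by
    rw [map_sub, δ_comp_ofHom, δ_ofHom_comp, σ.δ_retraction, ht,
      comp_assoc _ _ _ (zero_add 1) (add_zero 1) (add_zero 1) (zero_add 1),
      sub_self]
  refine ⟨toHom v hv, ofHom_injective ?_⟩
  rw [← ofHom_comp_ofHom, ofHom_toHom, comp_sub,
    ← comp_assoc _ _ _ (add_zero 0) (add_zero 0) (add_zero 0), σ.comp_retraction, id_comp,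
    ← comp_assoc _ _ _ (add_zero 0) (zero_add 0) (zero_add 0), h.comp_eq_zero, zero_comp, sub_zero]

lemma isPerfect_left (hM : IsPerfect R ((toHot R).obj M)) (hQ : IsPerfect R ((toHot R).obj Q)) :
    IsPerfect R ((toHot R).obj K) := by
  refine (IsPerfect.cone π hM hQ).of_comp_eq_id (u := (ofHom ι).comp (coneInr π) (zero_add (-1)))
    (v := coneDesc (add_zero 1) (-σ.connecting) σ.retraction) ?_ ?_ (neg_add_cancel 1) ?_
  · refine isClosed_of_δ_eq_zero (neg_add_cancel 1) ?_
    rw [δ_ofHom_comp, δ_coneInr, ← comp_assoc _ _ _ (add_zero 0) (add_zero 0), h.comp_eq_zero,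
      zero_comp]
  · rw [GradedHom.IsClosed, δ_coneDesc _ _ _ _ (zero_add 1) rfl, map_neg, σ.isClosed_connecting h,
      σ.δ_retraction]
    simp [coneDesc]
  · rw [comp_assoc _ _ _ _ _ (neg_add_cancel 1) (add_zero 0), coneInr_comp_coneDesc,
      σ.comp_retraction]

lemma isPerfect_middle (hK : IsPerfect R ((toHot R).obj K)) (hQ : IsPerfect R ((toHot R).obj Q)) :
    IsPerfect R ((toHot R).obj M) := by
  let θ : GradedHom (Q.shift (-1)) Q (-1) := shiftHom (-1) Q
  let τ : GradedHom Q (Q.shift (-1)) 1 := shiftInv (-1) Q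
  have hθ : θ.IsClosed := isClosed_shiftHom (-1) Q
  have hτ : τ.IsClosed := isClosed_shiftInv (-1) Q
  have hτθ : τ.comp θ (add_neg_cancel 1) = GradedHom.id Q := shiftInv_comp_shiftHom (-1) Q
  let φ := (θ.comp σ.connecting (neg_add_cancel 1)).toHom
    ((hθ.comp (σ.isClosed_connecting h) (neg_add_cancel 1)).δ_eq_zero _)
  have hφ : ofHom φ = θ.comp σ.connecting (neg_add_cancel 1) := ofHom_toHom _ _
  refine (IsPerfect.cone φ (.shift (-1) Q hQ) hK).of_comp_eq_id
    (u := σ.retraction.comp (ofHom (coneInl φ)) (add_zero 0) -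
      (ofHom π).comp (τ.comp (coneInr φ) (add_neg_cancel 1)) (zero_add 0))
    (v := coneDesc (add_neg_cancel 1) (ofHom ι) (-θ.comp σ.sec (add_zero (-1)))) ?_ ?_
    (add_zero 0) ?_
  · refine isClosed_of_δ_eq_zero (zero_add 1) ?_
    rw [map_sub, δ_comp_ofHom, δ_ofHom_comp, σ.δ_retraction,
      δ_comp_of_isClosed_left hτ _ _ _ (neg_add_cancel 1) (add_zero 1), δ_coneInr, hφ,
      ← comp_assoc τ _ _ (add_zero 1) (add_zero 1), ← comp_assoc τ _ _ (add_neg_cancel 1)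
      (zero_add 1), hτθ, id_comp, comp_assoc _ _ _ _ _ (add_zero 1) (zero_add 1), sub_self]
  · refine isClosed_coneDesc (isClosed_ofHom ι) ?_
    rw [map_neg, δ_comp_of_isClosed_left hθ _ _ _ (zero_add 1) (neg_add_cancel 1), σ.δ_sec h, hφ,
      comp_neg, neg_neg, comp_assoc _ _ _ _ _ (add_zero 1) (neg_add_cancel 1)]
  · rw [sub_comp, comp_assoc _ _ _ _ _ (add_zero 0) (add_zero 0), coneInl_comp_coneDesc,
      comp_assoc _ _ _ _ _ (add_zero 0) (zero_add 0),
      comp_assoc τ _ _ _ _ (add_zero (-1)) (add_neg_cancel 1), coneInr_comp_coneDesc, comp_neg,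
      ← comp_assoc τ _ _ (add_neg_cancel 1) (zero_add 0), hτθ, id_comp, comp_neg, sub_neg_eq_add,
      σ.add_eq_id]

end GradedSplitting

end

section Hat

variable [R.Admissible] {L : Type u} [AddCommGroup L] [Module (R.gr 0)ᵐᵒᵖ L]

variable (R L) in
/-- The map `l ↦ l ⊗ 1` from `L` to the degree zero part of `L̂`. -/
def toHat : L →ₗ[(R.gr 0)ᵐᵒᵖ] (hat R L).X 0 where
  toFun l := ten 0 l (1 : R.gr 0)
  map_add' l l' := by rw [map_add]; rfl
  map_smul' a l := by
    obtain ⟨a, rfl⟩ := MulOpposite.op_surjective a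
    have h : R.mul (zero_add 0) a (1 : R.gr 0) = R.mul (zero_add 0) (1 : R.gr 0) a := by
      ext; simp
    rw [ten_smul, h]
    rfl

lemma toHat_surjective : Function.Surjective (toHat R L) := by
  rw [← LinearMap.range_eq_top, Submodule.eq_top_iff']
  intro (t : Ten R L 0)
  induction t using ten_induction with
  | h l b =>
    refine ⟨MulOpposite.op b • l, (ten_smul l b (1 : R.gr 0)).trans (congrArg (ten 0 l) ?_)⟩
    ext; simp
  | h0 => exact Submodule.zero_mem _
  | hadd x y hx hy => exact Submodule.add_mem _ hx hy

lemma toHat_injective : Function.Injective (toHat R L) := by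
  let φ : Ten R L 0 →+ L := tenLift
    (AddMonoidHom.mk' (fun l => AddMonoidHom.mk' (fun a => MulOpposite.op a • l)
      (fun a b => by simp [add_smul])) (fun l l' => by ext; simp))
    (fun l a b => by
      simp only [AddMonoidHom.mk'_apply, smul_smul]
      congr 1)
  exact Function.LeftInverse.injective (g := φ) fun l => one_smul (R.gr 0)ᵐᵒᵖ l

instance [Nontrivial L] : Nontrivial ((hat R L).X 0) := toHat_injective.nontrivial

lemma exists_hom_hat (θ : L →ₗ[(R.gr 0)ᵐᵒᵖ] M.X 0) (hθ : ∀ l, M.d (zero_add 1) (θ l) = 0) :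
    ∃ f : hat R L ⟶ M, ∀ l : L, f.f 0 (toHat R L l) = θ l := by
  let φ (i : ℤ) : Ten R L i →+ M.X i := tenLift
    (AddMonoidHom.mk' (fun l => M.act (zero_add i) (θ l)) (fun l l' => by simp))
    (fun l a b => by
      simp only [AddMonoidHom.mk'_apply, map_smul]
      exact M.act_act _ _ _ _ _ _ _)
  have hφ : ∀ i l b, φ i (ten i l b) = M.act (zero_add i) (θ l) b := fun _ _ _ => rfl
  refine ⟨⟨φ, fun {i j n} h x a => ?_, fun {i j} h x => ?_⟩, fun l => M.act_one _⟩
  · refine ten_hom_ext (f := (φ n).comp (((hat R L).act h).flip a))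
      (g := ((M.act h).flip a).comp (φ i)) (fun l b => ?_) x
    refine (hφ n l (R.mul h b a)).trans (Eq.trans ?_ (congrArg (fun y => M.act h y a)
      (hφ i l b)).symm)
    exact (M.act_act _ _ _ _ _ _ _).symm
  · refine ten_hom_ext (f := (φ j).comp ((hat R L).d h)) (g := (M.d h).comp (φ i))
      (fun l b => ?_) x
    refine (hφ j l (R.d h b)).trans (Eq.trans ?_ (congrArg (M.d h) (hφ i l b)).symm)
    rw [M.d_act _ h (zero_add 1) h (by omega) (zero_add j), hθ, map_zero]
    simp

variable [IsSimpleModule (R.gr 0)ᵐᵒᵖ L]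

lemma isPure_hat : IsPure (hat R L) := by
  obtain ⟨r⟩ := exists_retract_hat (R := R) L
  refine isFinProj_free.of_comp_eq_id (ofHom r.i) (ofHom r.r) (add_zero 0) ?_ fun n hn => by
    rwa [add_zero]
  rw [ofHom_comp_ofHom, r.retract]

lemma isPerfect_hat : IsPerfect R ((toHot R).obj (hat R L)) :=
  (isHeart_hat L).1

end Hat

namespace DGSubmodule

/-- The largest sub dg module on which a given additive map in degree `n` vanishes. -/
def core {V : Type*} [AddCommGroup V] {n : ℤ} (r : M.X n →+ V) : DGSubmodule M where
  carrier i :=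
    { carrier := {x | (∀ j (h : i + j = n) a, r (M.act h x a) = 0) ∧
        ∀ j m (h : i + j = m) (h' : m + 1 = n) a, r (M.d h' (M.act h x a)) = 0}
      zero_mem' := by simp
      add_mem' hx hy := by
        refine ⟨fun j h a => ?_, fun j m h h' a => ?_⟩
        · rw [map_add, AddMonoidHom.add_apply, map_add, hx.1, hy.1, add_zero]
        · rw [map_add, AddMonoidHom.add_apply, map_add, map_add, hx.2, hy.2, add_zero]
      neg_mem' hx := by
        refine ⟨fun j h a => ?_, fun j m h h' a => ?_⟩
        · rw [map_neg, AddMonoidHom.neg_apply, map_neg, hx.1, neg_zero]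
        · rw [map_neg, AddMonoidHom.neg_apply, map_neg, map_neg, hx.2, neg_zero] }
  act_mem h x hx a :=
    ⟨fun j h' b => by rw [M.act_act h h' rfl (by omega)]; exact hx.1 _ _ _,
      fun j m h' h'' b => by rw [M.act_act h h' rfl (by omega)]; exact hx.2 _ _ _ _ _⟩
  d_mem {i i'} h {x} hx := by
    have hd {j m m' : ℤ} (hm : i' + j = m) (hm' : i + j = m') (hj : m' + 1 = m) (a : R.gr j) :
        M.act hm (M.d h x) a =
          M.d hj (M.act hm' x a) - i.negOnePow • M.act (by omega) x (R.d rfl a) := by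
      rw [M.d_act hm' hj h rfl hm (by omega), add_sub_cancel_right]
    refine ⟨fun j hj a => ?_, fun j m hm hm' a => ?_⟩
    · rw [hd hj rfl (by omega), map_sub, hx.2, Units.smul_def, map_zsmul, hx.1, smul_zero,
        sub_zero]
    · rw [hd hm rfl (by omega), map_sub, M.d_d, d_zsmul_unit, map_sub, map_zero, zero_sub,
        Units.smul_def, map_zsmul, hx.2, smul_zero, neg_zero]

end DGSubmodule

lemma injective_of_ofHom_comp_eq_id {f : M ⟶ N} {v : GradedHom N M 0}
    (h : (ofHom f).comp v (add_zero 0) = GradedHom.id M) (i : ℤ) :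
    Function.Injective (f.f i) := by
  refine Function.LeftInverse.injective (g := v.f (add_zero i)) fun x => ?_
  have := congrArg (fun w => GradedHom.f w (add_zero i) x) h
  rwa [GradedHom.comp_f _ _ _ (add_zero i) (add_zero i) (add_zero i), ofHom_f_self,
    ofHom_f_self, id_f] at this

section PureQuotient

variable [R.Admissible]

lemma isAcyclic_quot_core (hN : ∀ i < 0, Subsingleton (N.X i))
    (r : N.X 1 →ₗ[(R.gr 0)ᵐᵒᵖ] N.X 0) (hr : ∀ x, r (N.d (zero_add 1) x) = x) :
    (DGSubmodule.core r.toAddMonoidHom).quot.IsAcyclic := by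
  set S := DGSubmodule.core r.toAddMonoidHom
  have mem_one {x : N.X 1} (hx : r x = 0) : x ∈ S.carrier 1 := by
    refine ⟨fun j h a => ?_, fun j m h h' a => ?_⟩
    · obtain rfl : j = 0 := by omega
      exact (map_smul r (MulOpposite.op (α := R.gr 0) a) x).trans (by rw [hx, smul_zero])
    · rw [eq_zero_of_neg (by omega) a, map_zero, map_zero, map_zero]
  have mem_of_one_lt {i : ℤ} (hi : 1 < i) (x : N.X i) : x ∈ S.carrier i :=
    ⟨fun j h a => by rw [eq_zero_of_neg (by omega) a, map_zero, map_zero],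
      fun j m h h' a => by rw [eq_zero_of_neg (by omega) a, map_zero, map_zero, map_zero]⟩
  intro i j l h h' y hy
  obtain ⟨x, rfl⟩ := S.π_surjective j y
  rcases lt_or_ge j 0 with hj | hj
  · have := hN j hj
    exact ⟨0, by rw [Subsingleton.elim x 0, map_zero, map_zero]⟩
  rcases lt_or_ge 1 j with hj' | hj'
  · exact ⟨0, by rw [(S.π_f_eq_zero_iff x).2 (mem_of_one_lt hj' x), map_zero]⟩
  obtain rfl | rfl : j = 0 ∨ j = 1 := by omega
  · obtain rfl : l = 1 := by omega
    have hdx := ((S.π_f_eq_zero_iff _).1 ((S.π.map_d h' x).trans hy)).1 0 (add_zero 1) 1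
    rw [N.act_one] at hdx
    exact ⟨0, by rw [show x = 0 from (hr x).symm.trans hdx, map_zero, map_zero]⟩
  · obtain rfl : i = 0 := by omega
    refine ⟨S.π.f 0 (r x), ?_⟩
    rw [← S.π.map_d, ← sub_eq_zero, ← map_sub, S.π_f_eq_zero_iff]
    exact mem_one (by rw [map_sub, hr, sub_self])

/-- A retraction `r` of an injective differential `N⁰ → N¹` gives a map from `N` to the acyclic
complex `N⁰ = N⁰` in degrees `0` and `1`, which is null-homotopic for degree reasons. -/
lemma IsPure.subsingleton_of_d_injective (hM : M.IsPure) (hM' : M.IsHomotopyProjective)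
    {q : M ⟶ N} (hq : ∀ i, Function.Surjective (q.f i))
    (hd : Function.Injective (N.d (zero_add 1))) : Subsingleton (N.X 0) := by
  have hN (i : ℤ) (hi : i < 0) : Subsingleton (N.X i) :=
    have := hM.subsingleton_of_neg hi
    (hq i).subsingleton
  obtain ⟨r, hr⟩ := IsSemisimpleModule.extension_property (N.dLinearMap (zero_add 1)) hd
    LinearMap.id
  set S := DGSubmodule.core r.toAddMonoidHom
  obtain ⟨h, hh⟩ := (hM' (isAcyclic_quot_core hN r (LinearMap.congr_fun hr)) (ofHom (q ≫ S.π))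
    (isClosed_ofHom _)).exists_δ_eq (neg_add_cancel 1)
  have hh₀ : h = 0 := hM.hom_ext fun x =>
    have := hN (0 + -1) (by omega)
    have := (S.π_surjective (0 + -1)).subsingleton
    Subsingleton.elim (α := S.quot.X (0 + -1)) _ _
  have hqπ : q ≫ S.π = 0 := ofHom_injective <| by rw [← hh, hh₀, map_zero, map_zero]
  refine subsingleton_of_forall_eq 0 fun y => ?_
  obtain ⟨x, rfl⟩ := hq 0 y
  have := ((S.π_f_eq_zero_iff _).1 ((comp_eq_zero_iff q).1 hqπ 0 x)).2 0 0 (add_zero 0)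
    (zero_add 1) 1
  rw [N.act_one] at this
  exact (LinearMap.congr_fun hr _).symm.trans this

lemma IsPure.exists_hat_splitMono (hM : M.IsPure) (hM' : M.IsHomotopyProjective)
    (hN : N.IsPure) {q : M ⟶ N} (hq : ∀ i, Function.Surjective (q.f i)) [Nontrivial (N.X 0)] :
    ∃ L : Submodule (R.gr 0)ᵐᵒᵖ (N.X 0), IsSimpleModule (R.gr 0)ᵐᵒᵖ L ∧
      ∃ (ι : hat R L ⟶ N) (r : GradedHom N (hat R L) 0),
        (ofHom ι).comp r (add_zero 0) = GradedHom.id (hat R L) := by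
  obtain h | ⟨L, hL, hL'⟩ := IsSemisimpleModule.eq_bot_or_exists_simple_le
    (LinearMap.ker (N.dLinearMap (zero_add 1)))
  · have := hM.subsingleton_of_d_injective hM' hq (LinearMap.ker_eq_bot.1 h)
    exact (not_subsingleton (N.X 0) this).elim
  obtain ⟨t, ht⟩ := IsSemisimpleModule.extension_property (R := (R.gr 0)ᵐᵒᵖ) (N := L) (P := L)
    L.subtype L.subtype_injective LinearMap.id
  obtain ⟨ι, hι⟩ := exists_hom_hat (L := L) L.subtype fun l => hL l.2
  obtain ⟨r, hr⟩ := hN.exists_extension (toHat R L ∘ₗ t)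
  refine ⟨L, hL', ι, r, isPure_hat.hom_ext fun x => ?_⟩
  obtain ⟨l, rfl⟩ := toHat_surjective x
  rw [GradedHom.comp_f _ _ _ (add_zero 0) (add_zero 0) (add_zero 0), ofHom_f_self, hι]
  exact (hr l).trans (congrArg (toHat R L) (LinearMap.congr_fun ht l))

/-- A nonzero pure quotient `N` of a pure homotopy projective dg module contains some `L̂`, with
a pure quotient, so that statements about `N` can be shown by induction on the length of `N⁰`. -/
theorem pureQuotient_induction (hM : M.IsPure) (hM' : M.IsHomotopyProjective)
    {motive : DGMod R → Prop}
    (zero : ∀ N : DGMod R, GradedHom.id N = 0 → motive N)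
    (ext : ∀ (L : Type u) [AddCommGroup L] [Module (R.gr 0)ᵐᵒᵖ L] [IsSimpleModule (R.gr 0)ᵐᵒᵖ L]
      (N Q : DGMod R) (ι : hat R L ⟶ N) (π : N ⟶ Q) (_ : IsShortExact ι π)
      (_ : GradedSplitting ι π), motive Q → motive N)
    (hN : N.IsPure) {q : M ⟶ N} (hq : ∀ i, Function.Surjective (q.f i)) : motive N := by
  have := hN.finite
  induction hl : Module.length (R.gr 0)ᵐᵒᵖ (N.X 0) using WellFoundedLT.induction generalizing N
    with
  | _ l ih =>
    subst hl
    rcases subsingleton_or_nontrivial (N.X 0) with h | h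
    · exact zero N (hN.hom_ext fun x => Subsingleton.elim (α := N.X 0) _ _)
    obtain ⟨L, hL, ι, r, hr⟩ := hM.exists_hat_splitMono hM' hN hq
    let π := (DGSubmodule.range ι).π
    have h : IsShortExact ι π :=
      ⟨injective_of_ofHom_comp_eq_id hr, exact_range_π ι, DGSubmodule.π_surjective _⟩
    obtain ⟨σ⟩ := h.nonempty_gradedSplitting r hr
    have hQ : (DGSubmodule.range ι).quot.IsPure := σ.isFinProj_right hN
    refine ext L N _ ι π h σ (ih _ ?_ hQ (q := q ≫ π) (fun i => (h.surjective i).comp (hq i))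
      hQ.finite rfl)
    have := IsSimpleModule.nontrivial (R.gr 0)ᵐᵒᵖ L
    have := hQ.finite
    rw [Module.length_eq_add_of_exact ((ofHom ι).linearMap (add_zero 0))
      ((ofHom π).linearMap (add_zero 0)) (h.injective 0) (h.surjective 0) (h.exact 0)]
    exact lt_of_eq_of_lt (zero_add _).symm
      ((ENat.add_lt_add_iff_right Module.length_ne_top).2 Module.length_pos)

end PureQuotient

variable (R) in
/-- The pure perfect dg modules. They form an abelian category which is equivalent to the heart. -/
def purePerfect : ObjectProperty (DGMod R) := fun M => M.IsPure ∧ IsPerfect R ((toHot R).obj M)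

lemma purePerfect_of_id_eq_zero (hN : GradedHom.id N = 0) : purePerfect R N :=
  ⟨by rw [IsPure, IsFinProj, hN]; exact zero_mem _,
    IsPerfect.free.of_comp_eq_id (u := (0 : GradedHom N (free R) 0)) (v := 0) (map_zero _)
      (map_zero _) (add_zero 0) (by rw [zero_comp, hN])⟩

section

variable [R.Admissible]

lemma IsPure.isPerfect_of_surjective (hM : M.IsPure) (hM' : IsPerfect R ((toHot R).obj M))
    (hN : N.IsPure) {q : M ⟶ N} (hq : ∀ i, Function.Surjective (q.f i)) :
    IsPerfect R ((toHot R).obj N) := by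
  refine pureQuotient_induction hM hM'.isHomotopyProjective
    (motive := fun N => IsPerfect R ((toHot R).obj N)) (fun N hN => ?_) ?_ hN hq
  · exact (purePerfect_of_id_eq_zero hN).2
  · exact fun L _ _ _ N Q ι π h σ hQ => σ.isPerfect_middle h isPerfect_hat hQ

omit [R.Admissible] in
lemma exists_d_eq_of_subsingleton {n : ℤ} (h : Subsingleton (M.cohomology n)) (x : M.X n)
    (hx : M.d rfl x = 0) : ∃ y, M.d (sub_add_cancel n 1) y = x := by
  have e := Subsingleton.elim (QuotientAddGroup.mk ⟨x, hx⟩ : M.cohomology n) 0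
  rwa [QuotientAddGroup.eq_zero_iff, AddSubgroup.mem_addSubgroupOf] at e

lemma isExact_of_hat {L : Type u} [AddCommGroup L] [Module (R.gr 0)ᵐᵒᵖ L]
    [IsSimpleModule (R.gr 0)ᵐᵒᵖ L] {p : ℤ} (hJ : Subsingleton (J.cohomology p))
    {w : GradedHom (hat R L) J p} (hw : w.IsClosed) : w.IsExact := by
  obtain ⟨r⟩ := exists_retract_hat (R := R) L
  have h : ((ofHom r.r).comp w (zero_add p)).IsExact := isExact_of_free
    ((isClosed_ofHom _).comp hw _) (exists_d_eq_of_subsingleton hJ)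
  have h' := (isClosed_ofHom r.i).comp_isExact h (zero_add p)
  rwa [← comp_assoc _ _ _ (add_zero 0) (zero_add p), ofHom_comp_ofHom, r.retract, id_comp] at h'

lemma IsPure.isExact_of_subsingleton_cohomology (hM : M.IsPure) (hM' : M.IsHomotopyProjective)
    (hN : N.IsPure) {q : M ⟶ N} (hq : ∀ i, Function.Surjective (q.f i)) {p : ℤ}
    (hJ : Subsingleton (J.cohomology p)) {w : GradedHom N J p} (hw : w.IsClosed) :
    w.IsExact := by
  refine pureQuotient_induction hM hM' (motive := fun N => ∀ w : GradedHom N J p, w.IsClosed →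
    w.IsExact) (fun N hN w _ => ?_) (fun L _ _ _ N Q ι π h σ hQ w hw => ?_) hN hq w hw
  · rw [← id_comp w (zero_add p), hN, zero_comp]
    exact ⟨0, map_zero _⟩
  obtain ⟨t, ht⟩ := (isExact_of_hat hJ ((isClosed_ofHom ι).comp hw (zero_add p))).exists_δ_eq
    (sub_add_cancel p 1)
  set w' := δ (sub_add_cancel p 1) (σ.retraction.comp t (zero_add (p - 1)))
  obtain ⟨v, hv⟩ := exists_ofHom_comp_eq h.exact h.surjective (w - w') <| by
    rw [comp_sub, ← δ_ofHom_comp, ← comp_assoc _ _ _ (add_zero 0) (zero_add _),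
      σ.comp_retraction, id_comp, ht, sub_self]
  have hv' : v.IsClosed := isClosed_of_δ_eq_zero rfl <| eq_of_ofHom_comp_eq h.surjective <| by
    rw [← δ_ofHom_comp, hv, map_sub, hw.δ_eq_zero, (isExact_δ _ _).isClosed.δ_eq_zero, sub_zero,
      comp_zero]
  rw [← sub_add_cancel w w', ← hv]
  exact ((isClosed_ofHom π).comp_isExact (hQ v hv') _).add (isExact_δ _ _)

lemma IsPure.nonempty_gradedSplitting (hM : M.IsPure) (hN : N.IsPure) {e : M ⟶ J} {ι : J ⟶ N}
    {π : N ⟶ Q} (he : ∀ i, Function.Surjective (e.f i)) (h : IsShortExact ι π) :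
    Nonempty (GradedSplitting ι π) := by
  obtain ⟨v, hv⟩ := hM.exists_comp_comp_eq hN (ofHom (e ≫ ι))
  refine h.nonempty_gradedSplitting (v.comp (ofHom e) (add_zero 0)) ?_
  refine eq_of_comp_ofHom_eq h.injective (eq_of_ofHom_comp_eq he ?_)
  simpa only [← ofHom_comp_ofHom, comp_assoc _ _ _ (add_zero 0) (add_zero 0) (add_zero 0)
    (add_zero 0), id_comp] using hv

end

section

open Limits

lemma IsShortExact.purePerfect_middle {ι : K ⟶ M} {π : M ⟶ Q} (h : IsShortExact ι π)
    (hK : purePerfect R K) (hQ : purePerfect R Q) : purePerfect R M :=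
  have ⟨σ⟩ := h.nonempty_gradedSplitting_of_isFinProj hQ.1
  ⟨σ.isFinProj_middle hK.1 hQ.1, σ.isPerfect_middle h hK.2 hQ.2⟩

variable {f : M ⟶ N}

lemma isShortExact_range_ι {π : N ⟶ Q} (hex : ∀ i, Function.Exact (f.f i) (π.f i))
    (hπ : ∀ i, Function.Surjective (π.f i)) : IsShortExact (DGSubmodule.range f).ι π :=
  ⟨DGSubmodule.ι_injective _, fun i y => (hex i y).trans
    ⟨fun h => (DGSubmodule.range f).exists_ι_f_eq h,
      fun ⟨x, hx⟩ => hx ▸ (DGSubmodule.range f).ι_f_mem x⟩, hπ⟩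

lemma isShortExact_toRange {ι : K ⟶ M} (hι : ∀ i, Function.Injective (ι.f i))
    (hex : ∀ i, Function.Exact (ι.f i) (f.f i)) : IsShortExact ι (DGSubmodule.toRange f) :=
  ⟨hι, fun i x => Subtype.ext_iff.trans (hex i x), DGSubmodule.toRange_surjective f⟩

variable [R.Admissible]

lemma purePerfect_coker {π : N ⟶ Q} (hM : purePerfect R M) (hN : purePerfect R N)
    (hex : ∀ i, Function.Exact (f.f i) (π.f i)) (hπ : ∀ i, Function.Surjective (π.f i)) :
    purePerfect R Q := by
  obtain ⟨σ⟩ := hM.1.nonempty_gradedSplitting hN.1 (DGSubmodule.toRange_surjective f)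
    (isShortExact_range_ι hex hπ)
  have hQ := σ.isFinProj_right hN.1
  exact ⟨hQ, hN.1.isPerfect_of_surjective hN.2 hQ hπ⟩

variable (f) in
lemma purePerfect_range (hM : purePerfect R M) (hN : purePerfect R N) :
    purePerfect R (DGSubmodule.range f).toDGMod := by
  obtain ⟨σ⟩ := hM.1.nonempty_gradedSplitting hN.1 (DGSubmodule.toRange_surjective f)
    (isShortExact_range_ι (exact_range_π f) (DGSubmodule.π_surjective _))
  have hJ := σ.isFinProj_left hN.1
  exact ⟨hJ, hM.1.isPerfect_of_surjective hM.2 hJ (DGSubmodule.toRange_surjective f)⟩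

lemma purePerfect_ker {ι : K ⟶ M} (hM : purePerfect R M) (hN : purePerfect R N)
    (hι : ∀ i, Function.Injective (ι.f i)) (hex : ∀ i, Function.Exact (ι.f i) (f.f i)) :
    purePerfect R K := by
  have h := isShortExact_toRange hι hex
  have hJ := purePerfect_range f hM hN
  obtain ⟨σ⟩ := h.nonempty_gradedSplitting_of_isFinProj hJ.1
  exact ⟨σ.isFinProj_left hM.1, σ.isPerfect_left h hM.2 hJ.2⟩

instance : (purePerfect R).IsClosedUnderKernels where
  kernels_le := fun _ ⟨_, _, hk, hf⟩ =>
    purePerfect_ker hf.1 hf.2 (injective_of_isLimit _ hk) (exact_of_isLimit _ hk)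

instance : (purePerfect R).IsClosedUnderCokernels where
  cokernels_le := fun _ ⟨_, _, hk, hf⟩ =>
    purePerfect_coker hf.1 hf.2 (exact_of_isColimit _ hk) (surjective_of_isColimit _ hk)

instance : (purePerfect R).ContainsZero where
  exists_zero := ⟨_, isZero_zero _, purePerfect_of_id_eq_zero <| by
    rw [GradedHom.id, (isZero_zero _).eq_of_src (𝟙 _) 0, map_zero]⟩

instance : (purePerfect R).IsClosedUnderIsomorphisms where
  of_iso e hX := purePerfect_ker (f := 0) hX hX (injective_of_mono e.inv) fun i x =>
    ⟨fun _ => surjective_of_epi e.inv i x, fun _ => rfl⟩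

instance : (purePerfect R).IsClosedUnderBinaryProducts where
  limitsOfShape_le := fun X ⟨p⟩ => by
    let A := p.diag.obj ⟨.left⟩
    let B := p.diag.obj ⟨.right⟩
    have h : IsShortExact (biprod.inl : A ⟶ A ⊞ B) biprod.snd :=
      ⟨injective_of_mono _, exact_of_isLimit _ (biprod.isKernelSndKernelFork A B),
        surjective_of_epi _⟩
    refine (purePerfect R).prop_of_iso ?_
      (h.purePerfect_middle (p.prop_diag_obj ⟨.left⟩) (p.prop_diag_obj ⟨.right⟩))
    exact IsLimit.conePointUniqueUpToIso (BinaryBiproduct.isLimit A B)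
      ((IsLimit.postcomposeHomEquiv (diagramIsoPair p.diag) _).2 p.isLimit)

instance : (purePerfect R).IsClosedUnderFiniteProducts := .mk'

end

section Heart

open Limits

variable [R.Admissible]

lemma toBar_eq_zero_of_mem_finiteRank {e : GradedHom M M 0} (he : e ∈ finiteRank {0} M M 0)
    {i : ℤ} (hi : 0 < i) (x : M.X i) : M.toBar.f i (e.f (add_zero i) x) = 0 := by
  induction he using finiteRank_induction with
  | zero => exact map_zero _
  | add e e' _ _ he he' => rw [GradedHom.add_f, map_add, he, he', add_zero]
  | comp n hn q hq a y =>
    obtain rfl : n = 0 := hn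
    obtain rfl : q = 0 := by omega
    rw [GradedHom.comp_f _ _ hq _ (add_zero i) (add_zero i)]
    exact (M.toBar.map_act (zero_add i) y _).trans (bar_act_of_pos (zero_add i) hi _ _)

lemma IsPure.subsingleton_bar (hM : M.IsPure) {i : ℤ} (hi : i ≠ 0) :
    Subsingleton (M.bar.X i) := by
  refine subsingleton_of_forall_eq 0 fun y => ?_
  obtain ⟨x, rfl⟩ := M.toBar_surjective i y
  rcases hi.lt_or_gt with hi | hi
  · have := hM.subsingleton_of_neg hi
    rw [Subsingleton.elim (α := M.X i) x 0, map_zero]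
  · exact toBar_eq_zero_of_mem_finiteRank hM hi x

lemma purePerfect.isHeart (hM : purePerfect R M) : isHeart R ((toHot R).obj M) :=
  ⟨hM.2, fun _ hi =>
    have := hM.1.subsingleton_bar hi
    (QuotientAddGroup.mk_surjective.subsingleton : Subsingleton (M.bar.cohomology _))⟩

lemma IsPure.toHot_map_injective (hM : M.IsPure) (hN : N.IsPure) :
    Function.Injective ((toHot R).map : (M ⟶ N) → _) := fun f g h => by
  obtain ⟨s, hs⟩ := ((toHot_map_eq_iff_isExact f g).1 h).exists_δ_eq (neg_add_cancel 1)
  have := hN.subsingleton_of_neg (neg_one_lt_zero (R := ℤ))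
  have hs0 : s = 0 := hM.hom_ext fun x => Subsingleton.elim (α := N.X (-1)) _ _
  rw [hs0, map_zero] at hs
  exact ofHom_injective (sub_eq_zero.1 hs.symm)

variable (R) in
/-- The functor from the pure perfect dg modules to the heart; it is an equivalence. -/
def toHeart : (purePerfect R).FullSubcategory ⥤ Heart R :=
  (isHeart R).lift ((purePerfect R).ι ⋙ toHot R) fun M => purePerfect.isHeart M.property

instance : (toHeart R).Faithful where
  map_injective {M N} _ _ h := InducedCategory.hom_ext <|
    M.property.1.toHot_map_injective N.property.1 (congrArg (fun φ => φ.hom) h)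

instance : (toHeart R).Full where
  map_surjective f :=
    have ⟨g, hg⟩ := (toHot R).map_surjective f.hom
    ⟨ObjectProperty.homMk g, InducedCategory.hom_ext hg⟩

instance : (toHeart R).EssSurj where
  mem_essImage X := by
    obtain ⟨M, hM, ⟨e⟩⟩ := X.property.1.exists_isPure_iso X.property.2
    exact ⟨⟨M, hM, .summand ⟨e.inv, e.hom, e.inv_hom_id⟩ X.property.1⟩,
      ⟨(isHeart R).isoMk e.symm⟩⟩

instance : (toHeart R).IsEquivalence where

instance : HasFiniteProducts (Heart R) where
  out _ := Adjunction.hasLimitsOfShape_of_equivalence (toHeart R).inv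

instance : Abelian (Heart R) := abelianOfEquivalence (toHeart R).inv

variable (R) in
/-- The functor sending a dg module to its component of degree zero. -/
def degreeZero : DGMod R ⥤ ModuleCat (R.gr 0)ᵐᵒᵖ where
  obj M := ModuleCat.of _ (M.X 0)
  map f := ModuleCat.ofHom ((ofHom f).linearMap (add_zero 0))

instance : ((purePerfect R).ι ⋙ degreeZero R).Faithful where
  map_injective {M _} _ _ h := InducedCategory.hom_ext <| ofHom_injective <|
    M.property.1.hom_ext fun x => congrArg (fun φ => φ.hom x) h

instance : ((purePerfect R).ι ⋙ degreeZero R).PreservesMonomorphisms where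
  preserves f _ := (ModuleCat.mono_iff_injective _).2 <| by
    have := (purePerfect R).preservesMonomorphisms_ι_of_isNormalEpiCategory
    exact injective_of_mono ((purePerfect R).ι.map f) 0

instance (X : Heart R) : IsArtinianObject X := by
  let F := (toHeart R).inv ⋙ (purePerfect R).ι ⋙ degreeZero R
  have : Module.Finite (R.gr 0)ᵐᵒᵖ (F.obj X) := ((toHeart R).inv.obj X).property.1.finite
  have : IsArtinianObject (F.obj X) :=
    ⟨(ModuleCat.subobjectModule (F.obj X)).strictMono.wellFoundedLT⟩
  exact isArtinianObject_of_faithful F X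

lemma exists_comp_eq_of_subsingleton_cohomology (hM : purePerfect R M) (hN : purePerfect R N)
    {f : M ⟶ N} (hf : ∀ i, Function.Injective (f.f i)) (hJ : Subsingleton (J.cohomology 1))
    (g : M ⟶ J) : ∃ g' : N ⟶ J, f ≫ g' = g := by
  have h : IsShortExact f (DGSubmodule.range f).π :=
    ⟨hf, exact_range_π f, DGSubmodule.π_surjective _⟩
  have hQ := purePerfect_coker hM hN h.exact h.surjective
  obtain ⟨σ⟩ := h.nonempty_gradedSplitting_of_isFinProj hQ.1
  exact σ.exists_comp_eq h g (hQ.1.isExact_of_subsingleton_cohomology hQ.2.isHomotopyProjective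
    hQ.1 (q := 𝟙 _) (fun _ => Function.surjective_id) hJ
    ((σ.isClosed_connecting h).comp (isClosed_ofHom g) (add_zero 1)))

lemma exists_toHeart_map_comp_eq {I : Heart R} (hI : Subsingleton (I.obj.as.cohomology 1))
    {X Y : (purePerfect R).FullSubcategory} (f : X ⟶ Y) [Mono f] (g : (toHeart R).obj X ⟶ I) :
    ∃ g', (toHeart R).map f ≫ g' = g := by
  have := (purePerfect R).preservesMonomorphisms_ι_of_isNormalEpiCategory
  obtain ⟨g₀, hg₀⟩ := (toHot R).map_surjective (X := X.obj) (Y := I.obj.as) g.hom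
  obtain ⟨e, rfl⟩ := exists_comp_eq_of_subsingleton_cohomology X.property Y.property
    (injective_of_mono ((purePerfect R).ι.map f)) hI g₀
  exact ⟨ObjectProperty.homMk ((toHot R).map e),
    InducedCategory.hom_ext (((toHot R).map_comp _ _).symm.trans hg₀)⟩

lemma injective_of_subsingleton_cohomology {I : Heart R}
    (hI : Subsingleton (I.obj.as.cohomology 1)) : Injective I where
  factors {X Y} g f _ := by
    let F := (toHeart R).asEquivalence
    obtain ⟨e, he⟩ : ∃ e : F.functor.obj (F.inverse.obj Y) ⟶ I,
        F.functor.map (F.inverse.map f) ≫ e = F.counit.app X ≫ g :=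
      exists_toHeart_map_comp_eq hI (F.inverse.map f) _
    have hf : f ≫ F.counitInv.app Y = F.counitInv.app X ≫ F.functor.map (F.inverse.map f) :=
      F.counitInv.naturality f
    exact ⟨F.counitInv.app Y ≫ e, by rw [reassoc_of% hf, he]; simp⟩

lemma isZero_toHeart_obj_iff (M : (purePerfect R).FullSubcategory) :
    IsZero ((toHeart R).obj M) ↔ Subsingleton (M.obj.X 0) := by
  refine ⟨fun h => ?_, fun h => (toHeart R).map_isZero ((IsZero.iff_id_eq_zero M).2 ?_)⟩
  · have h₀ := (IsZero.iff_id_eq_zero M).1 (h.of_full_of_faithful_of_isZero (toHeart R) M)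
    exact subsingleton_of_forall_eq 0 fun x => congrArg (fun φ => φ.hom.f 0 x) h₀
  · exact InducedCategory.hom_ext <| ofHom_injective <| M.property.1.hom_ext fun x =>
      Subsingleton.elim (α := M.obj.X 0) _ _

section

variable (L : Type u) [AddCommGroup L] [Module (R.gr 0)ᵐᵒᵖ L] [IsSimpleModule (R.gr 0)ᵐᵒᵖ L]

lemma purePerfect_hat : purePerfect R (hat R L) :=
  ⟨isPure_hat, isPerfect_hat⟩

lemma not_isZero_heartHat : ¬IsZero (heartHat R L) := by
  have := IsSimpleModule.nontrivial (R.gr 0)ᵐᵒᵖ L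
  exact fun h => not_subsingleton ((hat R L).X 0)
    ((isZero_toHeart_obj_iff ⟨_, purePerfect_hat L⟩).1 h)

end

lemma exists_heartHat_mono {X : Heart R} (hX : ¬IsZero X) :
    ∃ (L : Type u) (_ : AddCommGroup L) (_ : Module (R.gr 0)ᵐᵒᵖ L)
      (_ : IsSimpleModule (R.gr 0)ᵐᵒᵖ L) (i : heartHat R L ⟶ X), Mono i := by
  let M := (toHeart R).objPreimage X
  let e : (toHeart R).obj M ≅ X := (toHeart R).objObjPreimageIso X
  have : Nontrivial (M.obj.X 0) := not_subsingleton_iff_nontrivial.1 fun h =>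
    hX (((isZero_toHeart_obj_iff M).2 h).of_iso e.symm)
  obtain ⟨L, hL, ι, r, hr⟩ := M.property.1.exists_hat_splitMono
    M.property.2.isHomotopyProjective M.property.1 (q := 𝟙 _) fun _ => Function.surjective_id
  let ι' : (⟨_, purePerfect_hat L⟩ : (purePerfect R).FullSubcategory) ⟶ M :=
    ObjectProperty.homMk ι
  have : Mono ((purePerfect R).ι.map ι') :=
    mono_of_injective _ fun i => injective_of_ofHom_comp_eq_id hr i
  have : Mono ι' := (purePerfect R).ι.mono_of_mono_map this
  exact ⟨L, inferInstance, inferInstance, hL, (toHeart R).map ι' ≫ e.hom,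
    mono_comp ((toHeart R).map ι') e.hom⟩

end Heart

end DGMod

end

theorem proposition6p8 {k : Type w} [CommRing k] (R : DGAlgebra.{w, u} k) [R.Admissible]
    (I : DGMod.Heart R)
    (hI : Subsingleton (I.obj.as.cohomology 1))
    (hL : ∀ (L : Type u) [AddCommGroup L] [Module (R.gr 0)ᵐᵒᵖ L] [IsSimpleModule (R.gr 0)ᵐᵒᵖ L],
      ∃ f : DGMod.heartHat R L ⟶ I, Mono f) :
    ∃ hfg : ∀ M : (DGMod.Heart R)ᵒᵖ, ModuleCat.isFG (End I) ((preadditiveYonedaObj I).obj M),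
      ((ModuleCat.isFG (End I)).lift (preadditiveYonedaObj I) hfg).rightOp.IsEquivalence := by
  have : Injective I := DGMod.injective_of_subsingleton_cohomology hI
  refine preadditiveYonedaObj_lift_isEquivalence (isCoseparator_of_injective fun X hX => ?_)
  obtain ⟨L, _, _, _, i, hi⟩ := DGMod.exists_heartHat_mono hX
  obtain ⟨j, hj⟩ := hL L
  exact ⟨_, i, j, hi, fun h => DGMod.not_isZero_heartHat L (Limits.IsZero.of_mono_eq_zero j h)⟩
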